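/- **Rounding Lemma.** There are a deterministic parallel algorithm and a constant $C$ such that the following holds. Let $H=(V,E)$ be a (finite, simple, undirected) graph with $n\ge 1$ nodes and $m$ edges, whose nodes have distinct identifiers in $[n]$. Let every node $v\in V$ have a (potentially negative) utility $util(v)\in\mathbb{R}$, let every edge $e\in E$ have a cost $cost(e)\in\mathbb{R}_{\ge 0}$, and let $\varepsilon>0$ be a real number. Given $H$ (as adjacency lists), $util$, $cost$ and $\varepsilon$, the algorithm computes a set $V'\subseteq V$ such that $$\sum_{v\in V'} util(v)-\sum_{e\in E\cap\binom{V'}{2}}cost(e)\ \ge\ \Big(\sum_{v\in V}\tfrac12\, util(v)-\sum_{e\in E}\tfrac14\, cost(e)\Big)-\varepsilon\sum_{e\in E}cost(e),$$ using work $O((m+n)\log\log n)$ and depth $\operatorname{poly}(\log n/\varepsilon)$; that is, work at most $C\,(m+n)\max\{1,\log\log n\}$ (with $\log\log 1$ read as $0$) and depth at most $C\,\big(\max\{1,\log n\}/\min\{1,\varepsilon\}\big)^{C}$. Here the model is the work-depth model: in each time unit any number of processors concurrently perform operations on a shared memory, with concurrent reads and concurrent writes, and an arbitrary one of several concurrent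 writes to a memory location takes place (the algorithm has to be correct however these conflicts are resolved). The work is the total number of operations and the depth is the number of steps, performed one after the other. The algorithm is a single program that does not depend on the input. A memory cell holds either an integer of $O(\log n)$ bits or a real number, with unit-cost arithmetic and comparisons on each, and no rounding of reals to integers. -/

import Mathlib

/-!  Work-depth model (work-time presentation of the PRAM).  An algorithm is one fixed program,
independent of the input: sequential control over time units, where a time unit consists of an
arbitrary number of operations executed concurrently by processors `0, …, N - 1` on a shared
memory.  Within a time unit all reads precede all writes; of several concurrent writes to one
location an arbitrary one takes place.  Memory cells hold either a machine word of `w` bits or a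
real number (the real-RAM convention, needed since utilities and costs are arbitrary reals; there
is no rounding of reals to words).  The memory is organised in a fixed number of arrays. -/

namespace WorkDepth

/-- Binary operations on machine words. -/
inductive WOp
  | add | sub | mul | div | mod | lt | eq

/-- Binary operations on reals. -/
inductive ROp
  | add | sub | mul | div

/-- The two kinds of memory cells and of expressions. -/
inductive Ty
  | word | real

/-- Expressions evaluated by one processor.  `pid` is the index of the processor;
`wload a e` and `rload a e` read the entry with index `e` of the word array, respectively
real array, with number `a`; `rle x y` is the result (1 or 0) of the comparison `x ≤ y`. -/
inductive Exp : Ty → Type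
  | lit (k : ℕ) : Exp Ty.word
  | pid : Exp Ty.word
  | wload (a : ℕ) (e : Exp Ty.word) : Exp Ty.word
  | wop (o : WOp) (x y : Exp Ty.word) : Exp Ty.word
  | rle (x y : Exp Ty.real) : Exp Ty.word
  | rload (a : ℕ) (e : Exp Ty.word) : Exp Ty.real
  | rop (o : ROp) (x y : Exp Ty.real) : Exp Ty.real
  | ofWord (x : Exp Ty.word) : Exp Ty.real

/-- Number of elementary operations performed when evaluating an expression. -/
def Exp.size : {τ : Ty} → Exp τ → ℕ
  | _, .lit _ => 1
  | _, .pid => 1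
  | _, .wload _ e => e.size + 1
  | _, .wop _ x y => x.size + y.size + 1
  | _, .rle x y => x.size + y.size + 1
  | _, .rload _ e => e.size + 1
  | _, .rop _ x y => x.size + y.size + 1
  | _, .ofWord x => x.size + 1

/-- Programs.  `wstore N g a e v` (and likewise `rstore`, for real arrays) is a time unit in which
all processors `i < N` for which the guard `g` is nonzero concurrently write the value of `v` into
the entry with index `e` of the array `a`; here `g`, `e`, `v` are evaluated by each processor with
its own index.  With `N = 1` this is an ordinary assignment. -/
inductive Cmd
  | wstore (N g : Exp Ty.word) (a : ℕ) (e : Exp Ty.word) (v : Exp Ty.word)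
  | rstore (N g : Exp Ty.word) (a : ℕ) (e : Exp Ty.word) (v : Exp Ty.real)
  | seq (c d : Cmd)
  | cond (b : Exp Ty.word) (c d : Cmd)
  | loop (b : Exp Ty.word) (c : Cmd)

/-- Shared memory, together with the work and the depth spent so far. -/
structure State where
  wmem : ℕ → ℕ → ℕ
  rmem : ℕ → ℕ → ℝ
  work : ℕ
  depth : ℕ

/-- Values of expressions. -/
abbrev Val : Ty → Type
  | Ty.word => ℕ
  | Ty.real => ℝ

/-- Arithmetic on `w`-bit words: sums and products are reduced modulo `2 ^ w`, subtraction is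
truncated at `0`, division is integer division, comparisons return `1` or `0`. -/
def WOp.eval (w : ℕ) : WOp → ℕ → ℕ → ℕ
  | .add, x, y => (x + y) % 2 ^ w
  | .sub, x, y => x - y
  | .mul, x, y => (x * y) % 2 ^ w
  | .div, x, y => x / y
  | .mod, x, y => x % y
  | .lt, x, y => if x < y then 1 else 0
  | .eq, x, y => if x = y then 1 else 0

/-- Exact arithmetic on reals. -/
noncomputable def ROp.eval : ROp → ℝ → ℝ → ℝ
  | .add, x, y => x + y
  | .sub, x, y => x - y
  | .mul, x, y => x * y
  | .div, x, y => x / y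

/-- Value of an expression for the processor `i` in the state `s`, with words of `w` bits. -/
noncomputable def Exp.eval (w : ℕ) (s : State) (i : ℕ) : {τ : Ty} → Exp τ → Val τ
  | _, .lit k => k % 2 ^ w
  | _, .pid => i
  | _, .wload a e => s.wmem a (e.eval w s i) % 2 ^ w
  | _, .wop o x y => o.eval w (x.eval w s i) (y.eval w s i)
  | _, .rle x y => by
      classical exact if (show ℝ from x.eval w s i) ≤ (show ℝ from y.eval w s i) then 1 else 0
  | _, .rload a e => s.rmem a (e.eval w s i)
  | _, .rop o x y => o.eval (x.eval w s i) (y.eval w s i)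
  | _, .ofWord x => ((show ℕ from x.eval w s i : ℕ) : ℝ)

/-- A rule that resolves concurrent writes: `pick t x S` is the processor whose write takes place
when, at time `t`, the processors in `S` concurrently write into the entry with index `x`.
Algorithms have to be correct for every such rule. -/
structure Arbiter where
  pick : ℕ → ℕ → Finset ℕ → ℕ
  pick_mem : ∀ (t x : ℕ) (S : Finset ℕ), S.Nonempty → pick t x S ∈ S

/-- The processors `i < N` with nonzero guard that write into the entry with index `x`. -/
def writers (N : ℕ) (guard addr : ℕ → ℕ) (x : ℕ) : Finset ℕ :=
  (Finset.range N).filter fun i => guard i ≠ 0 ∧ addr i = x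

/-- Contents, after a concurrent write, of an array with previous contents `old`. -/
def scatter {α : Type} (A : Arbiter) (t N : ℕ) (guard addr : ℕ → ℕ) (val : ℕ → α)
    (old : ℕ → α) : ℕ → α := fun x =>
  if (writers N guard addr x).Nonempty then val (A.pick t x (writers N guard addr x)) else old x

/-- Charge `W` units of work and `D` units of depth. -/
def State.charge (s : State) (W D : ℕ) : State :=
  { s with work := s.work + W, depth := s.depth + D }

/-- `Exec w A c s s'`: started in the state `s`, the program `c` terminates in the state `s'`, on a
machine with `w`-bit words whose write conflicts are resolved by `A`.  Each of the `N` processors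
taking part in a time unit is charged for all its elementary operations (also if its guard is zero);
the depth grows by the number of operations of one processor. -/
inductive Exec (w : ℕ) (A : Arbiter) : Cmd → State → State → Prop
  | wstore (N g : Exp Ty.word) (a : ℕ) (e : Exp Ty.word) (v : Exp Ty.word) (s : State) :
      Exec w A (.wstore N g a e v) s
        (State.charge
          { s with
            wmem := Function.update s.wmem a
              (scatter A s.depth (N.eval w s 0) (fun i => g.eval w s i) (fun i => e.eval w s i)
                (fun i => v.eval w s i) (s.wmem a)) }
          (N.size + (N.eval w s 0 : ℕ) * (g.size + e.size + v.size + 1))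
          (N.size + (g.size + e.size + v.size + 1)))
  | rstore (N g : Exp Ty.word) (a : ℕ) (e : Exp Ty.word) (v : Exp Ty.real) (s : State) :
      Exec w A (.rstore N g a e v) s
        (State.charge
          { s with
            rmem := Function.update s.rmem a
              (scatter A s.depth (N.eval w s 0) (fun i => g.eval w s i) (fun i => e.eval w s i)
                (fun i => v.eval w s i) (s.rmem a)) }
          (N.size + (N.eval w s 0 : ℕ) * (g.size + e.size + v.size + 1))
          (N.size + (g.size + e.size + v.size + 1)))
  | seq {c d : Cmd} {s s₁ s₂ : State} :
      Exec w A c s s₁ → Exec w A d s₁ s₂ → Exec w A (.seq c d) s s₂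
  | condTrue {b : Exp Ty.word} {c d : Cmd} {s s₁ : State} :
      b.eval w s 0 ≠ (0 : ℕ) → Exec w A c (s.charge b.size b.size) s₁ →
        Exec w A (.cond b c d) s s₁
  | condFalse {b : Exp Ty.word} {c d : Cmd} {s s₁ : State} :
      b.eval w s 0 = (0 : ℕ) → Exec w A d (s.charge b.size b.size) s₁ →
        Exec w A (.cond b c d) s s₁
  | loopTrue {b : Exp Ty.word} {c : Cmd} {s s₁ s₂ : State} :
      b.eval w s 0 ≠ (0 : ℕ) → Exec w A c (s.charge b.size b.size) s₁ →
        Exec w A (.loop b c) s₁ s₂ → Exec w A (.loop b c) s s₂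
  | loopFalse {b : Exp Ty.word} {c : Cmd} {s : State} :
      b.eval w s 0 = (0 : ℕ) → Exec w A (.loop b c) s (s.charge b.size b.size)

/-- The state `s` holds the input: a graph `G` with node identifiers `0, …, n - 1` as adjacency
lists, with node utilities, edge costs and the parameter `ε`.
* Word array `0` holds the number `n` of nodes in its entry `0`.
* The list of the neighbours of `v`, in any order, occupies the positions
  `off v, …, off v + deg v - 1` of word array `2`, where the lists are stored one after the other
  and `off` is word array `1` (entries `0, …, n`); real array `1` holds, at the position of a
  neighbour `u` of `v`, the cost of the edge `{v, u}`.
* Real array `0` holds the utilities, and entry `0` of real array `2` holds `ε`.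
All other memory cells have arbitrary contents; no work has been done yet. -/
structure IsInput {n : ℕ} (G : SimpleGraph (Fin n)) [DecidableRel G.Adj]
    (util : Fin n → ℝ) (cost : Sym2 (Fin n) → ℝ) (ε : ℝ) (s : State) : Prop where
  nodes : s.wmem 0 0 = n
  off_zero : s.wmem 1 0 = 0
  off_succ : ∀ v : Fin n, s.wmem 1 (v + 1) = s.wmem 1 v + G.degree v
  entry : ∀ (v : Fin n) (j : ℕ), j < G.degree v → ∃ u : Fin n, G.Adj v u ∧
    s.wmem 2 (s.wmem 1 v + j) = u ∧ s.rmem 1 (s.wmem 1 v + j) = cost s(v, u)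
  listed : ∀ v u : Fin n, G.Adj v u → ∃ j < G.degree v, s.wmem 2 (s.wmem 1 v + j) = u
  utility : ∀ v : Fin n, s.rmem 0 v = util v
  eps : s.rmem 2 0 = ε
  work_zero : s.work = 0
  depth_zero : s.depth = 0

/-- The set of nodes returned by an algorithm: the nodes marked by a nonzero entry of word
array `3`. -/
def State.output (s : State) (n : ℕ) : Finset (Fin n) :=
  Finset.univ.filter fun v => s.wmem 3 v ≠ 0

end WorkDepth

namespace WorkDepth

/-! Selecting every node independently with probability 1/2 gives the expected value `∑ util / 2 - ∑
cost / 4`. The method of conditional expectations attains it deterministically: the objective is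
extended multilinearly to fractional selections, one starts at 1/2 everywhere, and the coordinates
are fixed one after the other to 0 or 1 according to the sign of the partial derivative
(`objective_step`, `objective_le`). Done sequentially, this has depth linear in the size of the
graph, so it is affordable only for a graph of size polynomial in `log n / ε`.

Such a graph is obtained by colouring the nodes with `2 * S ^ 2` colours, where `S` is about `log n
/ ε`, and contracting the colour classes; all nodes of a class then share one decision. The
objective of the contracted graph ignores the edges inside classes, so the guarantee is lost by at
most the cost of the monochromatic edges, and this has to be at most `ε` times the total cost
(`IsInput.rounding`).

The colouring starts with the identifiers, for which no edge is monochromatic. One round replaces a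
colour `x < q ^ 2` by `x % q + a * (x / q)` with a common parameter `a < S`. Two distinct colours
collide for at most one `a` (`badParam_eq`), so by averaging the best `a` makes edges of at most a
`1 / S` fraction of the total cost newly monochromatic (`monoCost_hash_le`). With `q = S * 2 ^ 2 ^
j` the range shrinks from `S ^ 2 * 2 ^ 2 ^ (j + 1)` to `S ^ 2 * 2 ^ 2 ^ j`. Hence `J`, about `log
log n`, rounds suffice (`runs_colorNodes`), and the total loss is a fraction `J / S ≤ ε`. A round
takes linear work, because one histogram evaluates all `S` parameters at once (`runs_hist`); this is
the source of the factor `log log n`. If `n ≤ S ^ 4`, the graph is already small enough and is not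
contracted (`runs_prepare`).

The programs are verified in a Hoare logic with bounds on work and depth (`Runs`). All concurrent
writes are free of conflicts, so the arbiter never matters (`scatter_spec`). -/

/-- Contents of the shared memory. -/
structure Mem where
  w : ℕ → ℕ → ℕ
  r : ℕ → ℕ → ℝ

/-- The state with given memory contents, work and depth. -/
def Mem.st (σ : Mem) (W D : ℕ) : State := ⟨σ.w, σ.r, W, D⟩

/-- The memory after replacing a word array. -/
def Mem.setW (σ : Mem) (a : ℕ) (f : ℕ → ℕ) : Mem := ⟨Function.update σ.w a f, σ.r⟩

/-- The memory after replacing a real array. -/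
def Mem.setR (σ : Mem) (a : ℕ) (f : ℕ → ℝ) : Mem := ⟨σ.w, Function.update σ.r a f⟩

@[simp] theorem Mem.setW_w (σ : Mem) (a : ℕ) (f : ℕ → ℕ) (b : ℕ) :
    (σ.setW a f).w b = if b = a then f else σ.w b := by
  simp [Mem.setW, Function.update_apply]

@[simp] theorem Mem.setW_r (σ : Mem) (a : ℕ) (f : ℕ → ℕ) : (σ.setW a f).r = σ.r := rfl

@[simp] theorem Mem.setR_r (σ : Mem) (a : ℕ) (f : ℕ → ℝ) (b : ℕ) :
    (σ.setR a f).r b = if b = a then f else σ.r b := by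
  simp [Mem.setR, Function.update_apply]

@[simp] theorem Mem.setR_w (σ : Mem) (a : ℕ) (f : ℕ → ℝ) : (σ.setR a f).w = σ.w := rfl

/-! ### Expressions -/

instance : Add (Exp Ty.word) := ⟨.wop .add⟩
instance : Sub (Exp Ty.word) := ⟨.wop .sub⟩
instance : Mul (Exp Ty.word) := ⟨.wop .mul⟩
instance : Div (Exp Ty.word) := ⟨.wop .div⟩
instance : Mod (Exp Ty.word) := ⟨.wop .mod⟩
instance (k : ℕ) : OfNat (Exp Ty.word) k := ⟨.lit k⟩
instance : Add (Exp Ty.real) := ⟨.rop .add⟩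
instance : Sub (Exp Ty.real) := ⟨.rop .sub⟩
instance : Mul (Exp Ty.real) := ⟨.rop .mul⟩
instance : Div (Exp Ty.real) := ⟨.rop .div⟩

/-- Comparison of words. -/
def Exp.lt (x y : Exp Ty.word) : Exp Ty.word := .wop .lt x y

/-- Equality test of words. -/
def Exp.eqn (x y : Exp Ty.word) : Exp Ty.word := .wop .eq x y

/-- The word register stored in entry `0` of array `a`. -/
def reg (a : ℕ) : Exp Ty.word := .wload a 0

/-- Value of a word expression. -/
noncomputable def evw (w : ℕ) (σ : Mem) (i : ℕ) (e : Exp Ty.word) : ℕ := e.eval w (σ.st 0 0) i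

/-- Value of a real expression. -/
noncomputable def evr (w : ℕ) (σ : Mem) (i : ℕ) (e : Exp Ty.real) : ℝ := e.eval w (σ.st 0 0) i

/-- Expressions cannot read the work and depth counters. Assertions can therefore be made about
memories alone, with the counters set to zero. -/
theorem eval_st (w : ℕ) (σ : Mem) (i W D : ℕ) {τ : Ty} (e : Exp τ) :
    e.eval w (σ.st W D) i = e.eval w (σ.st 0 0) i := by
  induction e with
  | lit k => rfl
  | pid => rfl
  | wload a e ih => simp only [Exp.eval, ih]; rfl
  | wop o x y ihx ihy => simp only [Exp.eval, ihx, ihy]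
  | rle x y ihx ihy => simp only [Exp.eval, ihx, ihy]
  | rload a e ih => simp only [Exp.eval, ih]; rfl
  | rop o x y ihx ihy => simp only [Exp.eval, ihx, ihy]
  | ofWord x ih => simp only [Exp.eval, ih]

theorem evw_eq (w : ℕ) (σ : Mem) (i W D : ℕ) (e : Exp Ty.word) :
    e.eval w (σ.st W D) i = evw w σ i e := eval_st w σ i W D e

theorem evr_eq (w : ℕ) (σ : Mem) (i W D : ℕ) (e : Exp Ty.real) :
    e.eval w (σ.st W D) i = evr w σ i e := eval_st w σ i W D e

section eval

variable (w : ℕ) (σ : Mem) (i : ℕ) (x y : Exp Ty.word) (u v : Exp Ty.real) (a : ℕ)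

theorem evw_zero : evw w σ i 0 = 0 := Nat.zero_mod _
theorem evw_one (hw : 0 < w) : evw w σ i 1 = 1 := Nat.mod_eq_of_lt (Nat.one_lt_two_pow hw.ne')
theorem evw_two (hw : 1 < w) : evw w σ i 2 = 2 :=
  Nat.mod_eq_of_lt (lt_of_lt_of_le (show 2 < 2 ^ 2 by norm_num) (Nat.pow_le_pow_right two_pos hw))
theorem evw_pid : evw w σ i .pid = i := rfl
theorem evw_load : evw w σ i (.wload a x) = σ.w a (evw w σ i x) % 2 ^ w := rfl
theorem evw_reg : evw w σ i (reg a) = σ.w a 0 % 2 ^ w := by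
  rw [reg, evw_load, evw_zero]
theorem evw_add : evw w σ i (x + y) = (evw w σ i x + evw w σ i y) % 2 ^ w := rfl
theorem evw_sub : evw w σ i (x - y) = evw w σ i x - evw w σ i y := rfl
theorem evw_mul : evw w σ i (x * y) = (evw w σ i x * evw w σ i y) % 2 ^ w := rfl
theorem evw_div : evw w σ i (x / y) = evw w σ i x / evw w σ i y := rfl
theorem evw_mod : evw w σ i (x % y) = evw w σ i x % evw w σ i y := rfl
theorem evw_lt : evw w σ i (x.lt y) = if evw w σ i x < evw w σ i y then 1 else 0 := rfl
theorem evw_eqn : evw w σ i (x.eqn y) = if evw w σ i x = evw w σ i y then 1 else 0 := rfl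
open Classical in
theorem evw_rle : evw w σ i (.rle u v) = if evr w σ i u ≤ evr w σ i v then 1 else 0 := rfl
theorem evr_load : evr w σ i (.rload a x) = σ.r a (evw w σ i x) := rfl
theorem evr_add : evr w σ i (u + v) = evr w σ i u + evr w σ i v := rfl
theorem evr_sub : evr w σ i (u - v) = evr w σ i u - evr w σ i v := rfl
theorem evr_mul : evr w σ i (u * v) = evr w σ i u * evr w σ i v := rfl
theorem evr_div : evr w σ i (u / v) = evr w σ i u / evr w σ i v := rfl
theorem evr_ofWord : evr w σ i (.ofWord x) = (evw w σ i x : ℝ) := rfl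

end eval

/-! ### Which arrays a program writes -/

/-- Whether a program may write the word array `a`. -/
def Cmd.writesW : Cmd → ℕ → Bool
  | .wstore _ _ b _ _, a => Nat.beq a b
  | .rstore _ _ _ _ _, _ => false
  | .seq c d, a => c.writesW a || d.writesW a
  | .cond _ c d, a => c.writesW a || d.writesW a
  | .loop _ c, a => c.writesW a

/-- Whether a program may write the real array `a`. -/
def Cmd.writesR : Cmd → ℕ → Bool
  | .wstore _ _ _ _ _, _ => false
  | .rstore _ _ b _ _, a => Nat.beq a b
  | .seq c d, a => c.writesR a || d.writesR a
  | .cond _ c d, a => c.writesR a || d.writesR a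
  | .loop _ c, a => c.writesR a

/-- The two memories agree on all arrays that `c` does not write. -/
structure Frame (c : Cmd) (σ σ' : Mem) : Prop where
  w : ∀ a, c.writesW a = false → σ'.w a = σ.w a
  r : ∀ a, c.writesR a = false → σ'.r a = σ.r a

theorem Frame.refl (c : Cmd) (σ : Mem) : Frame c σ σ := ⟨fun _ _ => rfl, fun _ _ => rfl⟩

theorem Frame.trans {c : Cmd} {σ₁ σ₂ σ₃ : Mem} (h : Frame c σ₁ σ₂) (h' : Frame c σ₂ σ₃) :
    Frame c σ₁ σ₃ :=
  ⟨fun a ha => (h'.w a ha).trans (h.w a ha), fun a ha => (h'.r a ha).trans (h.r a ha)⟩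

/-- The written arrays are over-approximated syntactically by a computable test. That a concrete
program preserves a concrete array is then proved by `rfl`, which is how registers are carried
across program parts below. -/
theorem Exec.frame {w : ℕ} {A : Arbiter} {c : Cmd} {s s' : State} (h : Exec w A c s s') :
    (∀ a, c.writesW a = false → s'.wmem a = s.wmem a) ∧
      ∀ a, c.writesR a = false → s'.rmem a = s.rmem a := by
  induction h with
  | wstore N g a e v s =>
    refine ⟨fun b hb => ?_, fun _ _ => rfl⟩
    have : b ≠ a := by
      rintro rfl
      simp [Cmd.writesW] at hb
    simp [State.charge, this]
  | rstore N g a e v s =>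
    refine ⟨fun _ _ => rfl, fun b hb => ?_⟩
    have : b ≠ a := by
      rintro rfl
      simp [Cmd.writesR] at hb
    simp [State.charge, this]
  | seq _ _ ih₁ ih₂ =>
    refine ⟨fun a ha => ?_, fun a ha => ?_⟩
    · simp only [Cmd.writesW, Bool.or_eq_false_iff] at ha
      rw [ih₂.1 a ha.2, ih₁.1 a ha.1]
    · simp only [Cmd.writesR, Bool.or_eq_false_iff] at ha
      rw [ih₂.2 a ha.2, ih₁.2 a ha.1]
  | condTrue _ _ ih =>
    refine ⟨fun a ha => ?_, fun a ha => ?_⟩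
    · simp only [Cmd.writesW, Bool.or_eq_false_iff] at ha
      exact ih.1 a ha.1
    · simp only [Cmd.writesR, Bool.or_eq_false_iff] at ha
      exact ih.2 a ha.1
  | condFalse _ _ ih =>
    refine ⟨fun a ha => ?_, fun a ha => ?_⟩
    · simp only [Cmd.writesW, Bool.or_eq_false_iff] at ha
      exact ih.1 a ha.2
    · simp only [Cmd.writesR, Bool.or_eq_false_iff] at ha
      exact ih.2 a ha.2
  | loopTrue _ _ _ ih₁ ih₂ =>
    refine ⟨fun a ha => ?_, fun a ha => ?_⟩
    · rw [ih₂.1 a ha, ih₁.1 a ha]; rfl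
    · rw [ih₂.2 a ha, ih₁.2 a ha]; rfl
  | loopFalse _ => exact ⟨fun _ _ => rfl, fun _ _ => rfl⟩

/-! ### Total correctness with resource bounds -/

/-- Started with memory `σ`, the program `c` terminates with work at most `W`, depth at most `D`
and a memory that satisfies `Q`. -/
def Runs (w : ℕ) (A : Arbiter) (c : Cmd) (σ : Mem) (W D : ℕ) (Q : Mem → Prop) : Prop :=
  ∀ W₀ D₀, ∃ (σ' : Mem) (W₁ D₁ : ℕ), Exec w A c (σ.st W₀ D₀) (σ'.st W₁ D₁) ∧
    W₁ ≤ W₀ + W ∧ D₁ ≤ D₀ + D ∧ Q σ'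

section rules

variable {w : ℕ} {A : Arbiter} {c d : Cmd} {σ : Mem} {W W' D D' : ℕ} {Q Q' : Mem → Prop}

/-- Besides weakening, the rule supplies the frame condition for free; the same holds for
`Runs.seq`. Postconditions need only mention what changes. -/
theorem Runs.conseq (h : Runs w A c σ W D Q) (hW : W ≤ W') (hD : D ≤ D')
    (hQ : ∀ σ', Q σ' → Frame c σ σ' → Q' σ') : Runs w A c σ W' D' Q' := by
  intro W₀ D₀
  obtain ⟨σ', W₁, D₁, he, h₁, h₂, h₃⟩ := h W₀ D₀
  exact ⟨σ', W₁, D₁, he, by omega, by omega, hQ _ h₃ ⟨he.frame.1, he.frame.2⟩⟩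

theorem Runs.seq (h : Runs w A c σ W D Q)
    (h' : ∀ σ', Q σ' → Frame c σ σ' → Runs w A d σ' W' D' Q') :
    Runs w A (.seq c d) σ (W + W') (D + D') Q' := by
  intro W₀ D₀
  obtain ⟨σ₁, W₁, D₁, he, h₁, h₂, h₃⟩ := h W₀ D₀
  obtain ⟨σ₂, W₂, D₂, he', h₁', h₂', h₃'⟩ := h' σ₁ h₃ ⟨he.frame.1, he.frame.2⟩ W₁ D₁
  exact ⟨σ₂, W₂, D₂, .seq he he', by omega, by omega, h₃'⟩

theorem Runs.cond {b : Exp Ty.word} (h : evw w σ 0 b ≠ 0 → Runs w A c σ W D Q)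
    (h' : evw w σ 0 b = 0 → Runs w A d σ W D Q) :
    Runs w A (.cond b c d) σ (W + b.size) (D + b.size) Q := by
  intro W₀ D₀
  by_cases hb : evw w σ 0 b = 0
  · obtain ⟨σ₁, W₁, D₁, he, h₁, h₂, h₃⟩ := h' hb (W₀ + b.size) (D₀ + b.size)
    exact ⟨σ₁, W₁, D₁, .condFalse ((evw_eq ..).trans hb) he, by omega, by omega, h₃⟩
  · obtain ⟨σ₁, W₁, D₁, he, h₁, h₂, h₃⟩ := h hb (W₀ + b.size) (D₀ + b.size)
    exact ⟨σ₁, W₁, D₁, .condTrue (fun h => hb ((evw_eq ..).symm.trans h)) he, by omega, by omega,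
      h₃⟩

theorem Exp.size_pos : ∀ {τ : Ty} (e : Exp τ), 0 < e.size
  | _, .lit _ => Nat.one_pos
  | _, .pid => Nat.one_pos
  | _, .wload _ _ => Nat.succ_pos _
  | _, .wop _ _ _ => Nat.succ_pos _
  | _, .rle _ _ => Nat.succ_pos _
  | _, .rload _ _ => Nat.succ_pos _
  | _, .rop _ _ _ => Nat.succ_pos _
  | _, .ofWord _ => Nat.succ_pos _

/-- Loop rule: `I` is an invariant, and `P` and `R` bound the work and the depth still to be
spent. -/
theorem Runs.loop {b : Exp Ty.word} (I : Mem → Prop) (P R : Mem → ℕ)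
    (h : ∀ σ', I σ' → Frame c σ σ' → evw w σ' 0 b ≠ 0 → ∃ W D, Runs w A c σ' W D fun σ'' =>
      I σ'' ∧ W + b.size + P σ'' ≤ P σ' ∧ D + b.size + R σ'' ≤ R σ')
    (hI : I σ) :
    Runs w A (.loop b c) σ (P σ + b.size) (R σ + b.size)
      fun σ' => I σ' ∧ evw w σ' 0 b = 0 := by
  -- The work potential `P` also proves termination: each iteration pays at least the evaluation of
  -- the condition, whose size is positive, so `P` strictly decreases.
  have key : ∀ (p : ℕ) (σ' : Mem), P σ' = p → I σ' → Frame c σ σ' →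
      Runs w A (.loop b c) σ' (P σ' + b.size) (R σ' + b.size)
        fun σ'' => I σ'' ∧ evw w σ'' 0 b = 0 := by
    intro p
    induction p using Nat.strong_induction_on with
    | _ p ih =>
      intro σ' hp hI' hf W₀ D₀
      by_cases hb : evw w σ' 0 b = 0
      · exact ⟨σ', W₀ + b.size, D₀ + b.size, .loopFalse ((evw_eq ..).trans hb), by omega,
          by omega, hI', hb⟩
      · obtain ⟨W, D, hr⟩ := h σ' hI' hf hb
        obtain ⟨σ₁, W₁, D₁, he, h₁, h₂, hI₁, h₃, h₄⟩ := hr (W₀ + b.size) (D₀ + b.size)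
        have := b.size_pos
        obtain ⟨σ₂, W₂, D₂, he', h₁', h₂', h₃'⟩ := ih (P σ₁) (by omega) σ₁ rfl hI₁
          (hf.trans ⟨he.frame.1, he.frame.2⟩) W₁ D₁
        exact ⟨σ₂, W₂, D₂, .loopTrue (fun h => hb ((evw_eq ..).symm.trans h)) he he', by omega,
          by omega, h₃'⟩
  exact key _ σ rfl hI (Frame.refl c σ)

/-! ### Concurrent writes without conflicts -/

/-- If active processors have distinct addresses, every nonempty set of writers is a singleton, so
the choice of the arbiter is forced. -/
theorem scatter_spec {α : Type} (A : Arbiter) (t N : ℕ) (guard addr : ℕ → ℕ) (val : ℕ → α)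
    (old : ℕ → α)
    (hinj : ∀ i < N, ∀ j < N, guard i ≠ 0 → guard j ≠ 0 → addr i = addr j → i = j) :
    (∀ i < N, guard i ≠ 0 → scatter A t N guard addr val old (addr i) = val i) ∧
      ∀ x, (∀ i < N, guard i ≠ 0 → addr i ≠ x) → scatter A t N guard addr val old x = old x := by
  constructor
  · intro i hi hg
    have hmem : i ∈ writers N guard addr (addr i) := by simp [writers, hi, hg]
    have hne : (writers N guard addr (addr i)).Nonempty := ⟨i, hmem⟩
    have hp := A.pick_mem t (addr i) _ hne
    have hp' : A.pick t (addr i) (writers N guard addr (addr i)) = i := by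
      obtain ⟨h₁, h₂⟩ := Finset.mem_filter.1 hp
      exact hinj _ (Finset.mem_range.1 h₁) i hi h₂.1 hg h₂.2
    rw [scatter, if_pos hne, hp']
  · intro x hx
    rw [scatter, if_neg]
    rintro ⟨i, hi⟩
    simp only [writers, Finset.mem_filter, Finset.mem_range] at hi
    exact hx i hi.1 hi.2.1 hi.2.2

/-- Concurrent write of words without conflicts. -/
theorem Runs.wstore {N g e : Exp Ty.word} {a : ℕ} {v : Exp Ty.word} (M : ℕ) (gv ev vv : ℕ → ℕ)
    (hN : evw w σ 0 N = M) (hg : ∀ i < M, evw w σ i g = gv i) (he : ∀ i < M, gv i ≠ 0 → evw w σ i e = ev i)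
    (hv : ∀ i < M, gv i ≠ 0 → evw w σ i v = vv i)
    (hinj : ∀ i < M, ∀ j < M, gv i ≠ 0 → gv j ≠ 0 → ev i = ev j → i = j)
    (hQ : ∀ f : ℕ → ℕ, (∀ i < M, gv i ≠ 0 → f (ev i) = vv i) →
      (∀ x, (∀ i < M, gv i ≠ 0 → ev i ≠ x) → f x = σ.w a x) → Q (σ.setW a f)) (k : ℕ)
    (hk : N.size + (g.size + e.size + v.size + 1) ≤ k) :
    Runs w A (.wstore N g a e v) σ (k * (M + 1)) k Q := by
  intro W₀ D₀
  have hex := Exec.wstore (w := w) (A := A) N g a e v (σ.st W₀ D₀)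
  simp only [evw_eq, hN] at hex
  refine ⟨σ.setW a (scatter A D₀ M (fun i => evw w σ i g)
    (fun i => evw w σ i e) (fun i => evw w σ i v) (σ.w a)), W₀ + _, D₀ + _, hex, ?_, ?_, ?_⟩
  · nlinarith
  · omega
  · obtain ⟨h₁, h₂⟩ := scatter_spec A D₀ M (fun i => evw w σ i g) (fun i => evw w σ i e)
      (fun i => evw w σ i v) (σ.w a) (fun i hi j hj => by
        intro hgi hgj
        rw [hg i hi] at hgi
        rw [hg j hj] at hgj
        rw [he i hi hgi, he j hj hgj]
        exact hinj i hi j hj hgi hgj)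
    refine hQ _ (fun i hi hgi => ?_) (fun x hx => ?_)
    · rw [← he i hi hgi, ← hv i hi hgi]; exact h₁ i hi (by rwa [hg i hi])
    · exact h₂ x fun i hi hgi => by
        rw [hg i hi] at hgi
        rw [he i hi hgi]
        exact hx i hi hgi

/-- Concurrent write of reals without conflicts. -/
theorem Runs.rstore {N g e : Exp Ty.word} {a : ℕ} {v : Exp Ty.real} (M : ℕ) (gv ev : ℕ → ℕ)
    (vv : ℕ → ℝ)
    (hN : evw w σ 0 N = M) (hg : ∀ i < M, evw w σ i g = gv i) (he : ∀ i < M, gv i ≠ 0 → evw w σ i e = ev i)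
    (hv : ∀ i < M, gv i ≠ 0 → evr w σ i v = vv i)
    (hinj : ∀ i < M, ∀ j < M, gv i ≠ 0 → gv j ≠ 0 → ev i = ev j → i = j)
    (hQ : ∀ f : ℕ → ℝ, (∀ i < M, gv i ≠ 0 → f (ev i) = vv i) →
      (∀ x, (∀ i < M, gv i ≠ 0 → ev i ≠ x) → f x = σ.r a x) → Q (σ.setR a f)) (k : ℕ)
    (hk : N.size + (g.size + e.size + v.size + 1) ≤ k) :
    Runs w A (.rstore N g a e v) σ (k * (M + 1)) k Q := by
  intro W₀ D₀
  have hex := Exec.rstore (w := w) (A := A) N g a e v (σ.st W₀ D₀)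
  simp only [evw_eq, evr_eq, hN] at hex
  refine ⟨σ.setR a (scatter A D₀ M (fun i => evw w σ i g)
    (fun i => evw w σ i e) (fun i => evr w σ i v) (σ.r a)), W₀ + _, D₀ + _, hex, ?_, ?_, ?_⟩
  · nlinarith
  · omega
  · obtain ⟨h₁, h₂⟩ := scatter_spec A D₀ M (fun i => evw w σ i g) (fun i => evw w σ i e)
      (fun i => evr w σ i v) (σ.r a) (fun i hi j hj => by
        intro hgi hgj
        rw [hg i hi] at hgi
        rw [hg j hj] at hgj
        rw [he i hi hgi, he j hj hgj]
        exact hinj i hi j hj hgi hgj)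
    refine hQ _ (fun i hi hgi => ?_) (fun x hx => ?_)
    · rw [← he i hi hgi, ← hv i hi hgi]; exact h₁ i hi (by rwa [hg i hi])
    · exact h₂ x fun i hi hgi => by
        rw [hg i hi] at hgi
        rw [he i hi hgi]
        exact hx i hi hgi

/-- Processor `i < N` writes entry `i` of the word array `a`. -/
def wpar (N : Exp Ty.word) (a : ℕ) (v : Exp Ty.word) : Cmd := .wstore N 1 a .pid v

/-- Processor `i < N` writes entry `i` of the real array `a`. -/
def rpar (N : Exp Ty.word) (a : ℕ) (v : Exp Ty.real) : Cmd := .rstore N 1 a .pid v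

/-- Assignment to an entry of a word array. -/
def wset (a : ℕ) (e v : Exp Ty.word) : Cmd := .wstore 1 1 a e v

/-- Assignment to an entry of a real array. -/
def rset (a : ℕ) (e : Exp Ty.word) (v : Exp Ty.real) : Cmd := .rstore 1 1 a e v

theorem Runs.wpar {N : Exp Ty.word} {a : ℕ} {v : Exp Ty.word} (M : ℕ) (vv : ℕ → ℕ) (hw : 0 < w)
    (hN : evw w σ 0 N = M) (hv : ∀ i < M, evw w σ i v = vv i)
    (hQ : ∀ f : ℕ → ℕ, (∀ i < M, f i = vv i) → Q (σ.setW a f)) (k : ℕ)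
    (hk : N.size + v.size + 3 ≤ k) :
    Runs w A (WorkDepth.wpar N a v) σ (k * (M + 1)) k Q := by
  refine Runs.wstore M (fun _ => 1) (fun i => i) vv hN
    (fun i _ => evw_one w σ i hw) (fun i _ _ => rfl) (fun i hi _ => hv i hi)
    (fun i _ j _ _ _ h => h) (fun f hf _ => hQ f fun i hi => hf i hi one_ne_zero) k ?_
  change N.size + (1 + 1 + v.size + 1) ≤ k
  omega

theorem Runs.rpar {N : Exp Ty.word} {a : ℕ} {v : Exp Ty.real} (M : ℕ) (vv : ℕ → ℝ) (hw : 0 < w)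
    (hN : evw w σ 0 N = M) (hv : ∀ i < M, evr w σ i v = vv i)
    (hQ : ∀ f : ℕ → ℝ, (∀ i < M, f i = vv i) → (∀ i, M ≤ i → f i = σ.r a i) → Q (σ.setR a f))
    (k : ℕ) (hk : N.size + v.size + 3 ≤ k) :
    Runs w A (WorkDepth.rpar N a v) σ (k * (M + 1)) k Q := by
  refine Runs.rstore M (fun _ => 1) (fun i => i) vv hN
    (fun i _ => evw_one w σ i hw) (fun i _ _ => rfl) (fun i hi _ => hv i hi)
    (fun i _ j _ _ _ h => h) (fun f hf hf' => hQ f (fun i hi => hf i hi one_ne_zero)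
      fun x hx => hf' x fun i hi _ => by omega) k ?_
  change N.size + (1 + 1 + v.size + 1) ≤ k
  omega

theorem Runs.wset {a : ℕ} {e v : Exp Ty.word} (x y : ℕ) (hw : 0 < w)
    (he : evw w σ 0 e = x) (hv : evw w σ 0 v = y)
    (hQ : Q (σ.setW a (Function.update (σ.w a) x y))) (k : ℕ) (hk : 2 * (e.size + v.size + 3) ≤ k) :
    Runs w A (WorkDepth.wset a e v) σ k k Q := by
  have h1 (i : ℕ) : evw w σ i 1 = 1 := evw_one w σ i hw
  refine (Runs.wstore (Q := Q) 1 (fun _ => 1) (fun _ => x) (fun _ => y) (h1 0) (fun i _ => h1 i)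
    (fun i hi _ => (by omega : i = 0) ▸ he)
    (fun i hi _ => (by omega : i = 0) ▸ hv)
    (fun i hi j hj _ _ _ => by omega) (fun f hf hf' => ?_) (e.size + v.size + 3) ?_).conseq
      (by omega) (by omega) (fun _ h _ => h)
  · convert hQ
    funext z
    by_cases hz : z = x
    · subst hz
      rw [Function.update_self]
      exact hf 0 Nat.one_pos one_ne_zero
    · rw [Function.update_of_ne hz]
      exact hf' z fun _ _ _ => Ne.symm hz
  · change 1 + (1 + e.size + v.size + 1) ≤ _
    omega

theorem Runs.rset {a : ℕ} {e : Exp Ty.word} {v : Exp Ty.real} (x : ℕ) (y : ℝ) (hw : 0 < w)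
    (he : evw w σ 0 e = x) (hv : evr w σ 0 v = y)
    (hQ : Q (σ.setR a (Function.update (σ.r a) x y))) (k : ℕ) (hk : 2 * (e.size + v.size + 3) ≤ k) :
    Runs w A (WorkDepth.rset a e v) σ k k Q := by
  have h1 (i : ℕ) : evw w σ i 1 = 1 := evw_one w σ i hw
  refine (Runs.rstore (Q := Q) 1 (fun _ => 1) (fun _ => x) (fun _ => y) (h1 0) (fun i _ => h1 i)
    (fun i hi _ => (by omega : i = 0) ▸ he)
    (fun i hi _ => (by omega : i = 0) ▸ hv)
    (fun i hi j hj _ _ _ => by omega) (fun f hf hf' => ?_) (e.size + v.size + 3) ?_).conseq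
      (by omega) (by omega) (fun _ h _ => h)
  · convert hQ
    funext z
    by_cases hz : z = x
    · subst hz
      rw [Function.update_self]
      exact hf 0 Nat.one_pos one_ne_zero
    · rw [Function.update_of_ne hz]
      exact hf' z fun _ _ _ => Ne.symm hz
  · change 1 + (1 + e.size + v.size + 1) ≤ _
    omega

/-! ### Counting loops -/

/-- `for r = lo, …, hi - 1 do c`. -/
def forLoop (r : ℕ) (lo hi : Exp Ty.word) (c : Cmd) : Cmd :=
  .seq (wset r 0 lo) (.loop ((reg r).lt hi) (.seq c (wset r 0 (reg r + 1))))

/-- Rule for counting loops with invariant `I`. -/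
theorem Runs.forLoop {r : ℕ} {lo hi : Exp Ty.word} (I : ℕ → Mem → Prop) (x y : ℕ)
    (Wf Df : ℕ → ℕ) (hw : 0 < w) (hxy : x ≤ y) (hy : y < 2 ^ w) (hlo : evw w σ 0 lo = x)
    (hr : c.writesW r = false)
    (hhi : ∀ k σ', I k σ' → Frame (WorkDepth.forLoop r lo hi c) σ σ' → evw w σ' 0 hi = y)
    (hst : ∀ k σ' f, I k σ' → I k (σ'.setW r f))
    (hI : I x σ)
    (hc : ∀ k σ', x ≤ k → k < y → I k σ' → Frame (WorkDepth.forLoop r lo hi c) σ σ' →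
      σ'.w r 0 = k → Runs w A c σ' (Wf k) (Df k) (I (k + 1)))
    (K : ℕ) (hK : 20 + 2 * (hi.size + lo.size) ≤ K) :
    Runs w A (WorkDepth.forLoop r lo hi c) σ
      (∑ k ∈ Finset.Ico x y, (Wf k + K) + K) (∑ k ∈ Finset.Ico x y, (Df k + K) + K) (I y) := by
  have hsz : ((reg r).lt hi).size = 3 + hi.size := by
    change 2 + hi.size + 1 = _
    omega
  have hset : Runs w A (WorkDepth.wset r 0 lo) σ (2 * (1 + lo.size + 3)) (2 * (1 + lo.size + 3))
      fun σ' => I x σ' ∧ σ'.w r 0 = x := by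
    exact Runs.wset 0 x hw (evw_zero ..) hlo ⟨hst _ _ _ hI, by simp⟩ _ le_rfl
  refine (hset.seq (W' := ∑ k ∈ Finset.Ico x y, (Wf k + K) + (3 + hi.size))
    (D' := ∑ k ∈ Finset.Ico x y, (Df k + K) + (3 + hi.size)) (Q' := I y) ?_).conseq
    (by omega) (by omega) fun _ h _ => h
  rintro σ₁ ⟨hI₁, hx₁⟩ hf₁
  have hf₁' : Frame (WorkDepth.forLoop r lo hi c) σ σ₁ :=
    ⟨fun a ha => hf₁.w a (by simp only [WorkDepth.forLoop, Cmd.writesW, Bool.or_eq_false_iff] at ha; exact ha.1),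
      fun a ha => hf₁.r a rfl⟩
  -- The loop invariant is `I` at the current value of the counter, and the potentials are the costs
  -- of the iterations that remain.
  have := Runs.loop (w := w) (A := A) (σ := σ₁) (c := .seq c (WorkDepth.wset r 0 (reg r + 1)))
    (b := (reg r).lt hi)
    (fun σ' => Frame (WorkDepth.forLoop r lo hi c) σ σ' ∧ x ≤ σ'.w r 0 ∧ σ'.w r 0 ≤ y ∧
      I (σ'.w r 0) σ')
    (fun σ' => ∑ k ∈ Finset.Ico (σ'.w r 0) y, (Wf k + K))
    (fun σ' => ∑ k ∈ Finset.Ico (σ'.w r 0) y, (Df k + K)) ?_ ⟨hf₁', by omega, by omega, hx₁ ▸ hI₁⟩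
  · rw [hx₁, hsz] at this
    refine this.conseq le_rfl le_rfl ?_
    rintro σ' ⟨⟨hf, h₁, h₂, hI'⟩, hb⟩ -
    rw [evw_lt, hhi _ _ hI' hf, evw_reg, Nat.mod_eq_of_lt (by omega)] at hb
    obtain h : σ'.w r 0 = y := by
      by_contra hne
      rw [if_pos (by omega)] at hb
      exact one_ne_zero hb
    rwa [h] at hI'
  · rintro σ' ⟨hf, h₁, h₂, hI'⟩ - hb
    rw [evw_lt, hhi _ _ hI' hf, evw_reg, Nat.mod_eq_of_lt (by omega)] at hb
    have hlt : σ'.w r 0 < y := by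
      by_contra hne
      exact hb (if_neg hne)
    refine ⟨Wf (σ'.w r 0) + 16, Df (σ'.w r 0) + 16, ?_⟩
    refine (hc _ σ' h₁ hlt hI' hf rfl).seq ?_
    intro σ₂ hI₂ hf₂
    have hk₂ : σ₂.w r 0 = σ'.w r 0 := by rw [hf₂.w r hr]
    refine Runs.wset 0 (σ'.w r 0 + 1) hw (evw_zero ..) ?_ ?_ _ ?_
    · rw [evw_add, evw_reg, evw_one w _ _ hw, hk₂,
        Nat.mod_eq_of_lt (show σ'.w r 0 < 2 ^ w by omega), Nat.mod_eq_of_lt (by omega)]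
    · have hv : ((σ₂.setW r (Function.update (σ₂.w r) 0 (σ'.w r 0 + 1))).w r 0) = σ'.w r 0 + 1 := by
        simp
      refine ⟨⟨⟨fun a ha => ?_, fun a ha => ?_⟩, ?_, ?_, ?_⟩, ?_, ?_⟩
      · rw [← hf.w a ha]
        simp only [WorkDepth.forLoop, Cmd.writesW, Bool.or_eq_false_iff, WorkDepth.wset] at ha
        have hne : a ≠ r := by
          rintro rfl
          simp at ha
        rw [Mem.setW_w, if_neg hne, hf₂.w a ha.2.1]
      · rw [← hf.r a ha]
        simp only [WorkDepth.forLoop, Cmd.writesR, Bool.or_eq_false_iff, WorkDepth.wset] at ha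
        rw [Mem.setW_r, hf₂.r a ha.2.1]
      · rw [hv]; omega
      · rw [hv]; omega
      · rw [hv]; exact hst _ _ _ hI₂
      · rw [hv, hsz, Finset.sum_eq_sum_Ico_succ_bot hlt]
        omega
      · rw [hv, hsz, Finset.sum_eq_sum_Ico_succ_bot hlt]
        omega
    · exact Nat.le_of_ble_eq_true rfl

end rules

/-! ### Histograms -/

theorem mul_add_inj {S i j a b : ℕ} (ha : a < S) (hb : b < S) (h : i * S + a = j * S + b) :
    i = j ∧ a = b := by
  have hS : 0 < S := by omega
  have h₁ : (i * S + a) / S = i := by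
    rw [Nat.add_div_of_dvd_right (Nat.dvd_mul_left ..), Nat.mul_div_cancel _ hS,
      Nat.div_eq_of_lt ha, add_zero]
  have h₂ : (j * S + b) / S = j := by
    rw [Nat.add_div_of_dvd_right (Nat.dvd_mul_left ..), Nat.mul_div_cancel _ hS,
      Nat.div_eq_of_lt hb, add_zero]
  rw [h, h₂] at h₁
  subst h₁
  exact ⟨rfl, by omega⟩

theorem mul_add_lt {S R i a : ℕ} (hi : i < R) (ha : a < S) : i * S + a < R * S := by
  have : (i + 1) * S ≤ R * S := Nat.mul_le_mul_right _ hi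
  linarith [Nat.succ_mul i S, Nat.add_one i]

theorem sum_range_mul {M : Type*} [AddCommMonoid M] (R S : ℕ) (f : ℕ → M) :
    ∑ p ∈ Finset.range (R * S), f p
      = ∑ i ∈ Finset.range R, ∑ j ∈ Finset.range S, f (i * S + j) := by
  induction R with
  | zero => simp
  | succ R ih => rw [Nat.succ_mul, Finset.sum_range_add, ih, Finset.sum_range_succ]

/-- Add the values of the `j`-th items of all blocks to the histograms of the blocks. -/
def histStep : Cmd :=
  .rstore (reg 32) ((.pid * reg 31 + reg 33 : Exp Ty.word).lt (reg 30)) 10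
    (.pid * reg 31 + .wload 24 (.pid * reg 31 + reg 33))
    (.rload 10 (.pid * reg 31 + .wload 24 (.pid * reg 31 + reg 33)) +
      .rload 11 (.pid * reg 31 + reg 33))

/-- Add the histograms of the second half of the blocks to those of the first half. -/
def histFold : Cmd :=
  .seq (wset 34 0 ((reg 32 + 1) / 2)) <|
  .seq (rpar ((reg 32 - reg 34) * reg 31) 10 (.rload 10 .pid + .rload 10 (.pid + reg 34 * reg 31)))
  (wset 32 0 (reg 34))

/-- Histogram: the number of items is in register `30`, the number of keys in register `31`, the
keys are in word array `24` and the values in real array `11`; the result is stored in real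
array `10`.  The items are divided into blocks whose length is the number of keys. -/
def hist : Cmd :=
  .seq (wset 32 0 (reg 30 / reg 31 + 1)) <|
  .seq (rpar (reg 32 * reg 31) 10 (.ofWord 0)) <|
  .seq (forLoop 33 0 (reg 31) histStep)
  (.loop ((1 : Exp Ty.word).lt (reg 32)) histFold)

section

variable {w : ℕ} {A : Arbiter} {σ : Mem}

/-- Block `i` writes only to row `i` of an `R × S` table. By `mul_add_inj` different blocks never
write to the same cell, whatever the keys are. -/
theorem runs_histStep {N S R j : ℕ} (hS : 0 < S) (hw : R * S < 2 ^ w) (hRS : N ≤ R * S)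
    (h30 : σ.w 30 0 = N) (h31 : σ.w 31 0 = S) (h32 : σ.w 32 0 = R) (h33 : σ.w 33 0 = j)
    (hj : j < S) (hkey : ∀ p < N, σ.w 24 p < S) :
    Runs w A histStep σ (60 * (R + 1)) 60 fun σ' => ∀ i < R, ∀ k < S, σ'.r 10 (i * S + k) =
      σ.r 10 (i * S + k) + if i * S + j < N ∧ σ.w 24 (i * S + j) = k then
        σ.r 11 (i * S + j) else 0 := by
  have hR : R ≤ R * S := Nat.le_mul_of_pos_right _ hS
  have hp : ∀ i < R, evw w σ i (.pid * reg 31 + reg 33 : Exp Ty.word) = i * S + j := by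
    intro i hi
    have h₁ := mul_add_lt hi hj
    have h₂ : S ≤ R * S := Nat.le_mul_of_pos_left _ (by omega)
    simp (disch := omega) only [evw_add, evw_mul, evw_reg, evw_pid, h31, h33, Nat.mod_eq_of_lt]
  have hk : ∀ i < R, i * S + j < N → evw w σ i (.pid * reg 31 +
      .wload 24 (.pid * reg 31 + reg 33) : Exp Ty.word) = i * S + σ.w 24 (i * S + j) := by
    intro i hi hij
    have h₁ := hkey _ hij
    have h₂ : S ≤ R * S := Nat.le_mul_of_pos_left _ (by omega)
    have h₃ := mul_add_lt hi h₁
    rw [evw_add, evw_load, hp i hi]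
    simp (disch := omega) only [evw_mul, evw_reg, evw_pid, h31, Nat.mod_eq_of_lt]
  refine Runs.rstore R (fun i => if i * S + j < N then 1 else 0)
    (fun i => i * S + σ.w 24 (i * S + j))
    (fun i => σ.r 10 (i * S + σ.w 24 (i * S + j)) + σ.r 11 (i * S + j)) ?_ ?_ ?_ ?_ ?_ ?_ _
    (Nat.le_of_ble_eq_true rfl)
  · rw [evw_reg, h32, Nat.mod_eq_of_lt (by omega)]
  · intro i hi
    rw [evw_lt, hp i hi, evw_reg, h30, Nat.mod_eq_of_lt (by omega)]
  · intro i hi hg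
    exact hk i hi (by by_contra h; simp [h] at hg)
  · intro i hi hg
    rw [evr_add, evr_load, evr_load, hp i hi, hk i hi (by by_contra h; simp [h] at hg)]
  · intro i hi i' hi' hg hg' he
    have h₁ : i * S + j < N := by by_contra h; simp [h] at hg
    have h₂ : i' * S + j < N := by by_contra h; simp [h] at hg'
    exact (mul_add_inj (hkey _ h₁) (hkey _ h₂) he).1
  · intro f hf hf' i hi k hk
    rw [Mem.setR_r, if_pos rfl]
    by_cases h : i * S + j < N ∧ σ.w 24 (i * S + j) = k
    · rw [if_pos h, ← h.2]
      exact hf i hi (by simp [h.1])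
    · rw [if_neg h, add_zero]
      refine hf' _ fun i' hi' hg he => h ?_
      have h₂ : i' * S + j < N := by by_contra h; simp [h] at hg
      obtain ⟨rfl, h₃⟩ := mul_add_inj (hkey _ h₂) hk he
      exact ⟨h₂, h₃⟩

/-- The last `R - (R + 1) / 2` rows are added to as many initial rows, which preserves every column
sum. -/
theorem runs_histFold {S R : ℕ} (hw : 1 < w) (hR : 1 < R) (hS : 0 < S) (hw' : R * S + S < 2 ^ w)
    (h31 : σ.w 31 0 = S) (h32 : σ.w 32 0 = R) :
    Runs w A histFold σ (60 * ((R - (R + 1) / 2) * S + 1)) 100 fun σ' =>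
      σ'.w 32 0 = (R + 1) / 2 ∧ ∀ k < S, ∑ i ∈ Finset.range ((R + 1) / 2), σ'.r 10 (i * S + k) =
        ∑ i ∈ Finset.range R, σ.r 10 (i * S + k) := by
  have hRS : R ≤ R * S := Nat.le_mul_of_pos_right _ hS
  have hSR : S ≤ R * S := Nat.le_mul_of_pos_left _ (by omega)
  set R' := (R + 1) / 2 with hR'
  have hle : R' * S ≤ R * S := Nat.mul_le_mul_right _ (by omega)
  have hle' : (R - R') * S ≤ R * S := Nat.mul_le_mul_right _ (by omega)
  have hsum : (R - R') * S + R' * S = R * S := by rw [← Nat.add_mul]; congr 1; omega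
  refine Runs.conseq (W := 20 + (35 * ((R - R') * S + 1) + 12)) (D := 20 + (35 + 12)) (Runs.seq
    (Q := fun σ' => σ'.r = σ.r ∧ σ'.w 34 0 = R') (Runs.wset 0 R' (by omega) (evw_zero ..) ?_ ?_ _ ?_)
    fun σ₁ h₁ hf₁ => ?_) ?_ ?_ fun _ h _ => h
  · simp (disch := omega) only [evw_div, evw_add, evw_reg, evw_one, evw_two, h32, Nat.mod_eq_of_lt]
    exact hR'.symm
  · simp
  · exact Nat.le_of_ble_eq_true rfl
  · have g31 : σ₁.w 31 0 = S := by rw [hf₁.w 31 rfl, h31]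
    have g32 : σ₁.w 32 0 = R := by rw [hf₁.w 32 rfl, h32]
    refine Runs.seq (Q := fun σ' => ∀ k < S, ∑ i ∈ Finset.range R', σ'.r 10 (i * S + k) =
        ∑ i ∈ Finset.range R, σ.r 10 (i * S + k)) (Runs.rpar ((R - R') * S)
        (fun x => σ.r 10 x + σ.r 10 (x + R' * S)) (by omega) ?_ ?_ ?_ _
        (Nat.le_of_ble_eq_true rfl)) ?_
    · simp (disch := omega) only [evw_sub, evw_mul, evw_reg, g31, g32, h₁.2, Nat.mod_eq_of_lt]
    · intro x hx
      rw [evr_add, evr_load, evr_load, h₁.1]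
      simp (disch := omega) only [evw_pid, evw_add, evw_mul, evw_reg, g31, h₁.2, Nat.mod_eq_of_lt]
    · intro f hf hf' k hk
      simp only [Mem.setR_r, if_true]
      -- `d` counts the kept rows that have no partner: one if `R` is odd, none otherwise.
      obtain ⟨d, hd⟩ : ∃ d, R' = R - R' + d := ⟨R' - (R - R'), by omega⟩
      have e1 : Finset.range R = Finset.range (R' + (R - R')) := by congr 1; omega
      rw [e1, Finset.sum_range_add]
      rw [show Finset.range R' = Finset.range ((R - R') + d) by rw [← hd], Finset.sum_range_add,
        Finset.sum_range_add, add_right_comm, ← Finset.sum_add_distrib]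
      refine congrArg₂ _ (Finset.sum_congr rfl fun i hi => ?_) (Finset.sum_congr rfl fun i hi => ?_)
      · rw [hf _ (mul_add_lt (Finset.mem_range.1 hi) hk)]
        congr 2
        ring
      · rw [hf', h₁.1]
        have : (R - R') * S ≤ (R - R' + i) * S := Nat.mul_le_mul_right _ (by omega)
        omega
    · intro σ₂ h₂ hf₂
      refine Runs.wset 0 R' (by omega) (evw_zero ..) ?_ ⟨by simp, by simpa using h₂⟩ _
        (Nat.le_of_ble_eq_true rfl)
      rw [evw_reg, hf₂.w 34 rfl, h₁.2, Nat.mod_eq_of_lt (by omega)]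
  · have : 1 ≤ (R - R') * S := Nat.mul_pos (by omega) hS
    omega
  · omega

/-- With blocks as long as the number of keys, the table of all block histograms has at most `N + S`
cells. Filling it takes `S` steps with one processor per block. Folding halves the number of rows
each time, so its work is a geometric sum and its depth logarithmic. -/
theorem runs_hist {N S : ℕ} (hw : 1 < w) (hS : 0 < S) (hw' : N + 2 * S + 2 < 2 ^ w)
    (h30 : σ.w 30 0 = N) (h31 : σ.w 31 0 = S) (hkey : ∀ p < N, σ.w 24 p < S) :
    Runs w A hist σ (1000 * (N + S)) (1000 * (S + Nat.clog 2 (N + 1))) fun σ' => ∀ k < S,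
      σ'.r 10 k = ∑ p ∈ Finset.range N, if σ.w 24 p = k then σ.r 11 p else 0 := by
  set R := N / S + 1 with hR
  have hR0 : 0 < R := Nat.succ_pos _
  have hNR : N ≤ R * S := by
    have := Nat.lt_div_mul_add hS (a := N)
    rw [hR, Nat.succ_mul]
    omega
  have hRN : R * S ≤ N + S := by
    have := Nat.div_mul_le_self N S
    rw [hR, Nat.succ_mul]
    omega
  have hRS : R ≤ R * S := Nat.le_mul_of_pos_right _ hS
  have hRN' : R ≤ N + 1 := by
    have := Nat.div_le_self N S
    omega
  refine Runs.conseq (W := 24 + (20 * (R * S + 1) + ((60 * (R + 1) + 40) * S + 40 + (60 * (R * S) + 100 * R + 4))))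
    (D := 24 + (20 + (100 * S + 40 + (104 * Nat.clog 2 R + 4)))) (Runs.seq
    (Q := fun σ' => σ'.w 32 0 = R) (Runs.wset 0 R (by omega) (evw_zero ..) ?_ ?_ _ ?_)
    fun σ₁ h₁ hf₁ => ?_) ?_ ?_ fun _ h _ => h
  · simp (disch := omega) only [evw_div, evw_add, evw_reg, evw_one, h30, h31, Nat.mod_eq_of_lt]
    exact hR.symm
  · simp
  · exact Nat.le_of_ble_eq_true rfl
  · refine Runs.seq (Q := fun σ' => ∀ x < R * S, σ'.r 10 x = 0) (Runs.rpar (R * S) (fun _ => 0)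
      (by omega) ?_ ?_ ?_ _ (Nat.le_of_ble_eq_true rfl)) fun σ₂ h₂ hf₂ => ?_
    · have := hf₁.w 31 rfl
      simp (disch := omega) only [evw_mul, evw_reg, h₁, this, h31, Nat.mod_eq_of_lt]
    · intro i hi
      rw [evr_ofWord, evw_zero, Nat.cast_zero]
    · intro f hf _ x hx
      simpa using hf x hx
    · have g30 : σ₂.w 30 0 = N := by rw [hf₂.w 30 rfl, hf₁.w 30 rfl, h30]
      have g31 : σ₂.w 31 0 = S := by rw [hf₂.w 31 rfl, hf₁.w 31 rfl, h31]
      have g32 : σ₂.w 32 0 = R := by rw [hf₂.w 32 rfl, h₁]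
      have g24 : σ₂.w 24 = σ.w 24 := by rw [hf₂.w 24 rfl, hf₁.w 24 rfl]
      have g11 : σ₂.r 11 = σ.r 11 := by rw [hf₂.r 11 rfl, hf₁.r 11 rfl]
      refine Runs.seq (((Runs.forLoop (σ := σ₂) (fun j σ' => ∀ i < R, ∀ k < S,
        σ'.r 10 (i * S + k) = ∑ j' ∈ Finset.range j,
          if i * S + j' < N ∧ σ.w 24 (i * S + j') = k then σ.r 11 (i * S + j') else 0)
        0 S (fun _ => 60 * (R + 1)) (fun _ => 60) (by omega) (by omega) (by omega) (evw_zero ..) rfl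
        ?_ ?_ ?_ ?_ 40 (Nat.le_of_ble_eq_true rfl))).conseq ?_ ?_ fun _ h _ => h)
        fun σ₃ h₃ hf₃ => ?_
      · intro _ σ' _ hf
        rw [evw_reg, hf.w 31 rfl, g31, Nat.mod_eq_of_lt (by omega)]
      · intro _ σ' f h
        simpa using h
      · intro i hi k hk
        simpa using h₂ _ (mul_add_lt hi hk)
      · intro j σ' _ hj hI hf hj'
        refine (runs_histStep hS (by omega) hNR ((congrFun (hf.w 30 rfl) 0).trans g30)
          ((congrFun (hf.w 31 rfl) 0).trans g31) ((congrFun (hf.w 32 rfl) 0).trans g32) hj' hj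
          ?_).conseq le_rfl le_rfl ?_
        · rw [hf.w 24 rfl, g24]
          exact hkey
        · intro σ'' h'' _ i hi k hk
          rw [h'' i hi k hk, hI i hi k hk, Finset.sum_range_succ, hf.w 24 rfl, hf.r 11 rfl, g24, g11]
      · simp only [Finset.sum_const, Nat.card_Ico, smul_eq_mul]
        rw [Nat.sub_zero, Nat.mul_comm]
      · simp only [Finset.sum_const, Nat.card_Ico, smul_eq_mul]
        omega
      · have k31 : σ₃.w 31 0 = S := by rw [hf₃.w 31 rfl, g31]
        have k32 : σ₃.w 32 0 = R := by rw [hf₃.w 32 rfl, g32]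
        have := Runs.loop (w := w) (A := A) (σ := σ₃) (c := histFold)
          (b := (1 : Exp Ty.word).lt (reg 32))
          (fun σ' => 0 < σ'.w 32 0 ∧ σ'.w 32 0 ≤ R ∧ ∀ k < S,
            ∑ i ∈ Finset.range (σ'.w 32 0), σ'.r 10 (i * S + k) =
              ∑ i ∈ Finset.range R, σ₃.r 10 (i * S + k))
          -- A fold removes at least one row. The first term pays for the cells that are removed,
          -- the second for the constant overhead of a fold.
          (fun σ' => 60 * (σ'.w 32 0 * S) + 100 * σ'.w 32 0)
          (fun σ' => 104 * Nat.clog 2 (σ'.w 32 0)) ?_ ⟨by omega, by omega, fun k hk => by rw [k32]⟩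
        · rw [k32] at this
          refine this.conseq le_rfl le_rfl ?_
          rintro σ' ⟨⟨hpos, hle, hs⟩, hb⟩ - k hk
          rw [evw_lt, evw_reg, evw_one _ _ _ (by omega), Nat.mod_eq_of_lt (by omega)] at hb
          have h1 : σ'.w 32 0 = 1 := by
            by_contra hne
            rw [if_pos (by omega)] at hb
            exact one_ne_zero hb
          have hs := hs k hk
          rw [h1, Finset.sum_range_one, zero_mul, zero_add] at hs
          rw [hs, Finset.sum_congr rfl fun i hi => h₃ i (Finset.mem_range.1 hi) k hk]
          rw [← sum_range_mul R S fun p => if p < N ∧ σ.w 24 p = k then σ.r 11 p else 0]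
          rw [← Finset.sum_subset (Finset.range_subset_range.2 hNR)]
          · refine Finset.sum_congr rfl fun p hp => ?_
            simp [Finset.mem_range.1 hp]
          · intro p _ hp
            rw [Finset.mem_range] at hp
            simp [hp]
        · rintro σ' ⟨hpos, hle, hs⟩ hf hb
          rw [evw_lt, evw_reg, evw_one _ _ _ (by omega), Nat.mod_eq_of_lt (by omega)] at hb
          have h1 : 1 < σ'.w 32 0 := by
            by_contra hne
            exact hb (if_neg hne)
          have hle' : σ'.w 32 0 * S ≤ R * S := Nat.mul_le_mul_right _ hle
          refine ⟨_, _, (runs_histFold (R := σ'.w 32 0) hw h1 hS (by omega)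
            ((congrFun (hf.w 31 rfl) 0).trans k31) rfl).conseq le_rfl le_rfl ?_⟩
          rintro σ'' ⟨h₁, h₂⟩ hf'
          refine ⟨⟨by omega, by omega, fun k hk => ?_⟩, ?_, ?_⟩
          · rw [h₁, h₂ k hk, hs k hk]
          · rw [h₁, show ((1 : Exp Ty.word).lt (reg 32)).size = 4 from rfl]
            have hsum : (σ'.w 32 0 - (σ'.w 32 0 + 1) / 2) * S + (σ'.w 32 0 + 1) / 2 * S
                = σ'.w 32 0 * S := by
              rw [← Nat.add_mul]; congr 1; omega
            omega
          · rw [h₁, show ((1 : Exp Ty.word).lt (reg 32)).size = 4 from rfl,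
              Nat.clog_of_two_le (n := σ'.w 32 0) Nat.one_lt_two h1]
            rw [show σ'.w 32 0 + 2 - 1 = σ'.w 32 0 + 1 by omega]
            omega
  · have : (60 * (R + 1) + 40) * S = 60 * (R * S) + 100 * S := by ring
    omega
  · have : Nat.clog 2 R ≤ Nat.clog 2 (N + 1) := Nat.clog_mono_right _ hRN'
    omega

end

/-! ### The sequential greedy algorithm -/

/-- The node in register `41` is selected if this does not decrease the objective function. -/
def greedyNode : Cmd :=
  .seq (rset 14 (reg 41) (.ofWord 0)) <|
  .seq (rset 15 0 (.rload 13 (reg 41))) <|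
  .seq (forLoop 42 (.wload 25 (reg 41)) (.wload 25 (reg 41 + 1))
    (rset 15 0 (.rload 15 0 - .rload 12 (reg 42) * .rload 14 (.wload 26 (reg 42)))))
  (rset 14 (reg 41) (.ofWord (.rle (.ofWord 0) (.rload 15 0))))

/-- Sequential greedy rounding of a weighted graph: the number of nodes is in register `40`, the
offsets and entries of the adjacency lists are in word arrays `25` and `26`, the costs of the list
entries in real array `12` and the utilities in real array `13`.  The fractional selection,
initially `1 / 2` everywhere, is in real array `14`. -/
def greedy : Cmd :=
  .seq (rpar (reg 40) 14 (.ofWord 1 / .ofWord 2)) (forLoop 41 0 (reg 40) greedyNode)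

/-- The selection value of `d` at the time when the greedy algorithm processes `c`. -/
noncomputable def partialSel (X : ℕ → ℝ) (c d : ℕ) : ℝ :=
  if d < c then X d else if d = c then 0 else 1 / 2

open Classical in
/-- `X` results from the greedy algorithm. -/
def IsGreedy (K : ℕ) (off nbr : ℕ → ℕ) (cst util X : ℕ → ℝ) : Prop :=
  ∀ c < K, X c = if 0 ≤ util c -
    ∑ p ∈ Finset.Ico (off c) (off (c + 1)), cst p * partialSel X c (nbr p) then 1 else 0

/-- The decision at `c` depends only on the decisions below `c`, so a greedy prefix remains valid
when later entries are overwritten. -/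
theorem IsGreedy.congr {K : ℕ} {off nbr : ℕ → ℕ} {cst util X Y : ℕ → ℝ}
    (h : IsGreedy K off nbr cst util X) (hXY : ∀ c < K, X c = Y c) :
    IsGreedy K off nbr cst util Y := by
  intro c hc
  have : ∀ d, partialSel X c d = partialSel Y c d := by
    intro d
    unfold partialSel
    split_ifs with h₁
    · exact hXY d (by omega)
    · rfl
    · rfl
  rw [← hXY c hc, h c hc]
  simp only [this]

theorem sum_Ico_sub {f : ℕ → ℕ} {K : ℕ} (hf : ∀ c < K, f c ≤ f (c + 1)) :
    f 0 ≤ f K ∧ ∑ c ∈ Finset.Ico 0 K, (f (c + 1) - f c) = f K - f 0 := by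
  induction K with
  | zero => simp
  | succ K ih =>
    obtain ⟨h₁, h₂⟩ := ih fun c hc => hf c (by omega)
    have := hf K (by omega)
    rw [Finset.sum_Ico_succ_top (Nat.zero_le _), h₂]
    omega

theorem le_of_step {f : ℕ → ℕ} {K : ℕ} (hf : ∀ c < K, f c ≤ f (c + 1)) {a b : ℕ} (hab : a ≤ b)
    (hb : b ≤ K) : f a ≤ f b := by
  induction b, hab using Nat.le_induction with
  | base => rfl
  | succ b _ ih => exact (ih (by omega)).trans (hf b (by omega))

section

variable {w : ℕ} {A : Arbiter} {σ : Mem}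

/-- Entry `c` is set to 0 before its list is scanned, so that loops at `c`, which contraction
produces, contribute nothing. The accumulated value is the partial derivative of the objective with
respect to `c`. -/
theorem runs_greedyNode {c N : ℕ} (hw : 0 < w) (hc : c + 1 < 2 ^ w) (hN : N < 2 ^ w)
    (hoff : σ.w 25 c ≤ σ.w 25 (c + 1)) (hoff' : σ.w 25 (c + 1) ≤ N) (h41 : σ.w 41 0 = c)
    (hnbr : ∀ p < N, σ.w 26 p < 2 ^ w) (X : ℕ → ℝ) (hX : X = Function.update (σ.r 14) c 0) :
    Runs w A greedyNode σ (100 * (σ.w 25 (c + 1) - σ.w 25 c) + 200)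
      (100 * (σ.w 25 (c + 1) - σ.w 25 c) + 200) fun σ' => σ'.r 14 = Function.update X c
        (open Classical in if 0 ≤ σ.r 13 c -
          ∑ p ∈ Finset.Ico (σ.w 25 c) (σ.w 25 (c + 1)), σ.r 12 p * X (σ.w 26 p) then 1 else 0) := by
  refine Runs.conseq (W := 14 + (14 + ((100 * (σ.w 25 (c + 1) - σ.w 25 c) + 50) + 22)))
    (D := 14 + (14 + ((100 * (σ.w 25 (c + 1) - σ.w 25 c) + 50) + 22)))
    (Runs.seq (Q := fun σ' => σ'.r 14 = X) (Runs.rset c 0 hw ?_ ?_ ?_ _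
      (Nat.le_of_ble_eq_true rfl))
    fun σ₁ h₁ hf₁ => Runs.seq (Q := fun σ' => σ'.r 14 = X ∧ σ'.r 15 0 = σ.r 13 c)
      (Runs.rset 0 (σ.r 13 c) hw (evw_zero ..) ?_ ?_ _ (Nat.le_of_ble_eq_true rfl))
    fun σ₂ h₂ hf₂ => ?_) (by omega) (by omega) fun _ h _ => h
  · rw [evw_reg, h41, Nat.mod_eq_of_lt (by omega)]
  · rw [evr_ofWord, evw_zero, Nat.cast_zero]
  · simp [hX]
  · rw [evr_load, evw_reg, hf₁.w 41 rfl, h41, Nat.mod_eq_of_lt (by omega), hf₁.r 13 rfl]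
  · simp [h₁]
  have g41 : σ₂.w 41 0 = c := by rw [hf₂.w 41 rfl, hf₁.w 41 rfl, h41]
  have g25 : σ₂.w 25 = σ.w 25 := by rw [hf₂.w 25 rfl, hf₁.w 25 rfl]
  have g26 : σ₂.w 26 = σ.w 26 := by rw [hf₂.w 26 rfl, hf₁.w 26 rfl]
  have g12 : σ₂.r 12 = σ.r 12 := by rw [hf₂.r 12 rfl, hf₁.r 12 rfl]
  refine Runs.seq ((Runs.forLoop (σ := σ₂) (fun p σ' => σ'.r 14 = X ∧ σ'.r 15 0 = σ.r 13 c -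
      ∑ q ∈ Finset.Ico (σ.w 25 c) p, σ.r 12 q * X (σ.w 26 q))
    (σ.w 25 c) (σ.w 25 (c + 1)) (fun _ => 40) (fun _ => 40) hw hoff (by omega) ?_ rfl ?_ ?_ ?_ ?_ 50
    (Nat.le_of_ble_eq_true rfl)).conseq ?_ ?_ fun _ h _ => h) fun σ₃ h₃ hf₃ => ?_
  · rw [evw_load, evw_reg, g41, g25, Nat.mod_eq_of_lt (show c < 2 ^ w by omega),
      Nat.mod_eq_of_lt (by omega)]
  · intro _ σ' _ hf
    rw [evw_load, evw_add, evw_reg, evw_one _ _ _ hw, hf.w 41 rfl, hf.w 25 rfl, g41, g25,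
      Nat.mod_eq_of_lt (show c < 2 ^ w by omega), Nat.mod_eq_of_lt hc, Nat.mod_eq_of_lt (by omega)]
  · intro _ σ' f h
    simpa using h
  · simpa using h₂
  · rintro p σ' hp hp' ⟨hI, hI'⟩ hf h42
    refine Runs.rset 0 _ hw (evw_zero ..) rfl ?_ _ (Nat.le_of_ble_eq_true rfl)
    refine ⟨by simpa using hI, ?_⟩
    have := hnbr p (by omega)
    simp only [Mem.setR_r, if_true, Function.update_self]
    rw [evr_sub, evr_mul, evr_load, evr_load, evr_load, evw_load, evw_reg, evw_zero, h42,
      Nat.mod_eq_of_lt (show p < 2 ^ w by omega), hI, hI', hf.r 12 rfl, hf.w 26 rfl, g26, g12,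
      Nat.mod_eq_of_lt this, Finset.sum_Ico_succ_top hp]
    ring
  · simp only [Finset.sum_const, Nat.card_Ico, smul_eq_mul]
    omega
  · simp only [Finset.sum_const, Nat.card_Ico, smul_eq_mul]
    omega
  · refine Runs.rset c _ hw ?_ rfl ?_ _ (Nat.le_of_ble_eq_true rfl)
    · rw [evw_reg, hf₃.w 41 rfl, g41, Nat.mod_eq_of_lt (by omega)]
    · simp only [Mem.setR_r, if_true]
      rw [evr_ofWord, evw_rle, evr_ofWord, evw_zero, evr_load, evw_zero, h₃.1, h₃.2]
      simp

/-- The list lengths telescope to the total number of entries, which makes both work and depth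
linear in the size of the (small) graph. -/
theorem runs_greedy {K N : ℕ} (hw : 1 < w) (hK : K + 1 < 2 ^ w) (hN : N < 2 ^ w)
    (h40 : σ.w 40 0 = K) (hoff : ∀ c < K, σ.w 25 c ≤ σ.w 25 (c + 1)) (hoff' : σ.w 25 K = N)
    (hnbr : ∀ p < N, σ.w 26 p < K) :
    Runs w A greedy σ (1000 * (N + K + 1)) (1000 * (N + K + 1)) fun σ' =>
      IsGreedy K (σ.w 25) (σ.w 26) (σ.r 12) (σ.r 13) (σ'.r 14) := by
  refine Runs.conseq (W := 20 * (K + 1) + (100 * N + 240 * K + 40))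
    (D := 20 + (100 * N + 240 * K + 40))
    (Runs.seq (Q := fun σ' => ∀ c < K, σ'.r 14 c = 1 / 2) (Runs.rpar K (fun _ => 1 / 2) (by omega)
      ?_ ?_ ?_ _ (Nat.le_of_ble_eq_true rfl)) fun σ₁ h₁ hf₁ => ?_) (by omega) (by omega)
      fun _ h _ => h
  · rw [evw_reg, h40, Nat.mod_eq_of_lt (by omega)]
  · intro i _
    rw [evr_div, evr_ofWord, evr_ofWord, evw_one _ _ _ (by omega), evw_two _ _ _ hw]
    norm_num
  · intro f hf _ c hc
    simpa using hf c hc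
  have hle : ∑ c ∈ Finset.Ico 0 K, (100 * (σ.w 25 (c + 1) - σ.w 25 c) + 200 + 40) + 40 ≤
      100 * N + 240 * K + 40 := by
    have := (sum_Ico_sub hoff).2
    simp only [Finset.sum_add_distrib, ← Finset.mul_sum, this, Finset.sum_const, Nat.card_Ico,
      smul_eq_mul, hoff']
    omega
  have g40 : σ₁.w 40 0 = K := by rw [hf₁.w 40 rfl, h40]
  have g25 : σ₁.w 25 = σ.w 25 := by rw [hf₁.w 25 rfl]
  have g26 : σ₁.w 26 = σ.w 26 := by rw [hf₁.w 26 rfl]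
  have g12 : σ₁.r 12 = σ.r 12 := by rw [hf₁.r 12 rfl]
  have g13 : σ₁.r 13 = σ.r 13 := by rw [hf₁.r 13 rfl]
  refine (Runs.forLoop (σ := σ₁) (fun c σ' =>
      IsGreedy c (σ.w 25) (σ.w 26) (σ.r 12) (σ.r 13) (σ'.r 14) ∧ ∀ d, c ≤ d → d < K →
        σ'.r 14 d = 1 / 2) 0 K (fun c => 100 * (σ.w 25 (c + 1) - σ.w 25 c) + 200)
    (fun c => 100 * (σ.w 25 (c + 1) - σ.w 25 c) + 200) (by omega) (by omega) (by omega)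
    (evw_zero ..) rfl ?_ ?_ ?_ ?_ 40 (Nat.le_of_ble_eq_true rfl)).conseq hle hle fun _ h _ => h.1
  · intro _ σ' _ hf
    rw [evw_reg, hf.w 40 rfl, g40, Nat.mod_eq_of_lt (by omega)]
  · intro _ σ' f h
    simpa using h
  · exact ⟨fun c hc => absurd hc (Nat.not_lt_zero c), fun d _ hd => h₁ d hd⟩
  · rintro c σ' - hc ⟨hI, hI'⟩ hf h41
    have e25 : σ'.w 25 = σ.w 25 := by rw [hf.w 25 rfl, g25]
    have e26 : σ'.w 26 = σ.w 26 := by rw [hf.w 26 rfl, g26]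
    have e12 : σ'.r 12 = σ.r 12 := by rw [hf.r 12 rfl, g12]
    have e13 : σ'.r 13 = σ.r 13 := by rw [hf.r 13 rfl, g13]
    have hcN : σ.w 25 (c + 1) ≤ N := hoff' ▸ le_of_step hoff (by omega) le_rfl
    have := runs_greedyNode (A := A) (σ := σ') (c := c) (N := N) (w := w) (by omega) (by omega) hN
      (by rw [e25]; exact hoff c hc) (by rwa [e25]) h41
      (by rw [e26]; exact fun p hp => (hnbr p hp).trans (by omega)) _ rfl
    rw [e25, e26, e12, e13] at this
    refine this.conseq le_rfl le_rfl fun σ'' h _ => ?_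
    rw [Function.update_idem] at h
    have hlt : ∀ d, d ≠ c → σ''.r 14 d = σ'.r 14 d := fun d hd => by
      rw [h, Function.update_of_ne hd]
    refine ⟨fun d hd => ?_, fun d hd hdK => ?_⟩
    · rcases Nat.lt_succ_iff_lt_or_eq.1 hd with hd | rfl
      · exact (hI.congr fun e he => (hlt e (by omega)).symm) d hd
      · rw [h, Function.update_self]
        -- The array seen while processing `d` is exactly `partialSel` of the updated array: entries
        -- below `d` are final, entry `d` is 0, and later ones are still 1/2.
        have : ∀ p ∈ Finset.Ico (σ.w 25 d) (σ.w 25 (d + 1)),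
            σ.r 12 p * Function.update (σ'.r 14) d 0 (σ.w 26 p) =
              σ.r 12 p * partialSel (Function.update (σ'.r 14) d
                (open Classical in if 0 ≤ σ.r 13 d - ∑ p ∈ Finset.Ico (σ.w 25 d) (σ.w 25 (d + 1)),
                  σ.r 12 p * Function.update (σ'.r 14) d 0 (σ.w 26 p) then 1 else 0)) d
                (σ.w 26 p) := by
          intro p hp
          rw [Finset.mem_Ico] at hp
          congr 1
          have hp' := hnbr p (by omega)
          rw [partialSel]
          by_cases h₁ : σ.w 26 p < d
          · rw [if_pos h₁, Function.update_of_ne (by omega), Function.update_of_ne (by omega)]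
          · rw [if_neg h₁]
            by_cases h₂ : σ.w 26 p = d
            · rw [if_pos h₂, h₂, Function.update_self]
            · rw [if_neg h₂, Function.update_of_ne h₂, hI' _ (by omega) hp']
        rw [← Finset.sum_congr rfl this]
    · rw [hlt d (by omega), hI' d (by omega) hdK]

end

/-! ### The owners of the list positions -/

/-- Position `p` belongs to the adjacency list of node `v`. -/
def Owns (n : ℕ) (off : ℕ → ℕ) (v p : ℕ) : Prop := v < n ∧ off v ≤ p ∧ p < off (v + 1)

theorem Owns.unique {n : ℕ} {off : ℕ → ℕ} (hoff : ∀ v < n, off v ≤ off (v + 1)) {u v p : ℕ}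
    (hu : Owns n off u p) (hv : Owns n off v p) : u = v := by
  obtain ⟨hu, hu₁, hu₂⟩ := hu
  obtain ⟨hv, hv₁, hv₂⟩ := hv
  by_contra hne
  rcases lt_or_gt_of_ne hne with h | h
  · have := le_of_step hoff (a := u + 1) (b := v) h hv.le
    omega
  · have := le_of_step hoff (a := v + 1) (b := u) h hu.le
    omega

theorem exists_owns {n : ℕ} {off : ℕ → ℕ} (h0 : off 0 = 0) {p : ℕ} (hp : p < off n) :
    ∃ v, Owns n off v p := by
  induction n with
  | zero => omega
  | succ n ih =>
    by_cases h : p < off n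
    · obtain ⟨v, hv, h'⟩ := ih h
      exact ⟨v, by omega, h'⟩
    · exact ⟨n, by omega, by omega, hp⟩

/-- One step of the binary searches for the owners of the first positions of the blocks. -/
def bisect : Cmd :=
  .seq (wpar (reg 15) 27 ((.wload 22 .pid + .wload 23 .pid) / 2)) <|
  .seq (.wstore (reg 15) ((.pid * reg 12 : Exp Ty.word).lt (.wload 1 (.wload 27 .pid))) 23 .pid
    (.wload 27 .pid))
  (.wstore (reg 15) ((0 : Exp Ty.word).eqn
    ((.pid * reg 12 : Exp Ty.word).lt (.wload 1 (.wload 27 .pid)))) 22 .pid (.wload 27 .pid))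

/-- Copy the owner of the `j`-th position of each block to the next position, if this has none. -/
def scanStep : Cmd :=
  .wstore (reg 15) ((.pid * reg 12 + reg 17 + 1 : Exp Ty.word).lt (reg 10) *
    (Exp.wload 20 (.pid * reg 12 + reg 17 + 1)).eqn (reg 0)) 20 (.pid * reg 12 + reg 17 + 1)
    (.wload 20 (.pid * reg 12 + reg 17))

/-- Compute in word array `20` the owners of all list positions. -/
def fillSrc : Cmd :=
  .seq (wpar (reg 10) 20 (reg 0)) <|
  .seq (.wstore (reg 0) ((Exp.wload 1 .pid).lt (.wload 1 (.pid + 1))) 20 (.wload 1 .pid) .pid) <|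
  .seq (wset 15 0 (reg 10 / reg 12 + 1)) <|
  .seq (wpar (reg 15) 22 0) <|
  .seq (wpar (reg 15) 23 (reg 0)) <|
  .seq (forLoop 16 0 (reg 11) bisect) <|
  .seq (.wstore (reg 15) ((.pid * reg 12 : Exp Ty.word).lt (reg 10)) 20 (.pid * reg 12)
    (.wload 22 .pid))
  (forLoop 17 0 (reg 12) scanStep)

section

variable {w : ℕ} {A : Arbiter} {σ : Mem}

/-- All blocks bisect in parallel for the owner of their first position `i * S`. The upper bound is
conditional on `i * S < N` because the last block is empty when `S` divides `N`. -/
theorem runs_bisect {n N S R e : ℕ} (hw : 1 < w) (hn : 2 * n < 2 ^ w) (hRS : R * S < 2 ^ w)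
    (hR : R < 2 ^ w) (hS : S < 2 ^ w) (h12 : σ.w 12 0 = S) (h15 : σ.w 15 0 = R)
    (hoff : ∀ v ≤ n, σ.w 1 v < 2 ^ w)
    (hI : ∀ i < R, σ.w 22 i < σ.w 23 i ∧ σ.w 23 i ≤ n ∧ σ.w 1 (σ.w 22 i) ≤ i * S ∧
      (i * S < N → i * S < σ.w 1 (σ.w 23 i)) ∧ σ.w 23 i - σ.w 22 i ≤ 2 ^ (e + 1)) :
    Runs w A bisect σ (60 * (R + 1)) 60 fun σ' => ∀ i < R, σ'.w 22 i < σ'.w 23 i ∧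
      σ'.w 23 i ≤ n ∧ σ.w 1 (σ'.w 22 i) ≤ i * S ∧ (i * S < N → i * S < σ.w 1 (σ'.w 23 i)) ∧
      σ'.w 23 i - σ'.w 22 i ≤ 2 ^ e := by
  have hiS : ∀ i < R, i * S < 2 ^ w := fun i hi => (Nat.mul_le_mul_right S hi.le).trans_lt hRS
  set mid : ℕ → ℕ := fun i => (σ.w 22 i + σ.w 23 i) / 2 with hmid
  have hmidn : ∀ i < R, mid i ≤ n := fun i hi => by
    obtain ⟨h₁, h₂, -⟩ := hI i hi
    simp only [hmid]
    omega
  refine Runs.conseq (W := 20 * (R + 1) + (20 * (R + 1) + 20 * (R + 1))) (D := 20 + (20 + 20))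
    (Runs.seq (Q := fun σ' => ∀ i < R, σ'.w 27 i = mid i) (Runs.wpar R mid (by omega) ?_ ?_ ?_ _
      (Nat.le_of_ble_eq_true rfl)) fun σ₁ h₁ hf₁ => Runs.seq (Q := fun σ' => ∀ i < R, σ'.w 23 i =
        if i * S < σ.w 1 (mid i) then mid i else σ.w 23 i) (Runs.wstore R
        (fun i => if i * S < σ.w 1 (mid i) then 1 else 0) (fun i => i) mid ?_ ?_ ?_ ?_ ?_ ?_ _
        (Nat.le_of_ble_eq_true rfl)) fun σ₂ h₂ hf₂ => Runs.wstore R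
        (fun i => if i * S < σ.w 1 (mid i) then 0 else 1) (fun i => i) mid ?_ ?_ ?_ ?_ ?_ ?_ _
        (Nat.le_of_ble_eq_true rfl))
    (by omega) (by omega) fun _ h _ => h
  · rw [evw_reg, h15, Nat.mod_eq_of_lt hR]
  · intro i hi
    obtain ⟨h₁, h₂, -⟩ := hI i hi
    simp (disch := omega) only [evw_div, evw_add, evw_load, evw_pid, evw_two, Nat.mod_eq_of_lt]
    rfl
  · intro f hf i hi
    simpa using hf i hi
  · rw [evw_reg, hf₁.w 15 rfl, h15, Nat.mod_eq_of_lt hR]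
  · intro i hi
    have h₃ := hmidn i hi
    have h₄ := hoff _ h₃
    have h₅ := hiS i hi
    simp (disch := omega) only [evw_lt, evw_mul, evw_load, evw_pid, evw_reg, hf₁.w 12 rfl,
      hf₁.w 1 rfl, h12, h₁ i hi, Nat.mod_eq_of_lt]
  · intro i hi _
    rfl
  · intro i hi _
    rw [evw_load, evw_pid, h₁ i hi, Nat.mod_eq_of_lt (by have := hmidn i hi; omega)]
  · intro i hi j hj _ _ h
    exact h
  · intro f hf hf' i hi
    rw [Mem.setW_w, if_pos rfl]
    split_ifs with h
    · exact hf i hi (by simp [h])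
    · rw [hf' i ?_, hf₁.w 23 rfl]
      rintro j hj hg rfl
      simp [h] at hg
  · rw [evw_reg, hf₂.w 15 rfl, hf₁.w 15 rfl, h15, Nat.mod_eq_of_lt hR]
  · intro i hi
    have h₃ := hmidn i hi
    have h₄ := hoff _ h₃
    have h₅ := hiS i hi
    simp (disch := omega) only [evw_lt, evw_mul, evw_load, evw_pid, evw_reg, evw_eqn, evw_zero,
      hf₁.w 12 rfl, hf₁.w 1 rfl, h12, hf₂.w 12 rfl, hf₂.w 1 rfl, hf₂.w 27 rfl, h₁ i hi,
      Nat.mod_eq_of_lt]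
    split_ifs <;> simp_all
  · intro i hi _
    rfl
  · intro i hi _
    rw [evw_load, evw_pid, hf₂.w 27 rfl, h₁ i hi,
      Nat.mod_eq_of_lt (by have := hmidn i hi; omega)]
  · intro i hi j hj _ _ h
    exact h
  · intro f hf hf' i hi
    obtain ⟨g₁, g₂, g₃, g₄, g₅⟩ := hI i hi
    have hm : mid i = (σ.w 22 i + σ.w 23 i) / 2 := rfl
    have hpow : 2 ^ (e + 1) = 2 * 2 ^ e := by ring
    have hpos : 0 < 2 ^ e := by positivity
    have k22 : f i = if i * S < σ.w 1 (mid i) then σ.w 22 i else mid i := by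
      split_ifs with h
      · rw [hf' i ?_, hf₂.w 22 rfl, hf₁.w 22 rfl]
        rintro j hj hg rfl
        simp [h] at hg
      · exact hf i hi (by simp [h])
    simp only [Mem.setW_w, if_true, h₂ i hi, k22, show (23 : ℕ) ≠ 22 by decide, if_false]
    by_cases h : i * S < σ.w 1 (mid i)
    · simp only [h, if_true]
      -- The lower end never passes the test, so the interval stays nonempty when its upper end
      -- moves to the midpoint.
      have hne : mid i ≠ σ.w 22 i := by
        intro he
        rw [he] at h
        omega
      exact ⟨by omega, by omega, g₃, fun _ => trivial, by omega⟩
    · simp only [h, if_false]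
      exact ⟨by omega, by omega, by omega, g₄, by omega⟩

/-- The entry `n`, which is not a node, means that no owner has been recorded yet. First positions
of nonempty lists are always marked, so an unmarked position has the same owner as its predecessor.
-/
theorem runs_scanStep {n N S R j : ℕ} (hw : 1 < w) (hn : n < 2 ^ w) (hRS : R * S + S + 1 < 2 ^ w)
    (hNR : N ≤ R * S) (hR : R < 2 ^ w) (hj : j < S)
    (h0 : σ.w 0 0 = n) (h10 : σ.w 10 0 = N) (h12 : σ.w 12 0 = S) (h15 : σ.w 15 0 = R)
    (h17 : σ.w 17 0 = j) (hoff : ∀ v < n, σ.w 1 v ≤ σ.w 1 (v + 1)) (hoff0 : σ.w 1 0 = 0)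
    (hoffn : σ.w 1 n = N)
    (ha : ∀ p < N, σ.w 20 p = n ∨ Owns n (σ.w 1) (σ.w 20 p) p)
    (hb : ∀ v < n, σ.w 1 v < σ.w 1 (v + 1) → σ.w 20 (σ.w 1 v) = v)
    (hc : ∀ i k, k ≤ j → i * S + k < N → Owns n (σ.w 1) (σ.w 20 (i * S + k)) (i * S + k)) :
    Runs w A scanStep σ (60 * (R + 1)) 60 fun σ' =>
      (∀ p < N, σ'.w 20 p = n ∨ Owns n (σ.w 1) (σ'.w 20 p) p) ∧
      (∀ v < n, σ.w 1 v < σ.w 1 (v + 1) → σ'.w 20 (σ.w 1 v) = v) ∧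
      ∀ i k, k ≤ j + 1 → i * S + k < N → Owns n (σ.w 1) (σ'.w 20 (i * S + k)) (i * S + k) := by
  have hS : S ≤ R * S ∨ R = 0 := by
    rcases Nat.eq_zero_or_pos R with h | h
    · exact Or.inr h
    · exact Or.inl (Nat.le_mul_of_pos_left _ h)
  have hp : ∀ i < R, evw w σ i (.pid * reg 12 + reg 17 : Exp Ty.word) = i * S + j := by
    intro i hi
    have h₁ := mul_add_lt hi hj
    simp (disch := omega) only [evw_add, evw_mul, evw_reg, evw_pid, h12, h17, Nat.mod_eq_of_lt]
  have hp' : ∀ i < R, evw w σ i (.pid * reg 12 + reg 17 + 1 : Exp Ty.word) = i * S + j + 1 := by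
    intro i hi
    have h₁ := mul_add_lt hi hj
    rw [evw_add, hp i hi, evw_one _ _ _ (by omega), Nat.mod_eq_of_lt (by omega)]
  have hval : ∀ p < N, σ.w 20 p < 2 ^ w := by
    intro p hp
    rcases ha p hp with h | h
    · omega
    · exact h.1.trans hn
  have hnext : ∀ p u, p + 1 < N → σ.w 20 (p + 1) = n → Owns n (σ.w 1) u p →
      Owns n (σ.w 1) u (p + 1) := by
    intro p u hpN hpn hu
    obtain ⟨v, hv⟩ := exists_owns (n := n) hoff0 (p := p + 1) (by omega)
    -- If the owner of `p + 1` did not own `p` as well, its list would begin at `p + 1`, and this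
    -- position would already be marked.
    by_cases hvp : σ.w 1 v ≤ p
    · have : Owns n (σ.w 1) v p := ⟨hv.1, hvp, by have := hv.2.2; omega⟩
      rwa [hu.unique hoff this]
    · have h₁ : σ.w 1 v = p + 1 := by have := hv.2.1; omega
      have h₂ := hb v hv.1 (by have := hv.2.2; omega)
      rw [h₁, hpn] at h₂
      have := hv.1
      omega
  refine Runs.wstore R (fun i => if i * S + j + 1 < N ∧ σ.w 20 (i * S + j + 1) = n then 1 else 0)
    (fun i => i * S + j + 1) (fun i => σ.w 20 (i * S + j)) ?_ ?_ ?_ ?_ ?_ ?_ _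
    (Nat.le_of_ble_eq_true rfl)
  · rw [evw_reg, h15, Nat.mod_eq_of_lt hR]
  · intro i hi
    rw [evw_mul, evw_lt, evw_eqn, evw_load, hp' i hi, evw_reg, evw_reg, h10, h0,
      Nat.mod_eq_of_lt hn, Nat.mod_eq_of_lt (show N < 2 ^ w by omega)]
    by_cases h : i * S + j + 1 < N
    · rw [Nat.mod_eq_of_lt (hval _ h)]
      have : 1 % 2 ^ w = 1 := Nat.mod_eq_of_lt (Nat.one_lt_two_pow (by omega))
      by_cases h' : σ.w 20 (i * S + j + 1) = n <;> simp [h, h', this]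
    · simp [h]
  · intro i hi _
    exact hp' i hi
  · intro i hi hg
    have : i * S + j + 1 < N := by
      by_contra h
      simp [h] at hg
    rw [evw_load, hp i hi, Nat.mod_eq_of_lt (hval _ (by omega))]
  · intro i hi i' hi' _ _ h
    exact (mul_add_inj (S := S) hj hj (by omega)).1
  · intro f hf hf'
    have hold : ∀ x, σ.w 20 x ≠ n → f x = σ.w 20 x := by
      intro x hx
      refine hf' x fun i hi hg he => hx ?_
      rw [← he]
      by_contra h
      simp [h] at hg
    have hnew : ∀ p, (∃ i < R, i * S + j + 1 = p) → p < N → Owns n (σ.w 1) (f p) p := by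
      rintro _ ⟨i, hi, rfl⟩ hp
      rcases ha _ hp with h | h
      · rw [hf i hi (by simp [h, hp])]
        exact hnext _ _ hp h (hc i j le_rfl (by omega))
      · rwa [hold _ (by have := h.1; omega)]
    simp only [Mem.setW_w, if_true]
    refine ⟨fun p hp => ?_, fun v hv hlt => ?_, fun i k hk hik => ?_⟩
    · by_cases h : ∃ i < R, i * S + j + 1 = p
      · exact Or.inr (hnew p h hp)
      · rw [hf' p fun i hi _ he => h ⟨i, hi, he⟩]
        exact ha p hp
    · have := hb v hv hlt
      rw [hold _ (by omega), this]
    · rcases Nat.le_succ_iff.1 hk with hk | rfl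
      · have h := hc i k hk hik
        rwa [hold _ (by have := h.1; omega)]
      · refine hnew _ ⟨i, ?_, rfl⟩ hik
        by_contra h
        have := Nat.mul_le_mul_right S (not_lt.1 h)
        omega

/-- A binary search for each position would cost a logarithmic factor in work. Searching only once
per block of length `S ≥ E` and then scanning inside the blocks keeps the work linear. -/
theorem runs_fillSrc {n N S E : ℕ} (hw : 1 < w) (hn : 0 < n) (hw' : 2 * n + N + 2 * S + 1 < 2 ^ w)
    (hES : E ≤ S) (hE : n ≤ 2 ^ E) (hS : 0 < S)
    (h0 : σ.w 0 0 = n) (h10 : σ.w 10 0 = N) (h11 : σ.w 11 0 = E) (h12 : σ.w 12 0 = S)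
    (hoff : ∀ v < n, σ.w 1 v ≤ σ.w 1 (v + 1)) (hoff0 : σ.w 1 0 = 0) (hoffn : σ.w 1 n = N) :
    Runs w A fillSrc σ (1000 * (N + n + S)) (1000 * S) fun σ' => ∀ p < N,
      Owns n (σ.w 1) (σ'.w 20 p) p := by
  set R := N / S + 1 with hR
  have hR0 : 0 < R := Nat.succ_pos _
  have hNR : N ≤ R * S := by
    have := Nat.lt_div_mul_add hS (a := N)
    rw [hR, Nat.succ_mul]
    omega
  have hRN : R * S ≤ N + S := by
    have := Nat.div_mul_le_self N S
    rw [hR, Nat.succ_mul]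
    omega
  have hRE : R * E ≤ R * S := Nat.mul_le_mul_left _ hES
  have hRS : R ≤ R * S := Nat.le_mul_of_pos_right _ hS
  have hoffN : ∀ v ≤ n, σ.w 1 v ≤ N := fun v hv => hoffn ▸ le_of_step hoff hv le_rfl
  refine Runs.conseq
    (W := 20 * (N + 1) + (20 * (n + 1) + (30 + (20 * (R + 1) + (20 * (R + 1) +
      ((100 * (R + 1) * E + 40) + (30 * (R + 1) + (100 * (R + 1) * S + 40))))))))
    (D := 20 + (20 + (30 + (20 + (20 + ((100 * E + 40) + (30 + (100 * S + 40))))))))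
    (Runs.seq (Q := fun σ' => ∀ p < N, σ'.w 20 p = n) (Runs.wpar N (fun _ => n) (by omega) ?_ ?_
      ?_ _ (Nat.le_of_ble_eq_true rfl)) fun σ₁ h₁ hf₁ =>
    Runs.seq (Q := fun σ' => (∀ p < N, σ'.w 20 p = n ∨ Owns n (σ.w 1) (σ'.w 20 p) p) ∧
      (∀ v < n, σ.w 1 v < σ.w 1 (v + 1) → σ'.w 20 (σ.w 1 v) = v)) (Runs.wstore n
        (fun i => if σ.w 1 i < σ.w 1 (i + 1) then 1 else 0) (σ.w 1) (fun i => i) ?_ ?_ ?_ ?_ ?_ ?_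
        _ (Nat.le_of_ble_eq_true rfl)) fun σ₂ h₂ hf₂ =>
    Runs.seq (Q := fun σ' => σ'.w 15 0 = R) (Runs.wset 0 R (by omega) (evw_zero ..) ?_ ?_ _
      (Nat.le_of_ble_eq_true rfl)) fun σ₃ h₃ hf₃ =>
    Runs.seq (Q := fun σ' => ∀ i < R, σ'.w 22 i = 0) (Runs.wpar R (fun _ => 0) (by omega) ?_ ?_
      ?_ _ (Nat.le_of_ble_eq_true rfl)) fun σ₄ h₄ hf₄ =>
    Runs.seq (Q := fun σ' => ∀ i < R, σ'.w 23 i = n) (Runs.wpar R (fun _ => n) (by omega) ?_ ?_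
      ?_ _ (Nat.le_of_ble_eq_true rfl)) fun σ₅ h₅ hf₅ => ?_) ?_ ?_ fun _ h _ => h
  · rw [evw_reg, h10, Nat.mod_eq_of_lt (by omega)]
  · intro i _
    rw [evw_reg, h0, Nat.mod_eq_of_lt (by omega)]
  · intro f hf i hi
    simpa using hf i hi
  · rw [evw_reg, hf₁.w 0 rfl, h0, Nat.mod_eq_of_lt (by omega)]
  · intro i hi
    have g₁ := hoffN i hi.le
    have g₂ := hoffN (i + 1) hi
    simp (disch := omega) only [evw_lt, evw_load, evw_pid, evw_add, evw_one, hf₁.w 1 rfl,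
      Nat.mod_eq_of_lt]
  · intro i hi _
    have g₁ := hoffN i hi.le
    rw [evw_load, evw_pid, hf₁.w 1 rfl, Nat.mod_eq_of_lt (by omega)]
  · intro i hi _
    rfl
  · intro i hi j hj hg hg' h
    have g₁ : σ.w 1 i < σ.w 1 (i + 1) := by by_contra h; simp [h] at hg
    have g₂ : σ.w 1 j < σ.w 1 (j + 1) := by by_contra h; simp [h] at hg'
    exact Owns.unique hoff (p := σ.w 1 i) ⟨hi, le_rfl, g₁⟩ ⟨hj, h.ge, h ▸ g₂⟩
  · intro f hf hf'
    simp only [Mem.setW_w, if_true]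
    refine ⟨fun p hp => ?_, fun v hv hlt => hf v hv (by simp [hlt])⟩
    by_cases h : ∃ i < n, σ.w 1 i < σ.w 1 (i + 1) ∧ σ.w 1 i = p
    · obtain ⟨i, hi, hlt, rfl⟩ := h
      rw [hf i hi (by simp [hlt])]
      exact Or.inr ⟨hi, le_rfl, hlt⟩
    · left
      rw [hf' p ?_, h₁ p hp]
      rintro i hi hg rfl
      refine h ⟨i, hi, ?_, rfl⟩
      by_contra h
      simp [h] at hg
  · have := hf₁.w 10 rfl
    have := hf₁.w 12 rfl
    have := hf₂.w 10 rfl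
    have := hf₂.w 12 rfl
    have : S ≤ R * S := Nat.le_mul_of_pos_left _ hR0
    simp (disch := omega) only [evw_add, evw_div, evw_reg, evw_one, *, Nat.mod_eq_of_lt]
  · simp
  · rw [evw_reg, h₃, Nat.mod_eq_of_lt (by omega)]
  · intro i _
    exact evw_zero ..
  · intro f hf i hi
    simpa using hf i hi
  · rw [evw_reg, hf₄.w 15 rfl, h₃, Nat.mod_eq_of_lt (by omega)]
  · intro i _
    rw [evw_reg, hf₄.w 0 rfl, hf₃.w 0 rfl, hf₂.w 0 rfl, hf₁.w 0 rfl, h0,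
      Nat.mod_eq_of_lt (by omega)]
  · intro f hf i hi
    simpa using hf i hi
  · have g0 : σ₅.w 0 0 = n := by
      rw [hf₅.w 0 rfl, hf₄.w 0 rfl, hf₃.w 0 rfl, hf₂.w 0 rfl, hf₁.w 0 rfl, h0]
    have g10 : σ₅.w 10 0 = N := by
      rw [hf₅.w 10 rfl, hf₄.w 10 rfl, hf₃.w 10 rfl, hf₂.w 10 rfl, hf₁.w 10 rfl, h10]
    have g11 : σ₅.w 11 0 = E := by
      rw [hf₅.w 11 rfl, hf₄.w 11 rfl, hf₃.w 11 rfl, hf₂.w 11 rfl, hf₁.w 11 rfl, h11]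
    have g12 : σ₅.w 12 0 = S := by
      rw [hf₅.w 12 rfl, hf₄.w 12 rfl, hf₃.w 12 rfl, hf₂.w 12 rfl, hf₁.w 12 rfl, h12]
    have g1 : σ₅.w 1 = σ.w 1 := by
      rw [hf₅.w 1 rfl, hf₄.w 1 rfl, hf₃.w 1 rfl, hf₂.w 1 rfl, hf₁.w 1 rfl]
    have g15 : σ₅.w 15 0 = R := by rw [hf₅.w 15 rfl, hf₄.w 15 rfl, h₃]
    have g20 : σ₅.w 20 = σ₂.w 20 := by rw [hf₅.w 20 rfl, hf₄.w 20 rfl, hf₃.w 20 rfl]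
    have hSR : S ≤ R * S := Nat.le_mul_of_pos_left _ hR0
    refine Runs.seq ((Runs.forLoop (σ := σ₅) (fun j σ' => ∀ i < R, σ'.w 22 i < σ'.w 23 i ∧
      σ'.w 23 i ≤ n ∧ σ.w 1 (σ'.w 22 i) ≤ i * S ∧ (i * S < N → i * S < σ.w 1 (σ'.w 23 i)) ∧
      σ'.w 23 i - σ'.w 22 i ≤ 2 ^ (E - j)) 0 E (fun _ => 60 * (R + 1)) (fun _ => 60) (by omega)
      (by omega) (by omega) (evw_zero ..) rfl ?_ ?_ ?_ ?_ 40 (Nat.le_of_ble_eq_true rfl)).conseq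
      ?_ ?_ fun _ h _ => h) fun σ₆ h₆ hf₆ =>
      Runs.seq (Q := fun σ' => (∀ p < N, σ'.w 20 p = n ∨ Owns n (σ.w 1) (σ'.w 20 p) p) ∧
      (∀ v < n, σ.w 1 v < σ.w 1 (v + 1) → σ'.w 20 (σ.w 1 v) = v) ∧
      ∀ i, i * S < N → Owns n (σ.w 1) (σ'.w 20 (i * S)) (i * S)) (Runs.wstore R
        (fun i => if i * S < N then 1 else 0) (fun i => i * S) (σ₆.w 22) ?_ ?_ ?_ ?_ ?_ ?_
        _ (Nat.le_of_ble_eq_true rfl)) fun σ₇ h₇ hf₇ => (Runs.forLoop (σ := σ₇) (fun j σ' =>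
        (∀ p < N, σ'.w 20 p = n ∨ Owns n (σ.w 1) (σ'.w 20 p) p) ∧
      (∀ v < n, σ.w 1 v < σ.w 1 (v + 1) → σ'.w 20 (σ.w 1 v) = v) ∧
      ∀ i k, k ≤ j → i * S + k < N → Owns n (σ.w 1) (σ'.w 20 (i * S + k)) (i * S + k)) 0 S
      (fun _ => 60 * (R + 1)) (fun _ => 60) (by omega)
      (by omega) (by omega) (evw_zero ..) rfl ?_ ?_ ?_ ?_ 40 (Nat.le_of_ble_eq_true rfl)).conseq
      ?_ ?_ fun σ' h _ => ?_
    · intro _ σ' _ hf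
      rw [evw_reg, hf.w 11 rfl, g11, Nat.mod_eq_of_lt (by omega)]
    · intro _ σ' f h
      simpa using h
    · intro i hi
      rw [h₅ i hi, hf₅.w 22 rfl, h₄ i hi, hoff0, hoffn]
      exact ⟨hn, le_rfl, by omega, fun h => h, by simpa using hE⟩
    · intro j σ' _ hj hI hf _
      have hf1 : σ'.w 1 = σ.w 1 := by rw [hf.w 1 rfl, g1]
      have := runs_bisect (A := A) (σ := σ') (n := n) (N := N) (S := S) (R := R) (e := E - (j + 1))
        hw (by omega) (by omega) (by omega) (by omega) (by rw [hf.w 12 rfl, g12])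
        (by rw [hf.w 15 rfl, g15]) (by
          rw [hf1]
          intro v hv
          have := hoffN v hv
          omega) (by
          rw [hf1, show E - (j + 1) + 1 = E - j by omega]
          exact hI)
      rwa [hf1] at this
    · simp only [Finset.sum_const, Nat.card_Ico, smul_eq_mul]
      rw [Nat.sub_zero]
      nlinarith
    · simp only [Finset.sum_const, Nat.card_Ico, smul_eq_mul]
      omega
    · rw [evw_reg, hf₆.w 15 rfl, g15, Nat.mod_eq_of_lt (by omega)]
    · intro i hi
      have := Nat.mul_le_mul_right S hi.le
      simp (disch := omega) only [evw_lt, evw_mul, evw_pid, evw_reg, hf₆.w 12 rfl, g12,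
        hf₆.w 10 rfl, g10, Nat.mod_eq_of_lt]
    · intro i hi _
      have := Nat.mul_le_mul_right S hi.le
      simp (disch := omega) only [evw_mul, evw_pid, evw_reg, hf₆.w 12 rfl, g12, Nat.mod_eq_of_lt]
    · intro i hi _
      have := h₆ i hi
      rw [evw_load, evw_pid, Nat.mod_eq_of_lt (by omega)]
    · intro i hi j hj _ _ h
      exact Nat.eq_of_mul_eq_mul_right hS h
    · intro f hf hf'
      simp only [Mem.setW_w, if_true]
      have hnew : ∀ i < R, i * S < N → Owns n (σ.w 1) (f (i * S)) (i * S) := by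
        intro i hi hiN
        rw [hf i hi (by simp [hiN])]
        obtain ⟨k₁, k₂, k₃, k₄, k₅⟩ := h₆ i hi
        -- After `E` halvings the interval has length one, so its lower end is the owner.
        rw [Nat.sub_self, pow_zero] at k₅
        refine ⟨by omega, k₃, ?_⟩
        rw [show σ₆.w 22 i + 1 = σ₆.w 23 i by omega]
        exact k₄ hiN
      have hall : ∀ p < N, f p = σ₂.w 20 p ∨ Owns n (σ.w 1) (f p) p := by
        intro p hp
        by_cases h : ∃ i < R, i * S = p
        · obtain ⟨i, hi, rfl⟩ := h
          exact Or.inr (hnew i hi hp)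
        · left
          rw [hf' p fun i hi _ he => h ⟨i, hi, he⟩, hf₆.w 20 rfl, g20]
      refine ⟨fun p hp => ?_, fun v hv hlt => ?_, fun i hi => ?_⟩
      · rcases hall p hp with h | h
        · rw [h]
          exact h₂.1 p hp
        · exact Or.inr h
      · rcases hall (σ.w 1 v) (by have := hoffN (v + 1) hv; omega) with h | h
        · rw [h]
          exact h₂.2 v hv hlt
        · exact h.unique hoff ⟨hv, le_rfl, hlt⟩
      · refine hnew i ?_ hi
        by_contra h
        have := Nat.mul_le_mul_right S (not_lt.1 h)
        omega
    · intro _ σ' _ hf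
      rw [evw_reg, hf.w 12 rfl, hf₇.w 12 rfl, hf₆.w 12 rfl, g12, Nat.mod_eq_of_lt (by omega)]
    · intro _ σ' f h
      simpa using h
    · refine ⟨h₇.1, h₇.2.1, fun i k hk hik => ?_⟩
      obtain rfl : k = 0 := by omega
      exact h₇.2.2 i hik
    · rintro j σ' - hj ⟨ha, hb, hc⟩ hf h17
      have hf1 : σ'.w 1 = σ.w 1 := by rw [hf.w 1 rfl, hf₇.w 1 rfl, hf₆.w 1 rfl, g1]
      have := runs_scanStep (A := A) (σ := σ') (n := n) (N := N) (S := S) (R := R) (j := j)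
        hw (by omega) (by omega) hNR (by omega) hj
        (by rw [hf.w 0 rfl, hf₇.w 0 rfl, hf₆.w 0 rfl, g0])
        (by rw [hf.w 10 rfl, hf₇.w 10 rfl, hf₆.w 10 rfl, g10])
        (by rw [hf.w 12 rfl, hf₇.w 12 rfl, hf₆.w 12 rfl, g12])
        (by rw [hf.w 15 rfl, hf₇.w 15 rfl, hf₆.w 15 rfl, g15]) h17 (by rwa [hf1]) (by rwa [hf1])
        (by rwa [hf1]) (by rwa [hf1]) (by rwa [hf1]) (by rwa [hf1])
      rwa [hf1] at this
    · simp only [Finset.sum_const, Nat.card_Ico, smul_eq_mul]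
      rw [Nat.sub_zero]
      nlinarith
    · simp only [Finset.sum_const, Nat.card_Ico, smul_eq_mul]
      omega
    · intro p hp
      have h₁ := Nat.div_add_mod' p S
      have := h.2.2 (p / S) (p % S) (Nat.mod_lt _ hS).le (by omega)
      rwa [h₁] at this
  · nlinarith
  · omega

end

/-! ### Reducing the number of colours -/

/-- The hash function with parameter `a` that reduces colours below `q * q`. -/
def hash (q a x : ℕ) : ℕ := x % q + a * (x / q)

/-- The only parameter below `s` for which `x` and `y` may have the same hash value. -/
def badParam (q s x y : ℕ) : ℕ :=
  ((x % q - y % q) + (y % q - x % q)) / ((x / q - y / q) + (y / q - x / q)) % s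

/-- A collision says that the difference of the remainders is `a` times the opposite difference of
the quotients. If the quotients agree, so do the remainders and the colours; otherwise `a` is the
ratio of the absolute differences, which sums of two truncated subtractions express. The final
reduction modulo `s` keeps the key in range for all pairs and does not change `a < s`. -/
theorem badParam_eq {q s x y a : ℕ} (hxy : x ≠ y) (ha : a < s) (h : hash q a x = hash q a y) :
    badParam q s x y = a := by
  unfold hash at h
  unfold badParam
  have hx := Nat.div_add_mod x q
  have hy := Nat.div_add_mod y q
  rcases lt_trichotomy (x / q) (y / q) with hlt | heq | hlt
  · obtain ⟨d, hd⟩ := Nat.exists_eq_add_of_lt hlt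
    rw [hd] at h ⊢
    have h' : x % q = y % q + a * (d + 1) := by linarith [Nat.mul_add a (x / q) (d + 1)]
    have e₁ : x % q - y % q + (y % q - x % q) = a * (d + 1) := by omega
    have e₂ : x / q - (x / q + d + 1) + (x / q + d + 1 - x / q) = d + 1 := by omega
    rw [e₁, e₂, Nat.mul_div_cancel _ (Nat.succ_pos d), Nat.mod_eq_of_lt ha]
  · rw [heq] at h hx
    exact absurd (by rw [← hx, ← hy]; omega) hxy
  · obtain ⟨d, hd⟩ := Nat.exists_eq_add_of_lt hlt
    rw [hd] at h ⊢
    have h' : y % q = x % q + a * (d + 1) := by linarith [Nat.mul_add a (y / q) (d + 1)]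
    have e₁ : x % q - y % q + (y % q - x % q) = a * (d + 1) := by omega
    have e₂ : y / q + d + 1 - y / q + (y / q - (y / q + d + 1)) = d + 1 := by omega
    rw [e₁, e₂, Nat.mul_div_cancel _ (Nat.succ_pos d), Nat.mod_eq_of_lt ha]

/-- Both digits of `x` in base `q` are below `q`, so the value is less than `q + a * q`. -/
theorem hash_lt {q s a x : ℕ} (ha : a < s) (hx : x < q * q) : hash q a x < s * q := by
  have hq : 0 < q := by
    rcases Nat.eq_zero_or_pos q with rfl | h
    · simp at hx
    · exact h
  have h₁ : x % q < q := Nat.mod_lt _ hq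
  have h₂ : x / q < q := Nat.div_lt_of_lt_mul hx
  have h₃ : a * (x / q) ≤ a * q := Nat.mul_le_mul_left _ h₂.le
  have h₄ : (a + 1) * q ≤ s * q := Nat.mul_le_mul_right _ ha
  have h₅ : (a + 1) * q = a * q + q := by ring
  unfold hash
  omega

/-- Cost of the monochromatic list entries. -/
noncomputable def monoCost (N : ℕ) (src nbr : ℕ → ℕ) (cst : ℕ → ℝ) (col : ℕ → ℕ) : ℝ :=
  ∑ p ∈ Finset.range N, if col (src p) = col (nbr p) then cst p else 0

/-! ### The program for one round of colour reduction -/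

/-- The colour of the owner of the position that belongs to the processor. -/
def colSrc : Exp Ty.word := .wload 21 (.wload 20 .pid)

/-- The colour of the node listed at the position that belongs to the processor. -/
def colNbr : Exp Ty.word := .wload 21 (.wload 2 .pid)

/-- The parameter for which an edge may become monochromatic. -/
def keyExp : Exp Ty.word :=
  ((colSrc % reg 19 - colNbr % reg 19) + (colNbr % reg 19 - colSrc % reg 19)) /
    ((colSrc / reg 19 - colNbr / reg 19) + (colNbr / reg 19 - colSrc / reg 19)) % reg 12

/-- The cost of an edge, if it becomes monochromatic for the parameter in array `24`. -/
noncomputable def valExp : Exp Ty.real :=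
  .rload 1 .pid * .ofWord ((1 - colSrc.eqn colNbr) *
    (colSrc % reg 19 + .wload 24 .pid * (colSrc / reg 19)).eqn
      (colNbr % reg 19 + .wload 24 .pid * (colNbr / reg 19)))

/-- Find the position of the minimum of the first entries of real array `10`. -/
def argmin : Cmd :=
  .seq (wset 35 0 0) <|
  forLoop 36 0 (reg 12) (.wstore 1 ((0 : Exp Ty.word).eqn
    (.rle (.rload 10 (reg 35)) (.rload 10 (reg 36)))) 35 0 (reg 36))

/-- One round of colour reduction. -/
noncomputable def colorRound : Cmd :=
  .seq (wset 19 0 (reg 12 * .wload 28 (reg 14 - reg 18 - 1))) <|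
  .seq (wpar (reg 10) 24 keyExp) <|
  .seq (rpar (reg 10) 11 valExp) <|
  .seq hist <|
  .seq argmin <|
  wpar (reg 0) 21 (.wload 21 .pid % reg 19 + reg 35 * (.wload 21 .pid / reg 19))

section

variable {w : ℕ} {A : Arbiter} {σ : Mem}

theorem runs_argmin {S : ℕ} (hw : 1 < w) (hS : 0 < S) (hS' : S < 2 ^ w) (h12 : σ.w 12 0 = S) :
    Runs w A argmin σ (200 * S + 200) (200 * S + 200) fun σ' =>
      σ'.w 35 0 < S ∧ ∀ k < S, σ.r 10 (σ'.w 35 0) ≤ σ.r 10 k := by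
  refine Runs.conseq (W := 10 + ((120 + 40) * S + 40)) (D := 10 + ((60 + 40) * S + 40))
    (Runs.seq (Q := fun σ' => σ'.w 35 0 = 0) (Runs.wset 0 0 (by omega) (evw_zero ..) (evw_zero ..)
      ?_ _ (Nat.le_of_ble_eq_true rfl)) fun σ₁ h₁ hf₁ => (Runs.forLoop (σ := σ₁)
      (fun k σ' => σ'.w 35 0 < S ∧ ∀ l < k, σ.r 10 (σ'.w 35 0) ≤ σ.r 10 l) 0 S (fun _ => 60 * (1 + 1))
      (fun _ => 60) (by omega) (by omega) hS' (evw_zero ..) rfl ?_ ?_ ?_ ?_ 40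
      (Nat.le_of_ble_eq_true rfl)).conseq ?_ ?_ fun _ h _ => h) (by omega) (by omega)
    fun _ h _ => h
  · simp
  · intro _ σ' _ hf
    rw [evw_reg, hf.w 12 rfl, hf₁.w 12 rfl, h12, Nat.mod_eq_of_lt hS']
  · intro _ σ' f h
    simpa using h
  · exact ⟨by omega, fun l hl => absurd hl (Nat.not_lt_zero l)⟩
  · rintro k σ' - hk ⟨hI, hI'⟩ hf h36
    classical
    refine Runs.wstore 1 (fun _ => if σ.r 10 (σ'.w 35 0) ≤ σ.r 10 k then 0 else 1)
      (fun _ => 0) (fun _ => k) (evw_one _ _ _ (by omega)) ?_ ?_ ?_ ?_ ?_ _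
      (Nat.le_of_ble_eq_true rfl)
    · intro i _
      rw [evw_eqn, evw_zero, evw_rle, evr_load, evr_load, evw_reg, evw_reg, h36, hf.r 10 rfl,
        hf₁.r 10 rfl, Nat.mod_eq_of_lt (by omega), Nat.mod_eq_of_lt (by omega)]
      split_ifs <;> simp_all
    · intro i _ _
      exact evw_zero ..
    · intro i _ _
      rw [evw_reg, h36, Nat.mod_eq_of_lt (by omega)]
    · intro i hi j hj _ _ _
      omega
    · intro f hf₂ hf₃
      simp only [Mem.setW_w, if_true]
      by_cases h : σ.r 10 (σ'.w 35 0) ≤ σ.r 10 k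
      · have : f 0 = σ'.w 35 0 := hf₃ 0 fun i hi hg => by simp [h] at hg
        rw [this]
        refine ⟨hI, fun l hl => ?_⟩
        rcases Nat.lt_succ_iff_lt_or_eq.1 hl with hl | rfl
        · exact hI' l hl
        · exact h
      · have : f 0 = k := hf₂ 0 Nat.one_pos (by simp [h])
        rw [this]
        refine ⟨hk, fun l hl => ?_⟩
        rcases Nat.lt_succ_iff_lt_or_eq.1 hl with hl | rfl
        · exact (not_le.1 h).le.trans (hI' l hl)
        · exact le_rfl
  · simp only [Finset.sum_const, Nat.card_Ico, smul_eq_mul]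
    omega
  · simp only [Finset.sum_const, Nat.card_Ico, smul_eq_mul]
    omega

/-- Averaging over the parameters: `H k` is the cost that becomes monochromatic under parameter `k`.
Each entry is counted for at most one `k`, so the values of `H` sum to at most the total cost, and
the minimum is at most a `1 / s` fraction of it. Entries that were monochromatic stay so and are
accounted for separately. -/
theorem monoCost_hash_le {N q s a : ℕ} {src nbr col : ℕ → ℕ} {cst : ℕ → ℝ} (ha : a < s)
    (hcst : ∀ p < N, 0 ≤ cst p) (H : ℕ → ℝ)
    (hH : ∀ k < s, H k = ∑ p ∈ Finset.range N,
      if badParam q s (col (src p)) (col (nbr p)) = k then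
        cst p * (if col (src p) ≠ col (nbr p) ∧ hash q k (col (src p)) = hash q k (col (nbr p))
          then 1 else 0) else 0)
    (hmin : ∀ k < s, H a ≤ H k) {col' : ℕ → ℕ}
    (hcol' : ∀ p < N, col' (src p) = hash q a (col (src p)) ∧
      col' (nbr p) = hash q a (col (nbr p))) :
    s * monoCost N src nbr cst col' ≤
      s * monoCost N src nbr cst col + ∑ p ∈ Finset.range N, cst p := by
  have h₁ : s * H a ≤ ∑ k ∈ Finset.range s, H k := by
    have := Finset.card_nsmul_le_sum (Finset.range s) H (H a)
      fun k hk => hmin k (Finset.mem_range.1 hk)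
    simpa using this
  have h₂ : ∑ k ∈ Finset.range s, H k ≤ ∑ p ∈ Finset.range N, cst p := by
    rw [Finset.sum_congr rfl fun k hk => hH k (Finset.mem_range.1 hk), Finset.sum_comm]
    refine Finset.sum_le_sum fun p hp => ?_
    have hp' := hcst p (Finset.mem_range.1 hp)
    rw [Finset.sum_ite_eq]
    split_ifs <;> simp [hp']
  have h₃ : monoCost N src nbr cst col' ≤ monoCost N src nbr cst col + H a := by
    rw [hH a ha, monoCost, monoCost, ← Finset.sum_add_distrib]
    refine Finset.sum_le_sum fun p hp => ?_
    rw [Finset.mem_range] at hp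
    have hp' := hcst p hp
    rw [(hcol' p hp).1, (hcol' p hp).2]
    by_cases he : col (src p) = col (nbr p)
    · simp [he]
    · by_cases he' : hash q a (col (src p)) = hash q a (col (nbr p))
      · simp [he, he', badParam_eq he ha he']
      · simp [he, he']
  have h₄ : (s : ℝ) * monoCost N src nbr cst col' ≤ s * (monoCost N src nbr cst col + H a) :=
    mul_le_mul_of_nonneg_left h₃ (Nat.cast_nonneg s)
  linarith

/-- Each entry is keyed by its only dangerous parameter, with its cost as value if a collision
really occurs there. A single histogram thus yields the new monochromatic cost for all `S`
parameters, and `argmin` selects the best one. -/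
theorem runs_colorRound {n N S J j : ℕ} (q : ℕ) (hw : 1 < w) (hS : 0 < S) (hj : j < J)
    (hJ : J < 2 ^ w) (hn : n < 2 ^ w)
    (hw' : N + 2 * S + 2 < 2 ^ w) (hqw : q * q + S * q < 2 ^ w)
    (h0 : σ.w 0 0 = n) (h10 : σ.w 10 0 = N) (h12 : σ.w 12 0 = S) (h14 : σ.w 14 0 = J)
    (h18 : σ.w 18 0 = j) (h28 : σ.w 28 (J - j - 1) < 2 ^ w) (hq : q = S * σ.w 28 (J - j - 1))
    (hSq : q < 2 ^ w)
    (h30 : σ.w 30 0 = N) (h31 : σ.w 31 0 = S)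
    (hsrc : ∀ p < N, σ.w 20 p < n) (hnbr : ∀ p < N, σ.w 2 p < n)
    (hcol : ∀ v < n, σ.w 21 v < q * q) (hcst : ∀ p < N, 0 ≤ σ.r 1 p) :
    Runs w A colorRound σ (2000 * (N + n + S)) (2000 * (S + Nat.clog 2 (N + 1))) fun σ' =>
      (∀ v < n, σ'.w 21 v < S * q) ∧
      S * monoCost N (σ.w 20) (σ.w 2) (σ.r 1) (σ'.w 21) ≤
        S * monoCost N (σ.w 20) (σ.w 2) (σ.r 1) (σ.w 21) + ∑ p ∈ Finset.range N, σ.r 1 p := by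
  have hmodw : ∀ x, x % q ≤ x ∧ x / q ≤ x := fun x => ⟨Nat.mod_le _ _, Nat.div_le_self _ _⟩
  have hS2 : S < 2 ^ w := by omega
  have habs : ∀ a b : ℕ, a < 2 ^ w → b < 2 ^ w → a - b + (b - a) < 2 ^ w := fun a b _ _ => by omega
  have hdiv : ∀ x < q * q, x / q < q := fun x hx => Nat.div_lt_of_lt_mul hx
  -- No hash computation overflows, so word arithmetic gives the true hash values.
  have hmulw : ∀ a < S, ∀ x < q * q, hash q a x < 2 ^ w ∧ a * (x / q) < 2 ^ w := by
    intro a ha x hx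
    have h₁ := hash_lt ha hx
    have h₂ : a * (x / q) ≤ S * q := Nat.mul_le_mul ha.le (hdiv x hx).le
    omega
  set key : ℕ → ℕ := fun p => badParam q S (σ.w 21 (σ.w 20 p)) (σ.w 21 (σ.w 2 p)) with hkey
  have hkeyS : ∀ p, key p < S := fun p => Nat.mod_lt _ hS
  set val : ℕ → ℝ := fun p => σ.r 1 p * (if σ.w 21 (σ.w 20 p) ≠ σ.w 21 (σ.w 2 p) ∧
    hash q (key p) (σ.w 21 (σ.w 20 p)) = hash q (key p) (σ.w 21 (σ.w 2 p)) then 1 else 0) with hval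
  have hcs : ∀ σ' : Mem, σ'.w 20 = σ.w 20 → σ'.w 21 = σ.w 21 → ∀ p < N,
      evw w σ' p colSrc = σ.w 21 (σ.w 20 p) := by
    intro σ' g20 g21 p hp
    have h₁ := hsrc p hp
    have h₂ := hcol _ h₁
    rw [colSrc, evw_load, evw_load, evw_pid, g20, g21, Nat.mod_eq_of_lt (by omega : σ.w 20 p < _),
      Nat.mod_eq_of_lt (by omega)]
  have hcn : ∀ σ' : Mem, σ'.w 2 = σ.w 2 → σ'.w 21 = σ.w 21 → ∀ p < N,
      evw w σ' p colNbr = σ.w 21 (σ.w 2 p) := by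
    intro σ' g20 g21 p hp
    have h₁ := hnbr p hp
    have h₂ := hcol _ h₁
    rw [colNbr, evw_load, evw_load, evw_pid, g20, g21, Nat.mod_eq_of_lt (by omega : σ.w 2 p < _),
      Nat.mod_eq_of_lt (by omega)]
  refine Runs.conseq
    (W := 40 + (100 * (N + 1) + (100 * (N + 1) + (1000 * (N + S) + ((200 * S + 200) +
      40 * (n + 1))))))
    (D := 40 + (100 + (100 + (1000 * (S + Nat.clog 2 (N + 1)) + ((200 * S + 200) + 40)))))
    (Runs.seq (Q := fun σ' => σ'.w 19 0 = q) (Runs.wset 0 q (by omega) (evw_zero ..) ?_ ?_ _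
      (Nat.le_of_ble_eq_true rfl)) fun σ₁ h₁ hf₁ =>
    Runs.seq (Q := fun σ' => ∀ p < N, σ'.w 24 p = key p) (Runs.wpar N key (by omega) ?_ ?_ ?_ _
      (Nat.le_of_ble_eq_true rfl)) fun σ₂ h₂ hf₂ =>
    Runs.seq (Q := fun σ' => ∀ p < N, σ'.r 11 p = val p) (Runs.rpar N val (by omega) ?_ ?_ ?_ _
      (Nat.le_of_ble_eq_true rfl)) fun σ₃ h₃ hf₃ =>
    Runs.seq (runs_hist (N := N) (S := S) hw hS hw' ?_ ?_ ?_) fun σ₄ h₄ hf₄ =>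
    Runs.seq (runs_argmin (S := S) hw hS hS2 ?_) fun σ₅ h₅ hf₅ =>
    Runs.wpar n (fun v => hash q (σ₅.w 35 0) (σ.w 21 v)) (by omega) ?_ ?_ ?_ _
      (Nat.le_of_ble_eq_true rfl)) (by omega) (by omega) fun _ h _ => h
  · have : S * σ.w 28 (J - j - 1) < 2 ^ w := hq ▸ hSq
    simp (disch := omega) only [evw_mul, evw_load, evw_sub, evw_reg, evw_one, h12, h14, h18,
      Nat.mod_eq_of_lt]
    exact hq.symm
  · simp
  · rw [evw_reg, hf₁.w 10 rfl, h10, Nat.mod_eq_of_lt (by omega)]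
  · intro p hp
    have k₁ := hcol _ (hsrc p hp)
    have k₂ := hcol _ (hnbr p hp)
    have k₃ := hmodw (σ.w 21 (σ.w 20 p))
    have k₄ := hmodw (σ.w 21 (σ.w 2 p))
    have k₅ := hcs σ₁ (hf₁.w 20 rfl) (hf₁.w 21 rfl) p hp
    have k₆ := hcn σ₁ (hf₁.w 2 rfl) (hf₁.w 21 rfl) p hp
    have e19 : evw w σ₁ p (reg 19) = q := by rw [evw_reg, h₁, Nat.mod_eq_of_lt hSq]
    have e12 : evw w σ₁ p (reg 12) = S := by
      rw [evw_reg, hf₁.w 12 rfl, h12, Nat.mod_eq_of_lt hS2]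
    rw [keyExp, evw_mod, evw_div, evw_add, evw_add]
    simp only [evw_sub, evw_mod, evw_div, k₅, k₆, e19, e12]
    rw [Nat.mod_eq_of_lt (habs (σ.w 21 (σ.w 20 p) % q) _ (by omega) (by omega)),
      Nat.mod_eq_of_lt (habs (σ.w 21 (σ.w 20 p) / q) _ (by omega) (by omega))]
    rfl
  · intro f hf p hp
    simpa using hf p hp
  · rw [evw_reg, hf₂.w 10 rfl, hf₁.w 10 rfl, h10, Nat.mod_eq_of_lt (by omega)]
  · intro p hp
    have k₁ := hcol _ (hsrc p hp)
    have k₂ := hcol _ (hnbr p hp)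
    have k₃ := hmulw _ (hkeyS p) _ k₁
    have k₄ := hmulw _ (hkeyS p) _ k₂
    have k₅ := hcs σ₂ (by rw [hf₂.w 20 rfl, hf₁.w 20 rfl]) (by rw [hf₂.w 21 rfl, hf₁.w 21 rfl]) p hp
    have k₆ := hcn σ₂ (by rw [hf₂.w 2 rfl, hf₁.w 2 rfl]) (by rw [hf₂.w 21 rfl, hf₁.w 21 rfl]) p hp
    have e19 : evw w σ₂ p (reg 19) = q := by
      rw [evw_reg, hf₂.w 19 rfl, h₁, Nat.mod_eq_of_lt hSq]
    have e24 : evw w σ₂ p (.wload 24 .pid) = key p := by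
      rw [evw_load, evw_pid, h₂ p hp, Nat.mod_eq_of_lt ((hkeyS p).trans hS2)]
    rw [valExp, evr_mul, evr_load, evr_ofWord, evw_mul, evw_sub, evw_eqn, evw_eqn, evw_add, evw_mul,
      evw_add, evw_mul, evw_mod, evw_mod, evw_div, evw_div, k₅, k₆, e19, e24,
      evw_one _ _ _ (by omega), Nat.mod_eq_of_lt k₃.2, Nat.mod_eq_of_lt k₄.2,
      Nat.mod_eq_of_lt (show _ + _ < 2 ^ w from k₃.1),
      Nat.mod_eq_of_lt (show _ + _ < 2 ^ w from k₄.1), hf₂.r 1 rfl, hf₁.r 1 rfl, evw_pid]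
    have h1 : 1 % 2 ^ w = 1 := Nat.mod_eq_of_lt (Nat.one_lt_two_pow (by omega))
    change σ.r 1 p * ((((1 - if σ.w 21 (σ.w 20 p) = σ.w 21 (σ.w 2 p) then 1 else 0) *
      (if hash q (key p) (σ.w 21 (σ.w 20 p)) = hash q (key p) (σ.w 21 (σ.w 2 p)) then 1 else 0))
      % 2 ^ w : ℕ) : ℝ) = val p
    simp only [hval]
    by_cases c₁ : σ.w 21 (σ.w 20 p) = σ.w 21 (σ.w 2 p)
    · simp [c₁]
    · by_cases c₂ : hash q (key p) (σ.w 21 (σ.w 20 p)) = hash q (key p) (σ.w 21 (σ.w 2 p)) <;>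
        simp [c₁, c₂, h1]
  · intro f hf _ p hp
    simpa using hf p hp
  · rw [hf₃.w 30 rfl, hf₂.w 30 rfl, hf₁.w 30 rfl, h30]
  · rw [hf₃.w 31 rfl, hf₂.w 31 rfl, hf₁.w 31 rfl, h31]
  · intro p hp
    rw [hf₃.w 24 rfl, h₂ p hp]
    exact hkeyS p
  · rw [hf₄.w 12 rfl, hf₃.w 12 rfl, hf₂.w 12 rfl, hf₁.w 12 rfl, h12]
  · rw [evw_reg, hf₅.w 0 rfl, hf₄.w 0 rfl, hf₃.w 0 rfl, hf₂.w 0 rfl, hf₁.w 0 rfl, h0,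
      Nat.mod_eq_of_lt hn]
  · intro v hv
    have k₁ := hcol v hv
    have k₂ := hmulw _ h₅.1 _ k₁
    have e19 : evw w σ₅ v (reg 19) = q := by
      rw [evw_reg, hf₅.w 19 rfl, hf₄.w 19 rfl, hf₃.w 19 rfl, hf₂.w 19 rfl, h₁, Nat.mod_eq_of_lt hSq]
    have e21 : evw w σ₅ v (.wload 21 .pid) = σ.w 21 v := by
      rw [evw_load, evw_pid, hf₅.w 21 rfl, hf₄.w 21 rfl, hf₃.w 21 rfl, hf₂.w 21 rfl, hf₁.w 21 rfl,
        Nat.mod_eq_of_lt (by omega)]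
    rw [evw_add, evw_mod, evw_mul, evw_div, evw_reg w σ₅ v 35, Nat.mod_eq_of_lt (h₅.1.trans hS2),
      e19, e21, Nat.mod_eq_of_lt k₂.2, Nat.mod_eq_of_lt (show _ + _ < 2 ^ w from k₂.1)]
    rfl
  · intro f hf
    simp only [Mem.setW_w, if_true]
    refine ⟨fun v hv => ?_, ?_⟩
    · rw [hf v hv]
      exact hash_lt h₅.1 (hcol v hv)
    · refine monoCost_hash_le (q := q) h₅.1 hcst (σ₄.r 10) (fun k hk => ?_) h₅.2
        fun p hp => ⟨hf _ (hsrc p hp), hf _ (hnbr p hp)⟩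
      rw [h₄ k hk]
      refine Finset.sum_congr rfl fun p hp => ?_
      rw [Finset.mem_range] at hp
      rw [hf₃.w 24 rfl, h₂ p hp, h₃ p hp]
      simp only [hkey, hval]
      split_ifs <;> simp_all

end

/-! ### Parameters -/

/-- Whether the parameter in register `12` is still to be increased. -/
def growCond : Exp Ty.word :=
  (reg 12 * reg 12 * (reg 12 * reg 12)).lt (reg 0) *
    (1 - .rle (.ofWord (reg 11)) (.ofWord (reg 12) * .rload 2 0))

/-- Compute the number of list positions (register `10`), a bound on the number of bits of the
identifiers (register `11`) and the number of hash functions per round (register `12`). -/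
def setup : Cmd :=
  .seq (wset 10 0 (.wload 1 (reg 0))) <|
  .seq (wset 11 0 1) <|
  .seq (wset 29 0 1) <|
  .seq (.loop ((reg 29).lt (reg 0)) (.seq (wset 29 0 (reg 29 * 2)) (wset 11 0 (reg 11 + 1)))) <|
  .seq (wset 12 0 (reg 11))
  (.loop growCond (wset 12 0 (reg 12 + 1)))

/-- Store the numbers `2 ^ 2 ^ j` in word array `28`, until they reach the number of nodes, and the
last `j` in register `14`. -/
def towers : Cmd :=
  .seq (wset 28 0 2) <|
  .seq (wset 14 0 0) <|
  .loop ((Exp.wload 28 (reg 14)).lt (reg 0))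
    (.seq (wset 28 (reg 14 + 1) (.wload 28 (reg 14) * .wload 28 (reg 14)))
      (wset 14 0 (reg 14 + 1)))

/-- Colour the nodes such that few edges are monochromatic. -/
noncomputable def colorNodes : Cmd :=
  .seq (wset 30 0 (reg 10)) <|
  .seq (wset 31 0 (reg 12)) <|
  .seq (wpar (reg 0) 21 .pid)
  (forLoop 18 0 (reg 14) colorRound)

section

variable {w : ℕ} {A : Arbiter} {σ : Mem}

theorem clog_two_le_self (n : ℕ) : Nat.clog 2 n ≤ n :=
  Nat.clog_le_of_le_pow Nat.lt_two_pow_self.le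

/-- Real numbers cannot be rounded to words, so `S` is found by counting upwards. Stopping also at
`S ^ 4 ≥ n` keeps the work linear in `n` even for tiny `ε`; the bound `B` controls the depth. -/
theorem runs_setup {n N B : ℕ} (hw : 1 < w) (hn : 0 < n) (hw' : (n + 1) ^ 4 < 2 ^ w)
    (hNw : N < 2 ^ w) (h0 : σ.w 0 0 = n) (h1 : σ.w 1 n = N)
    (hB : Nat.clog 2 n + 1 ≤ B) (hB' : (Nat.clog 2 n + 1 : ℝ) ≤ B * σ.r 2 0) (heps : 0 < σ.r 2 0) :
    Runs w A setup σ (1000 * (n + 1)) (1000 * (B + 1)) fun σ' => σ'.w 10 0 = N ∧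
      0 < σ'.w 11 0 ∧ n ≤ 2 ^ σ'.w 11 0 ∧ σ'.w 11 0 ≤ Nat.clog 2 n + 1 ∧ σ'.w 11 0 ≤ σ'.w 12 0 ∧
      σ'.w 12 0 ≤ B ∧ σ'.w 12 0 ≤ n + 1 ∧
      (n ≤ σ'.w 12 0 ^ 4 ∨ (σ'.w 11 0 : ℝ) ≤ σ'.w 12 0 * σ.r 2 0) := by
  have hcl := clog_two_le_self n
  have hn4 : n + 1 ≤ (n + 1) ^ 4 := Nat.le_self_pow (by norm_num) _
  have hn2 : 2 * n < 2 ^ w := by nlinarith [Nat.pow_le_pow_right (show 0 < n + 1 by omega) (show 2 ≤ 4 by omega)]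
  set c := Nat.clog 2 n with hc
  refine Runs.conseq
    (W := 20 + (20 + (20 + ((60 * (c + 1 - 1) + 5) + (20 + (60 * (n + 1) + 30))))))
    (D := 20 + (20 + (20 + ((60 * (c + 1 - 1) + 5) + (20 + (60 * (B + 1) + 30))))))
    (Runs.seq (Q := fun σ' => σ'.w 10 0 = N) (Runs.wset 0 N (by omega) (evw_zero ..) ?_ ?_ _
      (Nat.le_of_ble_eq_true rfl)) fun σ₁ h₁ hf₁ =>
    Runs.seq (Q := fun σ' => σ'.w 11 0 = 1) (Runs.wset 0 1 (by omega) (evw_zero ..)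
      (evw_one _ _ _ (by omega)) ?_ _ (Nat.le_of_ble_eq_true rfl)) fun σ₂ h₂ hf₂ =>
    Runs.seq (Q := fun σ' => σ'.w 29 0 = 1) (Runs.wset 0 1 (by omega) (evw_zero ..)
      (evw_one _ _ _ (by omega)) ?_ _ (Nat.le_of_ble_eq_true rfl)) fun σ₃ h₃ hf₃ => ?_)
    (by omega) (by omega) fun _ h _ => h
  · rw [evw_load, evw_reg, h0, Nat.mod_eq_of_lt (by omega : n < 2 ^ w), h1, Nat.mod_eq_of_lt hNw]
  · simp
  · simp
  · simp
  have g0 : σ₃.w 0 0 = n := by rw [hf₃.w 0 rfl, hf₂.w 0 rfl, hf₁.w 0 rfl, h0]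
  have g10 : σ₃.w 10 0 = N := by rw [hf₃.w 10 rfl, hf₂.w 10 rfl, h₁]
  have g11 : σ₃.w 11 0 = 1 := by rw [hf₃.w 11 rfl, h₂]
  have g2 : σ₃.r 2 = σ.r 2 := by rw [hf₃.r 2 rfl, hf₂.r 2 rfl, hf₁.r 2 rfl]
  have hloop := Runs.loop (w := w) (A := A) (σ := σ₃)
    (c := .seq (wset 29 0 (reg 29 * 2)) (wset 11 0 (reg 11 + 1)))
    (b := (reg 29).lt (reg 0))
    (fun σ' => σ'.w 29 0 = 2 ^ (σ'.w 11 0 - 1) ∧ 0 < σ'.w 11 0 ∧ σ'.w 11 0 ≤ c + 1 ∧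
      (σ'.w 29 0 < 2 ^ w))
    (fun σ' => 60 * (c + 1 - σ'.w 11 0)) (fun σ' => 60 * (c + 1 - σ'.w 11 0)) ?_
    ⟨by simp [h₃, g11], by omega, by omega, by omega⟩
  · rw [g11, show ((reg 29).lt (reg 0)).size = 5 from rfl] at hloop
    refine Runs.seq hloop fun σ₄ h₄ hf₄ => ?_
    obtain ⟨⟨e29, epos, ele, elt⟩, hb⟩ := h₄
    rw [evw_lt, evw_reg, evw_reg, hf₄.w 0 rfl, g0, Nat.mod_eq_of_lt elt,
      Nat.mod_eq_of_lt (by omega)] at hb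
    have hpow : n ≤ 2 ^ σ₄.w 11 0 := by
      have h : ¬ σ₄.w 29 0 < n := by
        intro h
        rw [if_pos h] at hb
        exact one_ne_zero hb
      have : 2 ^ (σ₄.w 11 0 - 1) ≤ 2 ^ σ₄.w 11 0 := Nat.pow_le_pow_right two_pos (by omega)
      omega
    have e0 : σ₄.w 0 0 = n := by rw [hf₄.w 0 rfl, g0]
    have e10 : σ₄.w 10 0 = N := by rw [hf₄.w 10 rfl, g10]
    have e2 : σ₄.r 2 = σ.r 2 := by rw [hf₄.r 2 rfl, g2]
    refine Runs.seq (Q := fun σ' => σ'.w 12 0 = σ₄.w 11 0) (Runs.wset 0 (σ₄.w 11 0) (by omega)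
      (evw_zero ..) ?_ ?_ _ (Nat.le_of_ble_eq_true rfl)) fun σ₅ h₅ hf₅ => ?_
    · rw [evw_reg, Nat.mod_eq_of_lt (by omega)]
    · simp
    have k0 : σ₅.w 0 0 = n := by rw [hf₅.w 0 rfl, e0]
    have k10 : σ₅.w 10 0 = N := by rw [hf₅.w 10 rfl, e10]
    have k11 : σ₅.w 11 0 = σ₄.w 11 0 := by rw [hf₅.w 11 rfl]
    have k2 : σ₅.r 2 = σ.r 2 := by rw [hf₅.r 2 rfl, e2]
    -- The bound `S ≤ n + 1` is needed so that the fourth power in the test fits into a word.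
    have hgrow : ∀ σ' : Mem, σ'.w 0 0 = n → σ'.w 11 0 = σ₄.w 11 0 → σ'.r 2 = σ.r 2 →
        σ'.w 12 0 ≤ n + 1 → (evw w σ' 0 growCond ≠ 0 ↔
          σ'.w 12 0 ^ 4 < n ∧ σ'.w 12 0 * σ.r 2 0 < (σ₄.w 11 0 : ℝ)) := by
      intro σ' l0 l11 l2 l12
      have p4 := Nat.pow_le_pow_left l12 4
      have p4' : σ'.w 12 0 ^ 4 = σ'.w 12 0 * σ'.w 12 0 * (σ'.w 12 0 * σ'.w 12 0) := by ring
      have p2 : σ'.w 12 0 * σ'.w 12 0 ≤ σ'.w 12 0 ^ 4 := by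
        rw [p4']; exact Nat.le_mul_self _
      have p1 : σ'.w 12 0 ≤ σ'.w 12 0 * σ'.w 12 0 := Nat.le_mul_self _
      rw [growCond, evw_mul, evw_sub, evw_lt, evw_mul, evw_mul, evw_rle, evr_mul, evr_ofWord,
        evr_ofWord, evr_load, evw_zero, l2, evw_reg, evw_reg, evw_reg, l0, l11,
        evw_one _ _ _ (by omega), Nat.mod_eq_of_lt (by omega : σ'.w 12 0 < 2 ^ w),
        Nat.mod_eq_of_lt (by omega : σ'.w 12 0 * σ'.w 12 0 < 2 ^ w),
        Nat.mod_eq_of_lt (by omega : σ'.w 12 0 * σ'.w 12 0 * _ < 2 ^ w),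
        Nat.mod_eq_of_lt (by omega : n < 2 ^ w), Nat.mod_eq_of_lt (by omega : σ₄.w 11 0 < 2 ^ w),
        ← p4', ← not_le (a := (σ₄.w 11 0 : ℝ))]
      have h1 : 1 % 2 ^ w = 1 := Nat.mod_eq_of_lt (Nat.one_lt_two_pow (by omega))
      by_cases c₁ : σ'.w 12 0 ^ 4 < n <;>
        by_cases c₂ : (σ₄.w 11 0 : ℝ) ≤ σ'.w 12 0 * σ.r 2 0 <;> simp [c₁, c₂, h1]
    have hloop' := Runs.loop (w := w) (A := A) (σ := σ₅) (c := wset 12 0 (reg 12 + 1))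
      (b := growCond)
      (fun σ' => σ₄.w 11 0 ≤ σ'.w 12 0 ∧ σ'.w 12 0 ≤ n + 1 ∧ σ'.w 12 0 ≤ B ∧
        σ'.w 0 0 = n ∧ σ'.w 11 0 = σ₄.w 11 0 ∧ σ'.r 2 = σ.r 2 ∧ σ'.w 10 0 = N)
      (fun σ' => 60 * (n + 1 - σ'.w 12 0)) (fun σ' => 60 * (B + 1 - σ'.w 12 0)) ?_
      ⟨by omega, by omega, by omega, k0, k11, k2, k10⟩
    · refine hloop'.conseq ?_ ?_ ?_
      · rw [show growCond.size = 27 from rfl]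
        omega
      · rw [show growCond.size = 27 from rfl]
        omega
      · rintro σ' ⟨⟨m₁, m₂, m₃, m₄, m₅, m₆, m₇⟩, hb⟩ -
        rw [m₅]
        refine ⟨m₇, epos, hpow, by omega, m₁, m₃, m₂, ?_⟩
        by_contra hcon
        push Not at hcon
        exact (hgrow σ' m₄ m₅ m₆ m₂).2 hcon hb
    · rintro σ' ⟨m₁, m₂, m₃, m₄, m₅, m₆, m₇⟩ - hb
      obtain ⟨b₁, b₂⟩ := (hgrow σ' m₄ m₅ m₆ m₂).1 hb
      have hlt : σ'.w 12 0 < n := (Nat.le_self_pow (by norm_num) _).trans_lt b₁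
      -- While the loop runs, `S * ε < E ≤ B * ε`.
      have hltB : σ'.w 12 0 < B := by
        have : (σ₄.w 11 0 : ℝ) ≤ c + 1 := by exact_mod_cast ele
        have : (σ'.w 12 0 : ℝ) * σ.r 2 0 < B * σ.r 2 0 := by linarith
        exact_mod_cast lt_of_mul_lt_mul_right this heps.le
      refine ⟨20, 20, Runs.wset 0 (σ'.w 12 0 + 1) (by omega) (evw_zero ..) ?_ ?_ _
        (Nat.le_of_ble_eq_true rfl)⟩
      · rw [evw_add, evw_reg, evw_one _ _ _ (by omega), Nat.mod_eq_of_lt (by omega : σ'.w 12 0 < _),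
          Nat.mod_eq_of_lt (by omega)]
      · rw [show growCond.size = 27 from rfl]
        simp [m₄, m₅, m₆, m₇]
        omega
  · rintro σ' ⟨e29, epos, ele, elt⟩ hf hb
    rw [evw_lt, evw_reg, evw_reg, hf.w 0 rfl, g0, Nat.mod_eq_of_lt elt,
      Nat.mod_eq_of_lt (by omega)] at hb
    have hlt : σ'.w 29 0 < n := by
      by_contra h
      exact hb (if_neg h)
    have hle : σ'.w 11 0 ≤ c := by
      by_contra h
      have h₁ : n ≤ 2 ^ c := Nat.le_pow_clog Nat.one_lt_two n
      have h₂ : 2 ^ c ≤ 2 ^ (σ'.w 11 0 - 1) := Nat.pow_le_pow_right two_pos (by omega)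
      omega
    refine ⟨20 + 20, 20 + 20, Runs.seq (Q := fun σ'' => σ''.w 29 0 = σ'.w 29 0 * 2) (Runs.wset 0
      (σ'.w 29 0 * 2) (by omega) (evw_zero ..) ?_ ?_ _ (Nat.le_of_ble_eq_true rfl))
      fun σ'' h'' hf'' => Runs.wset 0 (σ'.w 11 0 + 1) (by omega) (evw_zero ..) ?_ ?_ _
        (Nat.le_of_ble_eq_true rfl)⟩
    · rw [evw_mul, evw_reg, evw_two _ _ _ hw, Nat.mod_eq_of_lt elt, Nat.mod_eq_of_lt (by omega)]
    · simp
    · rw [evw_add, evw_reg, evw_one _ _ _ (by omega), hf''.w 11 rfl, Nat.mod_eq_of_lt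
        (by omega : σ'.w 11 0 < _), Nat.mod_eq_of_lt (by omega)]
    · rw [show ((reg 29).lt (reg 0)).size = 5 from rfl]
      have : σ'.w 29 0 * 2 = 2 ^ σ'.w 11 0 := by
        rw [e29, ← pow_succ]
        congr 1
        omega
      simp [h'', this]
      omega

/-- Only entries below `n` are squared, which prevents overflow. The last conjunct records that `J`
is minimal, which later gives `J = O(log log n)`. -/
theorem runs_towers {n E : ℕ} (hw : 1 < w) (hw' : (n + 1) ^ 4 < 2 ^ w) (hE : n ≤ 2 ^ E)
    (hEw : E < 2 ^ w) (hE0 : 0 < E) (h0 : σ.w 0 0 = n) :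
    Runs w A towers σ (1000 * (E + 1)) (1000 * (E + 1)) fun σ' => σ'.w 14 0 ≤ E ∧
      (∀ j ≤ σ'.w 14 0, σ'.w 28 j = 2 ^ 2 ^ j) ∧ n ≤ 2 ^ 2 ^ σ'.w 14 0 ∧
      (σ'.w 14 0 = 0 ∨ 2 ^ 2 ^ (σ'.w 14 0 - 1) < n) := by
  have hn4 : n + 1 ≤ (n + 1) ^ 4 := Nat.le_self_pow (by norm_num) _
  have hnn : n * n < 2 ^ w := by
    have : n * n ≤ (n + 1) ^ 4 := by nlinarith [Nat.pow_le_pow_right (show 0 < n + 1 by omega) (show 2 ≤ 4 by omega)]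
    omega
  refine Runs.conseq (W := 20 + (20 + (100 * (E + 1 - 0) + 6)))
    (D := 20 + (20 + (100 * (E + 1 - 0) + 6)))
    (Runs.seq (Q := fun σ' => σ'.w 28 0 = 2) (Runs.wset 0 2 (by omega) (evw_zero ..)
      (evw_two _ _ _ hw) ?_ _ (Nat.le_of_ble_eq_true rfl)) fun σ₁ h₁ hf₁ =>
    Runs.seq (Q := fun σ' => σ'.w 14 0 = 0) (Runs.wset 0 0 (by omega) (evw_zero ..)
      (evw_zero ..) ?_ _ (Nat.le_of_ble_eq_true rfl)) fun σ₂ h₂ hf₂ => ?_)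
    (by omega) (by omega) fun _ h _ => h
  · simp
  · simp
  have g0 : σ₂.w 0 0 = n := by rw [hf₂.w 0 rfl, hf₁.w 0 rfl, h0]
  have hsz : ((Exp.wload 28 (reg 14)).lt (reg 0)).size = 6 := rfl
  have h4w : 2 < 2 ^ w := lt_of_lt_of_le (show 2 < 2 ^ 2 by norm_num)
    (Nat.pow_le_pow_right two_pos hw)
  have hloop := Runs.loop (w := w) (A := A) (σ := σ₂)
    (c := .seq (wset 28 (reg 14 + 1) (.wload 28 (reg 14) * .wload 28 (reg 14)))
      (wset 14 0 (reg 14 + 1)))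
    (b := (Exp.wload 28 (reg 14)).lt (reg 0))
    (fun σ' => σ'.w 14 0 ≤ E ∧ (∀ j ≤ σ'.w 14 0, σ'.w 28 j = 2 ^ 2 ^ j) ∧
      (σ'.w 14 0 = 0 ∨ 2 ^ 2 ^ (σ'.w 14 0 - 1) < n) ∧ σ'.w 28 (σ'.w 14 0) < 2 ^ w)
    (fun σ' => 100 * (E + 1 - σ'.w 14 0)) (fun σ' => 100 * (E + 1 - σ'.w 14 0)) ?_ ?_
  · rw [h₂, hsz] at hloop
    refine hloop.conseq le_rfl le_rfl ?_
    rintro σ' ⟨⟨m₁, m₂, m₃, m₄⟩, hb⟩ hf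
    refine ⟨m₁, m₂, ?_, m₃⟩
    rw [evw_lt, evw_load, evw_reg, evw_reg, hf.w 0 rfl, g0, Nat.mod_eq_of_lt (by omega : n < _),
      Nat.mod_eq_of_lt (by omega : σ'.w 14 0 < _), Nat.mod_eq_of_lt m₄, m₂ _ le_rfl] at hb
    by_contra h
    rw [if_pos (not_le.1 h)] at hb
    exact one_ne_zero hb
  · rintro σ' ⟨m₁, m₂, m₃, m₄⟩ hf hb
    rw [evw_lt, evw_load, evw_reg, evw_reg, hf.w 0 rfl, g0, Nat.mod_eq_of_lt (by omega : n < _),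
      Nat.mod_eq_of_lt (by omega : σ'.w 14 0 < _), Nat.mod_eq_of_lt m₄] at hb
    have hlt : σ'.w 28 (σ'.w 14 0) < n := by
      by_contra h
      exact hb (if_neg h)
    have hlt' := hlt
    rw [m₂ _ le_rfl] at hlt'
    have hJE : σ'.w 14 0 < E := by
      have h₁ : 2 ^ σ'.w 14 0 < E := (Nat.pow_lt_pow_iff_right Nat.one_lt_two).1 (hlt'.trans_le hE)
      exact Nat.lt_two_pow_self.trans h₁
    have hsq : σ'.w 28 (σ'.w 14 0) * σ'.w 28 (σ'.w 14 0) < 2 ^ w :=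
      (Nat.mul_le_mul hlt.le hlt.le).trans_lt hnn
    have e14 : evw w σ' 0 (reg 14) = σ'.w 14 0 := by rw [evw_reg, Nat.mod_eq_of_lt (by omega)]
    have hinc : ∀ σ'' : Mem, σ''.w 14 0 = σ'.w 14 0 →
        evw w σ'' 0 (reg 14 + 1) = σ'.w 14 0 + 1 := by
      intro σ'' h
      rw [evw_add, evw_reg, h, evw_one _ _ _ (by omega), Nat.mod_eq_of_lt
        (by omega : σ'.w 14 0 < _), Nat.mod_eq_of_lt (by omega)]
    refine ⟨40 + 20, 40 + 20, Runs.seq (Q := fun σ'' => σ''.w 28 = Function.update (σ'.w 28)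
      (σ'.w 14 0 + 1) (σ'.w 28 (σ'.w 14 0) * σ'.w 28 (σ'.w 14 0))) (Runs.wset (σ'.w 14 0 + 1)
      (σ'.w 28 (σ'.w 14 0) * σ'.w 28 (σ'.w 14 0)) (by omega) (hinc σ' rfl) ?_ ?_ _ (Nat.le_of_ble_eq_true rfl))
      fun σ'' h'' hf'' => Runs.wset 0 (σ'.w 14 0 + 1) (by omega) (evw_zero ..)
        (hinc σ'' (by rw [hf''.w 14 rfl])) ?_ _
        (Nat.le_of_ble_eq_true rfl)⟩
    · rw [evw_mul, evw_load, e14, Nat.mod_eq_of_lt m₄, Nat.mod_eq_of_lt hsq]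
    · simp
    · rw [hsz]
      simp only [Mem.setW_w, if_true, Function.update_self, h'',
        show (28 : ℕ) ≠ 14 by decide, if_false]
      refine ⟨⟨hJE, fun j hj => ?_, Or.inr ?_, hsq⟩, by omega, by omega⟩
      · rcases Nat.le_succ_iff.1 hj with hj | rfl
        · rw [Function.update_of_ne (by omega), m₂ j hj]
        · rw [Function.update_self, m₂ _ le_rfl, ← pow_add, pow_succ, mul_two]
      · simpa using hlt'
  · refine ⟨by omega, fun j hj => ?_, Or.inl h₂, ?_⟩
    · obtain rfl : j = 0 := by omega
      rw [hf₂.w 28 rfl, h₁]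
      norm_num
    · rw [h₂, hf₂.w 28 rfl, h₁]
      exact h4w

/-- Every round halves the exponent of the power of two in the colour range while a factor `S ^ 2`
persists, and it adds at most a `1 / S` fraction of the total cost. The initial colouring is
injective and has no monochromatic cost, since owners differ from their neighbours. -/
theorem runs_colorNodes {n N S J : ℕ} (hw : 1 < w) (hS : 0 < S)
    (hw' : (n + 1) ^ 5 + N < 2 ^ w) (hSn : S ^ 4 < n) (hJw : J < 2 ^ w)
    (h0 : σ.w 0 0 = n) (h10 : σ.w 10 0 = N) (h12 : σ.w 12 0 = S) (h14 : σ.w 14 0 = J)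
    (h28 : ∀ j ≤ J, σ.w 28 j = 2 ^ 2 ^ j) (hJ : n ≤ 2 ^ 2 ^ J)
    (hJ' : J = 0 ∨ 2 ^ 2 ^ (J - 1) < n)
    (hsrc : ∀ p < N, σ.w 20 p < n) (hnbr : ∀ p < N, σ.w 2 p < n)
    (hne : ∀ p < N, σ.w 20 p ≠ σ.w 2 p) (hcst : ∀ p < N, 0 ≤ σ.r 1 p) :
    Runs w A colorNodes σ (3000 * ((J + 1) * (N + n + S)))
      (3000 * ((J + 1) * (S + Nat.clog 2 (N + 1)))) fun σ' =>
      (∀ v < n, σ'.w 21 v < S * S * 2) ∧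
      S * monoCost N (σ.w 20) (σ.w 2) (σ.r 1) (σ'.w 21) ≤
        J * ∑ p ∈ Finset.range N, σ.r 1 p := by
  have hS4 : S * S * (S * S) < n := by
    have : S * S * (S * S) = S ^ 4 := by ring
    omega
  have hSS : S * S < n := (Nat.le_mul_self _).trans_lt hS4
  have hSn' : S < n := (Nat.le_mul_self _).trans_lt hSS
  have hn5 : n * n * n ≤ (n + 1) ^ 5 := by
    calc n * n * n = n ^ 3 := by ring
      _ ≤ (n + 1) ^ 3 := Nat.pow_le_pow_left (by omega) 3
      _ ≤ (n + 1) ^ 5 := Nat.pow_le_pow_right (by omega) (by omega)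
  have hn5' : 3 * (n + 1) ≤ (n + 1) ^ 5 := by
    have h₁ : 3 ≤ (n + 1) ^ 4 := by
      have : 2 ^ 4 ≤ (n + 1) ^ 4 := Nat.pow_le_pow_left (by omega) 4
      omega
    calc 3 * (n + 1) ≤ (n + 1) ^ 4 * (n + 1) := Nat.mul_le_mul_right _ h₁
      _ = (n + 1) ^ 5 := by ring
  refine Runs.conseq
    (W := 20 + (20 + (20 * (n + 1) + ((2000 * (N + n + S) + 40) * J + 40))))
    (D := 20 + (20 + (20 + ((2000 * (S + Nat.clog 2 (N + 1)) + 40) * J + 40))))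
    (Runs.seq (Q := fun σ' => σ'.w 30 0 = N) (Runs.wset 0 N (by omega) (evw_zero ..) ?_ ?_ _
      (Nat.le_of_ble_eq_true rfl)) fun σ₁ h₁ hf₁ =>
    Runs.seq (Q := fun σ' => σ'.w 31 0 = S) (Runs.wset 0 S (by omega) (evw_zero ..) ?_ ?_ _
      (Nat.le_of_ble_eq_true rfl)) fun σ₂ h₂ hf₂ =>
    Runs.seq (Q := fun σ' => ∀ v < n, σ'.w 21 v = v) (Runs.wpar n (fun v => v) (by omega) ?_ ?_ ?_ _
      (Nat.le_of_ble_eq_true rfl)) fun σ₃ h₃ hf₃ => ?_)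
    (by nlinarith) (by nlinarith) fun _ h _ => h
  · rw [evw_reg, h10, Nat.mod_eq_of_lt (by omega)]
  · simp
  · rw [evw_reg, hf₁.w 12 rfl, h12, Nat.mod_eq_of_lt (by omega)]
  · simp
  · rw [evw_reg, hf₂.w 0 rfl, hf₁.w 0 rfl, h0, Nat.mod_eq_of_lt (by omega)]
  · intro v _
    rfl
  · intro f hf v hv
    simpa using hf v hv
  have g0 : σ₃.w 0 0 = n := by rw [hf₃.w 0 rfl, hf₂.w 0 rfl, hf₁.w 0 rfl, h0]
  have g10 : σ₃.w 10 0 = N := by rw [hf₃.w 10 rfl, hf₂.w 10 rfl, hf₁.w 10 rfl, h10]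
  have g12 : σ₃.w 12 0 = S := by rw [hf₃.w 12 rfl, hf₂.w 12 rfl, hf₁.w 12 rfl, h12]
  have g14 : σ₃.w 14 0 = J := by rw [hf₃.w 14 rfl, hf₂.w 14 rfl, hf₁.w 14 rfl, h14]
  have g30 : σ₃.w 30 0 = N := by rw [hf₃.w 30 rfl, hf₂.w 30 rfl, h₁]
  have g31 : σ₃.w 31 0 = S := by rw [hf₃.w 31 rfl, h₂]
  have g20 : σ₃.w 20 = σ.w 20 := by rw [hf₃.w 20 rfl, hf₂.w 20 rfl, hf₁.w 20 rfl]
  have g2 : σ₃.w 2 = σ.w 2 := by rw [hf₃.w 2 rfl, hf₂.w 2 rfl, hf₁.w 2 rfl]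
  have g28 : σ₃.w 28 = σ.w 28 := by rw [hf₃.w 28 rfl, hf₂.w 28 rfl, hf₁.w 28 rfl]
  have g1 : σ₃.r 1 = σ.r 1 := by rw [hf₃.r 1 rfl, hf₂.r 1 rfl, hf₁.r 1 rfl]
  refine (Runs.forLoop (σ := σ₃) (fun k σ' => (∀ v < n, σ'.w 21 v < S * S * 2 ^ 2 ^ (J - k)) ∧
      S * monoCost N (σ.w 20) (σ.w 2) (σ.r 1) (σ'.w 21) ≤ k * ∑ p ∈ Finset.range N, σ.r 1 p) 0 J
    (fun _ => 2000 * (N + n + S)) (fun _ => 2000 * (S + Nat.clog 2 (N + 1))) (by omega)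
    (by omega) hJw (evw_zero ..) rfl ?_ ?_ ?_ ?_ 40 (Nat.le_of_ble_eq_true rfl)).conseq ?_ ?_ ?_
  · intro _ σ' _ hf
    rw [evw_reg, hf.w 14 rfl, g14, Nat.mod_eq_of_lt hJw]
  · intro _ σ' f h
    simpa using h
  · refine ⟨fun v hv => ?_, ?_⟩
    · rw [h₃ v hv, Nat.sub_zero]
      have : 1 * 2 ^ 2 ^ J ≤ S * S * 2 ^ 2 ^ J :=
        Nat.mul_le_mul_right _ (Nat.mul_pos hS hS)
      omega
    · have : monoCost N (σ.w 20) (σ.w 2) (σ.r 1) (σ₃.w 21) = 0 := by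
        refine Finset.sum_eq_zero fun p hp => ?_
        rw [Finset.mem_range] at hp
        rw [h₃ _ (hsrc p hp), h₃ _ (hnbr p hp), if_neg (hne p hp)]
      simp [this]
  · rintro k σ' - hk ⟨hI, hI'⟩ hf h18
    have f28 : σ'.w 28 (J - k - 1) = 2 ^ 2 ^ (J - k - 1) := by
      rw [hf.w 28 rfl, g28, h28 _ (by omega)]
    have hsq : 2 ^ 2 ^ (J - k) = 2 ^ 2 ^ (J - k - 1) * 2 ^ 2 ^ (J - k - 1) := by
      rw [← pow_add, ← mul_two, ← pow_succ]
      congr 2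
      omega
    have hTn : 2 ^ 2 ^ (J - k - 1) < n := by
      have : 2 ^ 2 ^ (J - k - 1) ≤ 2 ^ 2 ^ (J - 1) :=
        Nat.pow_le_pow_right two_pos (Nat.pow_le_pow_right two_pos (by omega))
      rcases hJ' with h | h <;> omega
    have hTn' : 2 ^ 2 ^ (J - k) ≤ n * n := by
      rw [hsq]
      exact Nat.mul_le_mul hTn.le hTn.le
    have hpos : 0 < 2 ^ 2 ^ (J - k - 1) := by positivity
    set T := 2 ^ 2 ^ (J - k - 1) with hT
    -- With `q = S * T` the current range is exactly `q * q`, as `runs_colorRound` requires, and the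
    -- new range `S * q` is the next instance of the invariant.
    have hqq : S * T * (S * T) = S * S * 2 ^ 2 ^ (J - k) := by
      rw [hsq]
      ring
    have hSq : S ≤ S * T := Nat.le_mul_of_pos_right _ hpos
    have hSqq : S * (S * T) ≤ S * T * (S * T) := Nat.mul_le_mul_right _ hSq
    -- Here `S ^ 2 < n` and `T < n` are used: intermediate colours may exceed `n` but remain
    -- polynomial in `n`.
    have hqlt : S * T * (S * T) ≤ n * n * n := by
      rw [hqq, Nat.mul_comm]
      exact Nat.mul_le_mul hTn' hSS.le
    have hqlt' : S * T * (S * T) + S * (S * T) < 2 ^ w := by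
      have : 2 * (n * n * n) ≤ (n + 1) ^ 5 := by
        have h₁ : 2 ≤ (n + 1) ^ 2 := by
          have : 2 ^ 2 ≤ (n + 1) ^ 2 := Nat.pow_le_pow_left (by omega) 2
          omega
        calc 2 * (n * n * n) = 2 * n ^ 3 := by ring
          _ ≤ (n + 1) ^ 2 * (n + 1) ^ 3 :=
            Nat.mul_le_mul h₁ (Nat.pow_le_pow_left (by omega) 3)
          _ = (n + 1) ^ 5 := by ring
      omega
    have hlt : S * T < 2 ^ w := (Nat.le_mul_self _).trans_lt (by omega)
    have := runs_colorRound (A := A) (σ := σ') (n := n) (N := N) (S := S) (J := J) (j := k)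
      (S * T) hw hS hk hJw (by omega) (by omega) hqlt' (by rw [hf.w 0 rfl, g0])
      (by rw [hf.w 10 rfl, g10]) (by rw [hf.w 12 rfl, g12]) (by rw [hf.w 14 rfl, g14]) h18
      (by rw [f28]; exact (Nat.le_mul_of_pos_left _ hS).trans_lt hlt) (by rw [f28]) hlt
      (by rw [hf.w 30 rfl, g30]) (by rw [hf.w 31 rfl, g31])
      (by rw [hf.w 20 rfl, g20]; exact hsrc) (by rw [hf.w 2 rfl, g2]; exact hnbr)
      (by rw [hqq]; exact hI) (by rw [hf.r 1 rfl, g1]; exact hcst)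
    rw [hf.w 20 rfl, hf.w 2 rfl, hf.r 1 rfl, g20, g2, g1] at this
    refine this.conseq le_rfl le_rfl fun σ'' h _ => ⟨fun v hv => ?_, ?_⟩
    · rw [show J - (k + 1) = J - k - 1 by omega, mul_assoc]
      exact h.1 v hv
    · push_cast
      linarith [h.2]
  · simp only [Finset.sum_const, Nat.card_Ico, smul_eq_mul]
    rw [Nat.sub_zero, Nat.mul_comm]
  · simp only [Finset.sum_const, Nat.card_Ico, smul_eq_mul]
    rw [Nat.sub_zero, Nat.mul_comm]
  · rintro σ' ⟨m₁, m₂⟩ -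
    rw [Nat.sub_self, pow_zero, pow_one] at m₁
    exact ⟨m₁, m₂⟩

end

/-! ### Contracting the colour classes -/

/-- The memory holds, as input of the greedy algorithm, the graph with nodes `0, …, K - 1` and `M`
list entries that results from contracting the colour classes. -/
structure Contracted (n N K M : ℕ) (src nbr : ℕ → ℕ) (cst util : ℕ → ℝ) (col : ℕ → ℕ) (σ : Mem) :
    Prop where
  col_lt : ∀ v < n, col v < K
  nodes : σ.w 40 0 = K
  mono : ∀ c < K, σ.w 25 c ≤ σ.w 25 (c + 1)
  last : σ.w 25 K = M
  nbr_lt : ∀ p < M, σ.w 26 p < K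
  util : ∀ c < K, σ.r 13 c = ∑ v ∈ Finset.range n, if col v = c then util v else 0
  sum : ∀ c < K, ∀ g : ℕ → ℝ,
    ∑ p ∈ Finset.Ico (σ.w 25 c) (σ.w 25 (c + 1)), σ.r 12 p * g (σ.w 26 p) =
      ∑ p ∈ Finset.range N, if col (src p) = c then cst p * g (col (nbr p)) else 0

/-- Sum up the utilities of the colour classes. -/
def contractNodes : Cmd :=
  .seq (wset 40 0 (reg 12 * reg 12 * 2)) <|
  .seq (wset 30 0 (reg 0)) <|
  .seq (wset 31 0 (reg 40)) <|
  .seq (wpar (reg 0) 24 (.wload 21 .pid)) <|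
  .seq (rpar (reg 0) 11 (.rload 0 .pid)) <|
  .seq hist <|
  rpar (reg 40) 13 (.rload 10 .pid)

/-- Sum up the costs between the colour classes. -/
def contractEdges : Cmd :=
  .seq (wset 30 0 (reg 10)) <|
  .seq (wset 31 0 (reg 40 * reg 40)) <|
  .seq (wpar (reg 10) 24 (colSrc * reg 40 + colNbr)) <|
  .seq (rpar (reg 10) 11 (.rload 1 .pid)) <|
  .seq hist <|
  .seq (rpar (reg 31) 12 (.rload 10 .pid)) <|
  .seq (wpar (reg 40 + 1) 25 (.pid * reg 40)) <|
  wpar (reg 31) 26 (.pid % reg 40)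

/-- Contract the colour classes. -/
def contract : Cmd := .seq contractNodes contractEdges

/-- Colour all nodes differently and copy the graph. -/
def copyGraph : Cmd :=
  .seq (wset 40 0 (reg 0)) <|
  .seq (wpar (reg 0) 21 .pid) <|
  .seq (rpar (reg 0) 13 (.rload 0 .pid)) <|
  .seq (rpar (reg 10) 12 (.rload 1 .pid)) <|
  .seq (wpar (reg 0 + 1) 25 (.wload 1 .pid)) <|
  wpar (reg 10) 26 (.wload 2 .pid)

section

variable {w : ℕ} {A : Arbiter} {σ : Mem}

/-- `H` is a dense `K × K` cost matrix stored row by row: cell `c * K + d` collects the entries from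
class `c` to class `d`. Summing a row against `g` regroups these entries by the class of the
neighbour. -/
theorem sum_contracted {K N : ℕ} (hK : 0 < K) {a b : ℕ → ℕ} {cst H : ℕ → ℝ} {nb : ℕ → ℕ}
    (hb : ∀ p < N, b p < K)
    (hH : ∀ x < K * K, H x = ∑ p ∈ Finset.range N, if a p * K + b p = x then cst p else 0)
    (hnb : ∀ x < K * K, nb x = x % K) {c : ℕ} (hc : c < K) (g : ℕ → ℝ) :
    ∑ x ∈ Finset.Ico (c * K) ((c + 1) * K), H x * g (nb x) =
      ∑ p ∈ Finset.range N, if a p = c then cst p * g (b p) else 0 := by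
  rw [Finset.sum_Ico_eq_sum_range, show (c + 1) * K - c * K = K by rw [Nat.succ_mul]; omega]
  have h : ∀ d ∈ Finset.range K, H (c * K + d) * g (nb (c * K + d)) =
      ∑ p ∈ Finset.range N, if b p = d then if a p = c then cst p * g (b p) else 0 else 0 := by
    intro d hd
    rw [Finset.mem_range] at hd
    have hlt := mul_add_lt hc hd
    rw [hH _ hlt, hnb _ hlt, Nat.mul_add_mod_self_right, Nat.mod_eq_of_lt hd, Finset.sum_mul]
    refine Finset.sum_congr rfl fun p hp => ?_
    have hbp := hb p (Finset.mem_range.1 hp)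
    by_cases h : a p * K + b p = c * K + d
    · obtain ⟨rfl, rfl⟩ := mul_add_inj hbp hd h
      simp
    · by_cases hbd : b p = d
      · have : a p ≠ c := by
          rintro rfl
          exact h (by rw [hbd])
        simp [hbd, this, hK.ne']
      · simp [h, hbd]
  rw [Finset.sum_congr rfl h, Finset.sum_comm]
  refine Finset.sum_congr rfl fun p hp => ?_
  rw [Finset.sum_ite_eq, if_pos (Finset.mem_range.2 (hb p (Finset.mem_range.1 hp)))]

theorem runs_contractNodes {n S K : ℕ} (hw : 1 < w) (hS : 0 < S) (hK : K = S * S * 2)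
    (hKn : K ≤ 4 * n) (hw' : 20 * (n + 1) < 2 ^ w) (h0 : σ.w 0 0 = n) (h12 : σ.w 12 0 = S)
    (hcol : ∀ v < n, σ.w 21 v < K) :
    Runs w A contractNodes σ (10000 * (n + 1)) (10000 * (K + Nat.clog 2 n + 1)) fun σ' =>
      σ'.w 40 0 = K ∧
      ∀ c < K, σ'.r 13 c = ∑ v ∈ Finset.range n, if σ.w 21 v = c then σ.r 0 v else 0 := by
  have hK0 : 0 < K := by rw [hK]; positivity
  have hSS : S * S ≤ K := by omega
  have hSS' : S ≤ S * S := Nat.le_mul_self S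
  have hclog : Nat.clog 2 (n + 1) ≤ Nat.clog 2 n + 1 := by
    refine Nat.clog_le_of_le_pow ?_
    have := Nat.le_pow_clog Nat.one_lt_two n
    have h1 : 0 < 2 ^ Nat.clog 2 n := by positivity
    rw [pow_succ]
    omega
  refine Runs.conseq
    (W := 30 + (20 + (20 + (20 * (n + 1) + (20 * (n + 1) + (1000 * (n + K) + 20 * (K + 1)))))))
    (D := 30 + (20 + (20 + (20 + (20 + (1000 * (K + Nat.clog 2 (n + 1)) + 20))))))
    (Runs.seq (Q := fun σ' => σ'.w 40 0 = K) (Runs.wset 0 K (by omega) (evw_zero ..) ?_ ?_ _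
      (Nat.le_of_ble_eq_true rfl)) fun σ₁ h₁ hf₁ =>
    Runs.seq (Q := fun σ' => σ'.w 30 0 = n) (Runs.wset 0 n (by omega) (evw_zero ..) ?_ ?_ _
      (Nat.le_of_ble_eq_true rfl)) fun σ₂ h₂ hf₂ =>
    Runs.seq (Q := fun σ' => σ'.w 31 0 = K) (Runs.wset 0 K (by omega) (evw_zero ..) ?_ ?_ _
      (Nat.le_of_ble_eq_true rfl)) fun σ₃ h₃ hf₃ =>
    Runs.seq (Q := fun σ' => ∀ v < n, σ'.w 24 v = σ.w 21 v) (Runs.wpar n (fun v => σ.w 21 v)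
      (by omega) ?_ ?_ ?_ _ (Nat.le_of_ble_eq_true rfl)) fun σ₄ h₄ hf₄ =>
    Runs.seq (Q := fun σ' => ∀ v < n, σ'.r 11 v = σ.r 0 v) (Runs.rpar n (fun v => σ.r 0 v)
      (by omega) ?_ ?_ ?_ _ (Nat.le_of_ble_eq_true rfl)) fun σ₅ h₅ hf₅ =>
    Runs.seq (runs_hist (N := n) (S := K) hw hK0 (by omega) ?_ ?_ ?_) fun σ₆ h₆ hf₆ =>
    Runs.rpar K (fun v => σ₆.r 10 v) (by omega) ?_ ?_ ?_ _ (Nat.le_of_ble_eq_true rfl))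
    (by omega) (by omega) fun _ h _ => h
  · have : S * S * 2 < 2 ^ w := by omega
    simp (disch := omega) only [evw_mul, evw_reg, evw_two, h12, Nat.mod_eq_of_lt]
    exact hK.symm
  · simp
  · rw [evw_reg, hf₁.w 0 rfl, h0, Nat.mod_eq_of_lt (by omega)]
  · simp
  · rw [evw_reg, hf₂.w 40 rfl, h₁, Nat.mod_eq_of_lt (by omega)]
  · simp
  · rw [evw_reg, hf₃.w 0 rfl, hf₂.w 0 rfl, hf₁.w 0 rfl, h0, Nat.mod_eq_of_lt (by omega)]
  · intro v hv
    have := hcol v hv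
    rw [evw_load, evw_pid, hf₃.w 21 rfl, hf₂.w 21 rfl, hf₁.w 21 rfl, Nat.mod_eq_of_lt (by omega)]
  · intro f hf v hv
    simpa using hf v hv
  · rw [evw_reg, hf₄.w 0 rfl, hf₃.w 0 rfl, hf₂.w 0 rfl, hf₁.w 0 rfl, h0, Nat.mod_eq_of_lt (by omega)]
  · intro v hv
    rw [evr_load, evw_pid, hf₄.r 0 rfl, hf₃.r 0 rfl, hf₂.r 0 rfl, hf₁.r 0 rfl]
  · intro f hf _ v hv
    simpa using hf v hv
  · rw [hf₅.w 30 rfl, hf₄.w 30 rfl, hf₃.w 30 rfl, h₂]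
  · rw [hf₅.w 31 rfl, hf₄.w 31 rfl, h₃]
  · intro v hv
    rw [hf₅.w 24 rfl, h₄ v hv]
    exact hcol v hv
  · rw [evw_reg, hf₆.w 40 rfl, hf₅.w 40 rfl, hf₄.w 40 rfl, hf₃.w 40 rfl, hf₂.w 40 rfl, h₁,
      Nat.mod_eq_of_lt (by omega)]
  · intro c _
    rw [evr_load, evw_pid]
  · intro f hf _
    refine ⟨?_, fun c hc => ?_⟩
    · rw [Mem.setR_w, hf₆.w 40 rfl, hf₅.w 40 rfl, hf₄.w 40 rfl, hf₃.w 40 rfl, hf₂.w 40 rfl, h₁]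
    · rw [Mem.setR_r, if_pos rfl, hf c hc, h₆ c hc]
      refine Finset.sum_congr rfl fun v hv => ?_
      rw [Finset.mem_range] at hv
      rw [hf₅.w 24 rfl, h₄ v hv, h₅ v hv]

/-- The hypothesis `K * K ≤ 4 * n` makes the dense matrix affordable within linear work. Its
diagonal is not cleared; the greedy algorithm disregards loops. -/
theorem runs_contractEdges {n N K : ℕ} {util : ℕ → ℝ} (hw : 1 < w) (hK0 : 0 < K)
    (hKn : K * K ≤ 4 * n) (hw' : 20 * (n + 1) + N < 2 ^ w)
    (g40 : σ.w 40 0 = K) (g10 : σ.w 10 0 = N)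
    (hsrc : ∀ p < N, σ.w 20 p < n) (hnbr : ∀ p < N, σ.w 2 p < n)
    (hcol : ∀ v < n, σ.w 21 v < K)
    (g13 : ∀ c < K, σ.r 13 c = ∑ v ∈ Finset.range n, if σ.w 21 v = c then util v else 0) :
    Runs w A contractEdges σ (10000 * (N + n + 1)) (10000 * (K * K + Nat.clog 2 (N + 1) + 1))
      (Contracted n N K (K * K) (σ.w 20) (σ.w 2) (σ.r 1) util (σ.w 21)) := by
  have hKK : K ≤ K * K := Nat.le_mul_self K
  have hkey : ∀ p < N, σ.w 21 (σ.w 20 p) * K + σ.w 21 (σ.w 2 p) < K * K := fun p hp =>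
    mul_add_lt (hcol _ (hsrc p hp)) (hcol _ (hnbr p hp))
  refine Runs.conseq
    (W := 20 + (20 + (20 * (N + 1) + (20 * (N + 1) + (1000 * (N + K * K) + (20 * (K * K + 1) +
      (20 * (K + 1 + 1) + 20 * (K * K + 1))))))))
    (D := 20 + (20 + (20 + (20 + (1000 * (K * K + Nat.clog 2 (N + 1)) + (20 + (20 + 20)))))))
    (Runs.seq (Q := fun σ' => σ'.w 30 0 = N) (Runs.wset 0 N (by omega) (evw_zero ..) ?_ ?_ _
      (Nat.le_of_ble_eq_true rfl)) fun τ₁ k₁ kf₁ =>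
    Runs.seq (Q := fun σ' => σ'.w 31 0 = K * K) (Runs.wset 0 (K * K) (by omega) (evw_zero ..) ?_ ?_
      _ (Nat.le_of_ble_eq_true rfl)) fun τ₂ k₂ kf₂ =>
    Runs.seq (Q := fun σ' => ∀ p < N, σ'.w 24 p = σ.w 21 (σ.w 20 p) * K + σ.w 21 (σ.w 2 p))
      (Runs.wpar N (fun p => σ.w 21 (σ.w 20 p) * K + σ.w 21 (σ.w 2 p))
      (by omega) ?_ ?_ ?_ _ (Nat.le_of_ble_eq_true rfl)) fun τ₃ k₃ kf₃ =>
    Runs.seq (Q := fun σ' => ∀ p < N, σ'.r 11 p = σ.r 1 p) (Runs.rpar N (fun p => σ.r 1 p)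
      (by omega) ?_ ?_ ?_ _ (Nat.le_of_ble_eq_true rfl)) fun τ₄ k₄ kf₄ =>
    Runs.seq (runs_hist (N := N) (S := K * K) hw (by omega) (by omega) ?_ ?_ ?_) fun τ₅ k₅ kf₅ =>
    Runs.seq (Q := fun σ' => ∀ c < K * K, σ'.r 12 c = τ₅.r 10 c) (Runs.rpar (K * K)
      (fun v => τ₅.r 10 v) (by omega) ?_ ?_ ?_ _ (Nat.le_of_ble_eq_true rfl)) fun τ₆ k₆ kf₆ =>
    Runs.seq (Q := fun σ' => ∀ c < K + 1, σ'.w 25 c = c * K) (Runs.wpar (K + 1) (fun v => v * K)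
      (by omega) ?_ ?_ ?_ _ (Nat.le_of_ble_eq_true rfl)) fun τ₇ k₇ kf₇ =>
    Runs.wpar (K * K) (fun v => v % K) (by omega) ?_ ?_ ?_ _ (Nat.le_of_ble_eq_true rfl))
    (by omega) (by omega) fun _ h _ => h
  · rw [evw_reg, g10, Nat.mod_eq_of_lt (by omega)]
  · simp
  · rw [evw_mul, evw_reg, kf₁.w 40 rfl, g40, Nat.mod_eq_of_lt (by omega : K < 2 ^ w),
      Nat.mod_eq_of_lt (by omega)]
  · simp
  · rw [evw_reg, kf₂.w 10 rfl, kf₁.w 10 rfl, g10, Nat.mod_eq_of_lt (by omega)]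
  · intro p hp
    have l₁ := hsrc p hp
    have l₂ := hnbr p hp
    have l₃ := hcol _ l₁
    have l₄ := hcol _ l₂
    have l₅ := hkey p hp
    rw [colSrc, colNbr, evw_add, evw_mul, evw_load, evw_load, evw_load, evw_load, evw_pid, evw_reg,
      kf₂.w 20 rfl, kf₁.w 20 rfl, kf₂.w 21 rfl, kf₁.w 21 rfl, kf₂.w 2 rfl, kf₁.w 2 rfl,
      kf₂.w 40 rfl, kf₁.w 40 rfl, g40]
    simp (disch := omega) only [Nat.mod_eq_of_lt]
  · intro f hf v hv
    simpa using hf v hv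
  · rw [evw_reg, kf₃.w 10 rfl, kf₂.w 10 rfl, kf₁.w 10 rfl, g10, Nat.mod_eq_of_lt (by omega)]
  · intro p hp
    rw [evr_load, evw_pid, kf₃.r 1 rfl, kf₂.r 1 rfl, kf₁.r 1 rfl]
  · intro f hf _ v hv
    simpa using hf v hv
  · rw [kf₄.w 30 rfl, kf₃.w 30 rfl, kf₂.w 30 rfl, k₁]
  · rw [kf₄.w 31 rfl, kf₃.w 31 rfl, k₂]
  · intro p hp
    rw [kf₄.w 24 rfl, k₃ p hp]
    exact hkey p hp
  · rw [evw_reg, kf₅.w 31 rfl, kf₄.w 31 rfl, kf₃.w 31 rfl, k₂, Nat.mod_eq_of_lt (by omega)]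
  · intro p hp
    rw [evr_load, evw_pid]
  · intro f hf _ v hv
    simpa using hf v hv
  · rw [evw_add, evw_reg, evw_one _ _ _ (by omega), kf₆.w 40 rfl, kf₅.w 40 rfl, kf₄.w 40 rfl,
      kf₃.w 40 rfl, kf₂.w 40 rfl, kf₁.w 40 rfl, g40, Nat.mod_eq_of_lt (by omega : K < 2 ^ w),
      Nat.mod_eq_of_lt (by omega)]
  · intro c hc
    have hcK : c * K ≤ K * K := Nat.mul_le_mul_right _ (by omega)
    rw [evw_mul, evw_reg, evw_pid, kf₆.w 40 rfl, kf₅.w 40 rfl, kf₄.w 40 rfl,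
      kf₃.w 40 rfl, kf₂.w 40 rfl, kf₁.w 40 rfl, g40, Nat.mod_eq_of_lt (by omega : K < 2 ^ w),
      Nat.mod_eq_of_lt (by omega)]
  · intro f hf v hv
    simpa using hf v hv
  · rw [evw_reg, kf₇.w 31 rfl, kf₆.w 31 rfl, kf₅.w 31 rfl, kf₄.w 31 rfl, kf₃.w 31 rfl, k₂,
      Nat.mod_eq_of_lt (by omega)]
  · intro c hc
    rw [evw_mod, evw_reg, evw_pid, kf₇.w 40 rfl, kf₆.w 40 rfl, kf₅.w 40 rfl, kf₄.w 40 rfl,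
      kf₃.w 40 rfl, kf₂.w 40 rfl, kf₁.w 40 rfl, g40, Nat.mod_eq_of_lt (by omega : K < 2 ^ w)]
  · intro f hf
    have e25 : (τ₇.setW 26 f).w 25 = τ₇.w 25 := by simp
    have e26 : (τ₇.setW 26 f).w 26 = f := by simp
    refine ⟨hcol, ?_, fun c hc => ?_, ?_, fun p hp => ?_, fun c hc => ?_, fun c hc g => ?_⟩
    · simp only [Mem.setW_w, show (40 : ℕ) ≠ 26 by decide, if_false]
      rw [kf₇.w 40 rfl, kf₆.w 40 rfl, kf₅.w 40 rfl, kf₄.w 40 rfl,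
        kf₃.w 40 rfl, kf₂.w 40 rfl, kf₁.w 40 rfl, g40]
    · rw [e25, k₇ c (by omega), k₇ (c + 1) (by omega)]
      exact Nat.mul_le_mul_right _ (by omega)
    · rw [e25, k₇ K (by omega)]
    · rw [e26, hf p hp]
      exact Nat.mod_lt _ hK0
    · rw [Mem.setW_r, kf₇.r 13 rfl, kf₆.r 13 rfl, kf₅.r 13 rfl, kf₄.r 13 rfl,
        kf₃.r 13 rfl, kf₂.r 13 rfl, kf₁.r 13 rfl, g13 c hc]
    · rw [e25, e26, Mem.setW_r, kf₇.r 12 rfl, k₇ c (by omega), k₇ (c + 1) (by omega)]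
      refine sum_contracted (a := fun p => σ.w 21 (σ.w 20 p)) (b := fun p => σ.w 21 (σ.w 2 p)) hK0
        (fun p hp => hcol _ (hnbr p hp)) (fun x hx => ?_) hf hc g
      rw [k₆ x hx, k₅ x hx]
      refine Finset.sum_congr rfl fun p hp => ?_
      rw [Finset.mem_range] at hp
      rw [kf₄.w 24 rfl, k₃ p hp, k₄ p hp]

theorem runs_contract {n N S K : ℕ} (hw : 1 < w) (hS : 0 < S) (hK : K = S * S * 2)
    (hKn : K * K ≤ 4 * n) (hw' : 20 * (n + 1) + N < 2 ^ w)
    (h0 : σ.w 0 0 = n) (h10 : σ.w 10 0 = N) (h12 : σ.w 12 0 = S)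
    (hsrc : ∀ p < N, σ.w 20 p < n) (hnbr : ∀ p < N, σ.w 2 p < n)
    (hcol : ∀ v < n, σ.w 21 v < K) :
    Runs w A contract σ (30000 * (N + n + 1)) (30000 * (K * K + Nat.clog 2 n + Nat.clog 2 (N + 1) + 1))
      (Contracted n N K (K * K) (σ.w 20) (σ.w 2) (σ.r 1) (σ.r 0) (σ.w 21)) := by
  have hK0 : 0 < K := by rw [hK]; positivity
  have hKK : K ≤ K * K := Nat.le_mul_self K
  refine ((runs_contractNodes hw hS hK (by omega) (by omega) h0 h12 hcol).seq
    fun σ₁ h₁ hf₁ => ?_).conseq (by omega : 10000 * (n + 1) + 10000 * (N + n + 1) ≤ _)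
    (by omega : 10000 * (K + Nat.clog 2 n + 1) + 10000 * (K * K + Nat.clog 2 (N + 1) + 1) ≤ _)
    fun _ h _ => h
  have := runs_contractEdges (A := A) (σ := σ₁) (n := n) (N := N) (K := K) (util := σ.r 0) hw hK0
    hKn hw' h₁.1 (by rw [hf₁.w 10 rfl, h10]) (by rwa [hf₁.w 20 rfl]) (by rwa [hf₁.w 2 rfl])
    (by rwa [hf₁.w 21 rfl]) (by rw [hf₁.w 21 rfl]; exact h₁.2)
  rwa [hf₁.w 20 rfl, hf₁.w 2 rfl, hf₁.w 21 rfl, hf₁.r 1 rfl] at this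

/-- The identity colouring turns the input into its own contraction, so both branches of the
algorithm share one analysis. The owners `src` occur only in the specification and need not be
computed. -/
theorem runs_copyGraph {n N : ℕ} (hw : 1 < w) (hw' : n + 1 + N < 2 ^ w)
    (h0 : σ.w 0 0 = n) (h10 : σ.w 10 0 = N) (hoff : ∀ v < n, σ.w 1 v ≤ σ.w 1 (v + 1))
    (hoffn : σ.w 1 n = N) (hnbr : ∀ p < N, σ.w 2 p < n) (src : ℕ → ℕ)
    (hsrc : ∀ p < N, Owns n (σ.w 1) (src p) p) :
    Runs w A copyGraph σ (1000 * (N + n + 1)) 1000 fun σ' => (∀ v < n, σ'.w 21 v = v) ∧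
      Contracted n N n N src (σ.w 2) (σ.r 1) (σ.r 0) (σ'.w 21) σ' := by
  have hoffN : ∀ v ≤ n, σ.w 1 v ≤ N := fun v hv => hoffn ▸ le_of_step hoff hv le_rfl
  refine Runs.conseq
    (W := 20 + (20 * (n + 1) + (20 * (n + 1) + (20 * (N + 1) + (20 * (n + 1 + 1) + 20 * (N + 1))))))
    (D := 20 + (20 + (20 + (20 + (20 + 20)))))
    (Runs.seq (Q := fun σ' => σ'.w 40 0 = n) (Runs.wset 0 n (by omega) (evw_zero ..) ?_ ?_ _
      (Nat.le_of_ble_eq_true rfl)) fun σ₁ h₁ hf₁ =>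
    Runs.seq (Q := fun σ' => ∀ v < n, σ'.w 21 v = v) (Runs.wpar n (fun v => v)
      (by omega) ?_ ?_ ?_ _ (Nat.le_of_ble_eq_true rfl)) fun σ₂ h₂ hf₂ =>
    Runs.seq (Q := fun σ' => ∀ v < n, σ'.r 13 v = σ.r 0 v) (Runs.rpar n (fun v => σ.r 0 v)
      (by omega) ?_ ?_ ?_ _ (Nat.le_of_ble_eq_true rfl)) fun σ₃ h₃ hf₃ =>
    Runs.seq (Q := fun σ' => ∀ p < N, σ'.r 12 p = σ.r 1 p) (Runs.rpar N (fun v => σ.r 1 v)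
      (by omega) ?_ ?_ ?_ _ (Nat.le_of_ble_eq_true rfl)) fun σ₄ h₄ hf₄ =>
    Runs.seq (Q := fun σ' => ∀ v < n + 1, σ'.w 25 v = σ.w 1 v) (Runs.wpar (n + 1)
      (fun v => σ.w 1 v) (by omega) ?_ ?_ ?_ _ (Nat.le_of_ble_eq_true rfl)) fun σ₅ h₅ hf₅ =>
    Runs.wpar N (fun v => σ.w 2 v) (by omega) ?_ ?_ ?_ _ (Nat.le_of_ble_eq_true rfl))
    (by omega) (by omega) fun _ h _ => h
  · rw [evw_reg, h0, Nat.mod_eq_of_lt (by omega)]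
  · simp
  · rw [evw_reg, hf₁.w 0 rfl, h0, Nat.mod_eq_of_lt (by omega)]
  · intro v _
    rfl
  · intro f hf v hv
    simpa using hf v hv
  · rw [evw_reg, hf₂.w 0 rfl, hf₁.w 0 rfl, h0, Nat.mod_eq_of_lt (by omega)]
  · intro v _
    rw [evr_load, evw_pid, hf₂.r 0 rfl, hf₁.r 0 rfl]
  · intro f hf _ v hv
    simpa using hf v hv
  · rw [evw_reg, hf₃.w 10 rfl, hf₂.w 10 rfl, hf₁.w 10 rfl, h10, Nat.mod_eq_of_lt (by omega)]
  · intro v _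
    rw [evr_load, evw_pid, hf₃.r 1 rfl, hf₂.r 1 rfl, hf₁.r 1 rfl]
  · intro f hf _ v hv
    simpa using hf v hv
  · rw [evw_add, evw_reg, evw_one _ _ _ (by omega), hf₄.w 0 rfl, hf₃.w 0 rfl, hf₂.w 0 rfl,
      hf₁.w 0 rfl, h0, Nat.mod_eq_of_lt (by omega : n < 2 ^ w), Nat.mod_eq_of_lt (by omega)]
  · intro v hv
    have := hoffN v (by omega)
    rw [evw_load, evw_pid, hf₄.w 1 rfl, hf₃.w 1 rfl, hf₂.w 1 rfl, hf₁.w 1 rfl,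
      Nat.mod_eq_of_lt (by omega)]
  · intro f hf v hv
    simpa using hf v hv
  · rw [evw_reg, hf₅.w 10 rfl, hf₄.w 10 rfl, hf₃.w 10 rfl, hf₂.w 10 rfl, hf₁.w 10 rfl, h10,
      Nat.mod_eq_of_lt (by omega)]
  · intro p hp
    have := hnbr p hp
    rw [evw_load, evw_pid, hf₅.w 2 rfl, hf₄.w 2 rfl, hf₃.w 2 rfl, hf₂.w 2 rfl, hf₁.w 2 rfl,
      Nat.mod_eq_of_lt (by omega)]
  · intro f hf
    have e25 : (σ₅.setW 26 f).w 25 = σ₅.w 25 := by simp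
    have e26 : (σ₅.setW 26 f).w 26 = f := by simp
    have e21 : ∀ v < n, (σ₅.setW 26 f).w 21 v = v := by
      intro v hv
      simp only [Mem.setW_w, show (21 : ℕ) ≠ 26 by decide, if_false]
      rw [hf₅.w 21 rfl, hf₄.w 21 rfl, hf₃.w 21 rfl, h₂ v hv]
    refine ⟨e21, fun v hv => by rwa [e21 v hv], ?_, fun c hc => ?_, ?_, fun p hp => ?_,
      fun c hc => ?_, fun c hc g => ?_⟩
    · simp only [Mem.setW_w, show (40 : ℕ) ≠ 26 by decide, if_false]
      rw [hf₅.w 40 rfl, hf₄.w 40 rfl, hf₃.w 40 rfl, hf₂.w 40 rfl, h₁]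
    · rw [e25, h₅ c (by omega), h₅ (c + 1) (by omega)]
      exact hoff c hc
    · rw [e25, h₅ n (by omega), hoffn]
    · rw [e26, hf p hp]
      exact hnbr p hp
    · rw [Mem.setW_r, hf₅.r 13 rfl, hf₄.r 13 rfl, h₃ c hc]
      rw [Finset.sum_congr rfl fun v hv => by rw [e21 v (Finset.mem_range.1 hv)]]
      rw [Finset.sum_ite_eq', if_pos (Finset.mem_range.2 hc)]
    · rw [e25, e26, h₅ c (by omega), h₅ (c + 1) (by omega), Mem.setW_r, hf₅.r 12 rfl]
      have hsub : Finset.Ico (σ.w 1 c) (σ.w 1 (c + 1)) ⊆ Finset.range N := by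
        intro p hp
        rw [Finset.mem_Ico] at hp
        have := hoffN (c + 1) hc
        exact Finset.mem_range.2 (by omega)
      rw [← Finset.sum_filter]
      refine Finset.sum_congr ?_ fun p hp => ?_
      · ext p
        rw [Finset.mem_filter, Finset.mem_Ico, Finset.mem_range]
        constructor
        · intro hp
          have hpN : p < N := Finset.mem_range.1 (hsub (Finset.mem_Ico.2 hp))
          refine ⟨hpN, ?_⟩
          rw [e21 _ (hsrc p hpN).1]
          exact (hsrc p hpN).unique hoff ⟨hc, hp⟩
        · rintro ⟨hpN, hp⟩
          rw [e21 _ (hsrc p hpN).1] at hp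
          exact hp ▸ (hsrc p hpN).2
      · rw [Finset.mem_filter, Finset.mem_range] at hp
        rw [h₄ p hp.1, hf p hp.1, e21 _ (hnbr p hp.1)]

end

/-! ### Analysis of the rounding -/

/-- Objective function of the contracted graph at the fractional selection `Y`. -/
noncomputable def objective (n N : ℕ) (src nbr : ℕ → ℕ) (cst util : ℕ → ℝ) (col : ℕ → ℕ)
    (Y : ℕ → ℝ) : ℝ :=
  ∑ v ∈ Finset.range n, util v * Y (col v) - 1 / 2 * ∑ p ∈ Finset.range N,
    cst p * if col (src p) = col (nbr p) then 0 else Y (col (src p)) * Y (col (nbr p))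

/-- Pairs inside a class are dropped, so the objective is affine in the coordinate `k`. Moving it
from 1/2 to `X k` changes the objective by the displacement times the partial derivative. -/
theorem objective_step {n N : ℕ} {src nbr col : ℕ → ℕ} {cst util X : ℕ → ℝ}
    (hsym : ∀ h : ℕ → ℕ → ℝ, ∑ p ∈ Finset.range N, cst p * h (src p) (nbr p) =
      ∑ p ∈ Finset.range N, cst p * h (nbr p) (src p)) (k : ℕ) :
    objective n N src nbr cst util col (fun d => if d < k + 1 then X d else 1 / 2) =
      objective n N src nbr cst util col (fun d => if d < k then X d else 1 / 2) +
      (X k - 1 / 2) * (∑ v ∈ Finset.range n, (if col v = k then util v else 0) -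
        ∑ p ∈ Finset.range N,
          if col (src p) = k then cst p * partialSel X k (col (nbr p)) else 0) := by
  have h₁ : ∑ v ∈ Finset.range n, util v * (if col v < k + 1 then X (col v) else 1 / 2) =
      ∑ v ∈ Finset.range n, util v * (if col v < k then X (col v) else 1 / 2) +
        (X k - 1 / 2) * ∑ v ∈ Finset.range n, if col v = k then util v else 0 := by
    rw [Finset.mul_sum, ← Finset.sum_add_distrib]
    refine Finset.sum_congr rfl fun v _ => ?_
    rcases lt_trichotomy (col v) k with h | h | h
    · simp [h, h.ne, Nat.lt_succ_of_lt h]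
    · simp [h]; ring
    · simp [h.ne', not_lt.2 h.le, show ¬ col v < k + 1 by omega]
  have h₂ : ∑ p ∈ Finset.range N, cst p * (if col (src p) = col (nbr p) then 0 else
        (if col (src p) < k + 1 then X (col (src p)) else 1 / 2) *
          (if col (nbr p) < k + 1 then X (col (nbr p)) else 1 / 2)) =
      ∑ p ∈ Finset.range N, cst p * (if col (src p) = col (nbr p) then 0 else
        (if col (src p) < k then X (col (src p)) else 1 / 2) *
          (if col (nbr p) < k then X (col (nbr p)) else 1 / 2)) +
      (X k - 1 / 2) * (∑ p ∈ Finset.range N,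
          cst p * (if col (src p) = k then partialSel X k (col (nbr p)) else 0) +
        ∑ p ∈ Finset.range N,
          cst p * (if col (nbr p) = k then partialSel X k (col (src p)) else 0)) := by
    rw [← Finset.sum_add_distrib, Finset.mul_sum, ← Finset.sum_add_distrib]
    refine Finset.sum_congr rfl fun p _ => ?_
    generalize col (src p) = a
    generalize col (nbr p) = b
    unfold partialSel
    rcases lt_trichotomy a k with ha | ha | ha <;> rcases lt_trichotomy b k with hb | hb | hb
    · simp [ha, hb, ha.ne, hb.ne, Nat.lt_succ_of_lt ha, Nat.lt_succ_of_lt hb]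
    · simp [ha, hb, ha.ne, Nat.lt_succ_of_lt ha]; ring
    · simp [ha, hb.ne', ha.ne, not_lt.2 hb.le, show ¬ b < k + 1 by omega, Nat.lt_succ_of_lt ha]
    · simp [ha, hb, hb.ne', hb.ne, Nat.lt_succ_of_lt hb]; ring
    · simp [ha, hb]
    · simp [ha, hb.ne, hb.ne', not_lt.2 hb.le, show ¬ b < k + 1 by omega]; ring
    · simp [hb, ha.ne', hb.ne, not_lt.2 ha.le, show ¬ a < k + 1 by omega, Nat.lt_succ_of_lt hb]
    · simp [hb, ha.ne', not_lt.2 ha.le, show ¬ a < k + 1 by omega]; ring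
    · simp [hb.ne', ha.ne', not_lt.2 ha.le, not_lt.2 hb.le, show ¬ a < k + 1 by omega,
        show ¬ b < k + 1 by omega]
  -- Class `k` occurs on either side of a list entry; by symmetry the two sums agree, which cancels
  -- the factor 1/2.
  have h₃ := hsym fun u v => if col u = k then partialSel X k (col v) else 0
  simp only [objective]
  rw [h₁, h₂, ← h₃]
  simp only [mul_ite, mul_zero]
  ring

/-- Conditional expectations: the greedy rule gives `X k - 1 / 2` the sign of the partial
derivative, so no step decreases the objective. -/
theorem objective_le {n N K M : ℕ} {src nbr col : ℕ → ℕ} {cst util X : ℕ → ℝ} {σ : Mem}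
    (hC : Contracted n N K M src nbr cst util col σ)
    (hX : IsGreedy K (σ.w 25) (σ.w 26) (σ.r 12) (σ.r 13) X)
    (hsrc : ∀ p < N, src p < n) (hnbr : ∀ p < N, nbr p < n)
    (hsym : ∀ h : ℕ → ℕ → ℝ, ∑ p ∈ Finset.range N, cst p * h (src p) (nbr p) =
      ∑ p ∈ Finset.range N, cst p * h (nbr p) (src p)) :
    objective n N src nbr cst util col (fun _ => 1 / 2) ≤
      objective n N src nbr cst util col X := by
  have key : ∀ k ≤ K, objective n N src nbr cst util col (fun _ => 1 / 2) ≤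
      objective n N src nbr cst util col (fun d => if d < k then X d else 1 / 2) := by
    intro k hk
    induction k with
    | zero => simp
    | succ k ih =>
      rw [objective_step hsym]
      refine (ih (by omega)).trans (le_add_of_nonneg_right ?_)
      have h := hX k hk
      rw [hC.util k hk, hC.sum k hk] at h
      rw [h]
      split_ifs with h'
      · exact mul_nonneg (by norm_num) h'
      · exact mul_nonneg_of_nonpos_of_nonpos (by norm_num) (not_le.1 h').le
  refine (key K le_rfl).trans (le_of_eq ?_)
  unfold objective
  congr 1
  · refine Finset.sum_congr rfl fun v hv => ?_
    beta_reduce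
    rw [if_pos (hC.col_lt v (Finset.mem_range.1 hv))]
  · congr 1
    refine Finset.sum_congr rfl fun p hp => ?_
    rw [Finset.mem_range] at hp
    beta_reduce
    rw [if_pos (hC.col_lt _ (hsrc p hp)), if_pos (hC.col_lt _ (hnbr p hp))]

/-! ### The input as adjacency lists -/

theorem sum_range_eq_sum_lists {off : ℕ → ℕ} {n : ℕ} (hoff : ∀ v < n, off v ≤ off (v + 1))
    (hoff0 : off 0 = 0) (f : ℕ → ℝ) :
    ∑ p ∈ Finset.range (off n), f p =
      ∑ v ∈ Finset.range n, ∑ p ∈ Finset.Ico (off v) (off (v + 1)), f p := by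
  induction n with
  | zero => simp [hoff0]
  | succ n ih =>
    rw [Finset.sum_range_succ, ← ih fun v hv => hoff v (by omega),
      Finset.sum_range_add_sum_Ico _ (hoff n (by omega))]

section

variable {n : ℕ} {G : SimpleGraph (Fin n)} [DecidableRel G.Adj] {util : Fin n → ℝ}
  {cost : Sym2 (Fin n) → ℝ} {ε : ℝ} {s : State}

theorem IsInput.mono (h : IsInput G util cost ε s) : ∀ v < n, s.wmem 1 v ≤ s.wmem 1 (v + 1) :=
  fun v hv => by
    rw [h.off_succ ⟨v, hv⟩]
    exact Nat.le_add_right _ _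

theorem IsInput.off_last (h : IsInput G util cost ε s) :
    s.wmem 1 n = 2 * G.edgeFinset.card := by
  rw [← G.sum_degrees_eq_twice_card_edges]
  have : ∀ k (hk : k ≤ n), s.wmem 1 k = ∑ v ∈ Finset.range k,
      if h : v < n then G.degree ⟨v, h⟩ else 0 := by
    intro k hk
    induction k with
    | zero => simp [h.off_zero]
    | succ k ih =>
      rw [Finset.sum_range_succ, ← ih (by omega), dif_pos (by omega)]
      exact h.off_succ ⟨k, by omega⟩
  rw [this n le_rfl, Finset.sum_range]
  simp

/-- The list of `v` enumerates the neighbours bijectively, so a sum over its positions is a sum over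
the neighbourhood. -/
theorem IsInput.sum_list (h : IsInput G util cost ε s) (v : Fin n) (f : ℕ → ℝ) :
    ∑ p ∈ Finset.Ico (s.wmem 1 v) (s.wmem 1 (v + 1)), s.rmem 1 p * f (s.wmem 2 p) =
      ∑ u ∈ G.neighborFinset v, cost s(v, u) * f u := by
  classical
  rw [Finset.sum_Ico_eq_sum_range, h.off_succ v, Nat.add_sub_cancel_left]
  have : Nonempty (Fin n) := ⟨v⟩
  choose! φ hφ using h.entry v
  have himg : (Finset.range (G.degree v)).image φ = G.neighborFinset v := by
    ext u
    simp only [Finset.mem_image, Finset.mem_range, SimpleGraph.mem_neighborFinset]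
    constructor
    · rintro ⟨j, hj, rfl⟩
      exact (hφ j hj).1
    · intro hu
      obtain ⟨j, hj, hj'⟩ := h.listed v u hu
      refine ⟨j, hj, Fin.ext ?_⟩
      rw [← (hφ j hj).2.1, hj']
  -- The input format does not state that list entries are distinct; this follows by counting, since
  -- `deg v` positions cover `deg v` neighbours.
  have hinj : Set.InjOn φ (Finset.range (G.degree v)) := by
    rw [← Finset.card_image_iff, himg, G.card_neighborFinset_eq_degree, Finset.card_range]
  rw [← himg, Finset.sum_image hinj]
  refine Finset.sum_congr rfl fun j hj => ?_
  rw [Finset.mem_range] at hj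
  rw [(hφ j hj).2.1, (hφ j hj).2.2]

theorem IsInput.sum_positions (h : IsInput G util cost ε s) {src : ℕ → ℕ}
    (hsrc : ∀ p < s.wmem 1 n, Owns n (s.wmem 1) (src p) p) (f : ℕ → ℕ → ℝ) :
    ∑ p ∈ Finset.range (s.wmem 1 n), s.rmem 1 p * f (src p) (s.wmem 2 p) =
      ∑ v, ∑ u ∈ G.neighborFinset v, cost s(v, u) * f v u := by
  rw [sum_range_eq_sum_lists h.mono h.off_zero, Finset.sum_range]
  refine Finset.sum_congr rfl fun v _ => ?_
  rw [← h.sum_list v]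
  refine Finset.sum_congr rfl fun p hp => ?_
  rw [Finset.mem_Ico] at hp
  have hlt : p < s.wmem 1 n := hp.2.trans_le (le_of_step h.mono v.2 le_rfl)
  rw [(hsrc p hlt).unique h.mono ⟨v.2, hp⟩]

theorem sum_neighbors_comm (f : Fin n → Fin n → ℝ) :
    ∑ v, ∑ u ∈ G.neighborFinset v, f v u = ∑ v, ∑ u ∈ G.neighborFinset v, f u v := by
  refine Finset.sum_comm' fun v u => ?_
  simp [G.adj_comm]

/-- Ordered adjacent pairs are darts, and every edge carries exactly two of them. -/
theorem sum_neighbors_sym2 (F : Sym2 (Fin n) → ℝ) :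
    ∑ v, ∑ u ∈ G.neighborFinset v, F s(v, u) = 2 * ∑ e ∈ G.edgeFinset, F e := by
  classical
  have h₁ : ∑ v, ∑ u ∈ G.neighborFinset v, F s(v, u) = ∑ d : G.Dart, F d.edge := by
    rw [← Finset.sum_fiberwise (s := Finset.univ) (g := fun d : G.Dart => d.fst)]
    refine Finset.sum_congr rfl fun v _ => ?_
    refine Finset.sum_bij' (fun u hu => ⟨(v, u), by simpa using hu⟩) (fun d _ => d.snd) ?_ ?_ ?_ ?_ ?_
    · intro u hu
      simp
    · rintro ⟨⟨a, b⟩, hd⟩ hd'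
      obtain rfl : a = v := by simpa using hd'
      simpa using hd
    · intro u hu
      rfl
    · rintro ⟨⟨a, b⟩, hd⟩ hd'
      obtain rfl : a = v := by simpa using hd'
      rfl
    · intro u hu
      rfl
  rw [h₁, ← Finset.sum_fiberwise_of_maps_to (s := Finset.univ) (t := G.edgeFinset)
    (g := fun d : G.Dart => d.edge) (fun d _ => by simp), Finset.mul_sum]
  refine Finset.sum_congr rfl fun e he => ?_
  rw [Finset.sum_congr rfl fun d hd => by rw [(Finset.mem_filter.1 hd).2], Finset.sum_const,
    G.dart_edge_fiber_card e (by simpa using he), nsmul_eq_mul]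
  norm_num

theorem IsInput.nbr_lt (h : IsInput G util cost ε s) :
    ∀ p < s.wmem 1 n, ∃ v u : Fin n, Owns n (s.wmem 1) v p ∧ G.Adj v u ∧ s.wmem 2 p = u ∧
      s.rmem 1 p = cost s(v, u) := by
  intro p hp
  obtain ⟨v, hv, hv₁, hv₂⟩ := exists_owns h.off_zero hp
  have h₁ := h.off_succ ⟨v, hv⟩
  obtain ⟨u, hu, hu₁, hu₂⟩ := h.entry ⟨v, hv⟩ (p - s.wmem 1 v) (by simp only at h₁; omega)
  simp only [Nat.add_sub_cancel' hv₁] at hu₁ hu₂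
  exact ⟨⟨v, hv⟩, u, ⟨hv, hv₁, hv₂⟩, hu, hu₁, hu₂⟩

/-- The rounding guarantee. -/
theorem IsInput.rounding (h : IsInput G util cost ε s) (hcost : ∀ e ∈ G.edgeFinset, 0 ≤ cost e)
    {K M : ℕ} {src col : ℕ → ℕ} {X : ℕ → ℝ} {σ : Mem}
    (hsrc : ∀ p < s.wmem 1 n, Owns n (s.wmem 1) (src p) p)
    (hC : Contracted n (s.wmem 1 n) K M src (s.wmem 2) (s.rmem 1) (s.rmem 0) col σ)
    (hX : IsGreedy K (σ.w 25) (σ.w 26) (σ.r 12) (σ.r 13) X)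
    (hmono : monoCost (s.wmem 1 n) src (s.wmem 2) (s.rmem 1) col ≤
      ε * ∑ p ∈ Finset.range (s.wmem 1 n), s.rmem 1 p)
    (out : Finset (Fin n)) (hout : ∀ v : Fin n, v ∈ out ↔ 1 ≤ X (col v)) :
    (∑ v ∈ Finset.univ, (1 / 2 : ℝ) * util v - ∑ e ∈ G.edgeFinset, (1 / 4 : ℝ) * cost e)
        - ε * ∑ e ∈ G.edgeFinset, cost e ≤
      ∑ v ∈ out, util v - ∑ e ∈ G.edgeFinset with ∀ v ∈ e, v ∈ out, cost e := by
  classical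
  set N := s.wmem 1 n with hN
  have hcst : ∀ p < N, 0 ≤ s.rmem 1 p := by
    intro p hp
    obtain ⟨v, u, -, hvu, -, hc⟩ := h.nbr_lt p hp
    rw [hc]
    exact hcost _ (by simpa using hvu)
  have hnbr : ∀ p < N, s.wmem 2 p < n := by
    intro p hp
    obtain ⟨v, u, -, -, hu, -⟩ := h.nbr_lt p hp
    rw [hu]
    exact u.2
  have hsum := h.sum_positions hsrc
  have hobj := objective_le hC hX (fun p hp => (hsrc p hp).1) hnbr fun f => by
    rw [hsum f, hsum fun a b => f b a]
    rw [sum_neighbors_comm]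
    simp only [Sym2.eq_swap]
  have hX01 : ∀ v : Fin n, X (col v) = if v ∈ out then 1 else 0 := by
    intro v
    have := hX (col v) (hC.col_lt v v.2)
    by_cases hv : v ∈ out
    · rw [if_pos hv]
      have h₁ := (hout v).1 hv
      split_ifs at this
      · exact this
      · linarith
    · rw [if_neg hv]
      have h₁ := fun h => hv ((hout v).2 h)
      split_ifs at this
      · exact absurd this.ge h₁
      · exact this
  have hT : ∑ p ∈ Finset.range N, s.rmem 1 p = 2 * ∑ e ∈ G.edgeFinset, cost e := by
    have := hsum fun _ _ => 1
    simp only [mul_one] at this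
    rw [this, sum_neighbors_sym2]
  have hO : ∑ p ∈ Finset.range N, s.rmem 1 p * (X (col (src p)) * X (col (s.wmem 2 p))) =
      2 * ∑ e ∈ G.edgeFinset with ∀ v ∈ e, v ∈ out, cost e := by
    rw [hsum fun a b => X (col a) * X (col b), Finset.sum_filter, ← sum_neighbors_sym2]
    refine Finset.sum_congr rfl fun v _ => Finset.sum_congr rfl fun u _ => ?_
    rw [hX01, hX01]
    by_cases hv : v ∈ out <;> by_cases hu : u ∈ out <;> simp [hv, hu]
  have hU : ∑ v ∈ Finset.range n, s.rmem 0 v * X (col v) = ∑ v ∈ out, util v := by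
    rw [Finset.sum_range]
    simp only [h.utility, hX01, mul_ite, mul_one, mul_zero]
    rw [← Finset.sum_filter]
    simp
  have hU' : ∑ v ∈ Finset.range n, s.rmem 0 v * (1 / 2) =
      ∑ v ∈ Finset.univ, (1 / 2 : ℝ) * util v := by
    rw [Finset.sum_range]
    simp only [h.utility, mul_comm]
  -- The true cost of the output exceeds the cost in the contracted objective only by selected
  -- monochromatic edges.
  have h₁ : ∑ p ∈ Finset.range N, s.rmem 1 p * (X (col (src p)) * X (col (s.wmem 2 p))) ≤
      ∑ p ∈ Finset.range N, s.rmem 1 p * (if col (src p) = col (s.wmem 2 p) then 0 else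
        X (col (src p)) * X (col (s.wmem 2 p))) +
        monoCost N src (s.wmem 2) (s.rmem 1) col := by
    rw [monoCost, ← Finset.sum_add_distrib]
    refine Finset.sum_le_sum fun p hp => ?_
    rw [Finset.mem_range] at hp
    by_cases hc : col (src p) = col (s.wmem 2 p)
    · rw [if_pos hc, if_pos hc, hc, mul_zero, zero_add]
      have := hX01 ⟨s.wmem 2 p, hnbr p hp⟩
      simp only at this
      rw [this]
      have := hcst p hp
      split_ifs <;> simp [this]
    · simp [hc]
  -- At the starting point, dropping the monochromatic edges can only increase the objective,
  -- because costs are nonnegative.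
  have h₂ : ∑ p ∈ Finset.range N, s.rmem 1 p * (if col (src p) = col (s.wmem 2 p) then 0 else
        (1 / 2 : ℝ) * (1 / 2)) ≤ ∑ p ∈ Finset.range N, s.rmem 1 p * (1 / 4) := by
    refine Finset.sum_le_sum fun p hp => mul_le_mul_of_nonneg_left ?_
      (hcst p (Finset.mem_range.1 hp))
    split_ifs <;> norm_num
  rw [← Finset.sum_mul, hT] at h₂
  rw [hT] at hmono
  rw [hO] at h₁
  simp only [objective] at hobj
  rw [hU, hU'] at hobj
  rw [← Finset.mul_sum (a := (1 / 4 : ℝ))]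
  linarith

end

/-! ### The algorithm -/

/-- Contract the graph if few colours suffice, otherwise copy it. -/
noncomputable def prepare : Cmd :=
  .cond ((reg 12 * reg 12 * (reg 12 * reg 12)).lt (reg 0))
    (.seq fillSrc <| .seq towers <| .seq colorNodes contract) copyGraph

/-- The rounding algorithm. -/
noncomputable def rounding : Cmd :=
  .seq setup <|
  .seq prepare <|
  .seq greedy <|
  wpar (reg 0) 3 (.rle (.ofWord 1) (.rload 14 (.wload 21 .pid)))

section

variable {w : ℕ} {A : Arbiter} {σ : Mem}

/-- Two regimes. If `S ^ 4 < n`, growth of `S` stopped because `E ≤ S * ε`; colouring then loses at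
most an `ε` fraction, and the contracted matrix has `4 * S ^ 4` cells, which is below `4 * n` and
polynomial in `B`. Otherwise `n ≤ S ^ 4 ≤ B ^ 4`, hence `N < n ^ 2 ≤ B ^ 8`, and the original graph
is small enough. -/
theorem runs_prepare {n N B E S Jm : ℕ} {ε : ℝ} (hw : 1 < w) (hn : 0 < n)
    (hw' : 100 * (n + 1) ^ 5 ≤ 2 ^ w) (hNn : N < n ^ 2)
    (h0 : σ.w 0 0 = n) (h10 : σ.w 10 0 = N) (h11 : σ.w 11 0 = E) (h12 : σ.w 12 0 = S)
    (hE0 : 0 < E) (hE : n ≤ 2 ^ E) (hE' : E ≤ Nat.clog 2 n + 1) (hES : E ≤ S) (hSB : S ≤ B)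
    (hSn : S ≤ n + 1) (hS : n ≤ S ^ 4 ∨ (E : ℝ) ≤ S * ε)
    (hJm : ∀ J, J = 0 ∨ 2 ^ 2 ^ (J - 1) < n → J ≤ Jm)
    (hclog : Nat.clog 2 n ≤ B) (hclog' : Nat.clog 2 (N + 1) ≤ 2 * B) (hε : 0 ≤ ε)
    (hoff : ∀ v < n, σ.w 1 v ≤ σ.w 1 (v + 1)) (hoff0 : σ.w 1 0 = 0) (hoffn : σ.w 1 n = N)
    (hnbr : ∀ p < N, σ.w 2 p < n)
    (hne : ∀ p < N, ∀ v, Owns n (σ.w 1) v p → v ≠ σ.w 2 p) (hcst : ∀ p < N, 0 ≤ σ.r 1 p) :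
    Runs w A prepare σ (200000 * ((Jm + 1) * (N + n))) (300000 * B ^ 8) fun σ' =>
      ∃ (K M : ℕ) (src : ℕ → ℕ), M ≤ N + 4 * n ∧ K ≤ 4 * n ∧ M + K ≤ 8 * B ^ 8 ∧
        (∀ p < N, Owns n (σ.w 1) (src p) p) ∧
        Contracted n N K M src (σ.w 2) (σ.r 1) (σ.r 0) (σ'.w 21) σ' ∧
        monoCost N src (σ.w 2) (σ.r 1) (σ'.w 21) ≤ ε * ∑ p ∈ Finset.range N, σ.r 1 p := by
  have hB : 1 ≤ B := by omega
  have hP1 : B ≤ B ^ 8 := Nat.le_self_pow (by norm_num) B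
  have hP2 : B * B ≤ B ^ 8 := by
    rw [← pow_two]
    exact Nat.pow_le_pow_right hB (by norm_num)
  have hP4 : B ^ 4 ≤ B ^ 8 := Nat.pow_le_pow_right hB (by norm_num)
  have hSP : S ^ 4 ≤ B ^ 4 := Nat.pow_le_pow_left hSB 4
  have hQ5 : (n + 1) ^ 4 ≤ (n + 1) ^ 5 := Nat.pow_le_pow_right (by omega) (by norm_num)
  have hQ2 : (n + 1) ^ 2 ≤ (n + 1) ^ 4 := Nat.pow_le_pow_right (by omega) (by norm_num)
  have hQ1 : n ^ 2 + 2 * n + 1 = (n + 1) ^ 2 := by ring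
  have hcl := clog_two_le_self n
  have hS4 : S * S * (S * S) = S ^ 4 := by ring
  have hSS : S * S ≤ S ^ 4 := hS4 ▸ Nat.le_mul_self _
  have hS4n : S ^ 4 ≤ (n + 1) ^ 4 := Nat.pow_le_pow_left hSn 4
  have hcond : evw w σ 0 ((reg 12 * reg 12 * (reg 12 * reg 12)).lt (reg 0)) =
      if S ^ 4 < n then 1 else 0 := by
    simp (disch := omega) only [evw_lt, evw_mul, evw_reg, h12, h0, Nat.mod_eq_of_lt]
    rw [hS4]
  have hJm1 : N + n ≤ (Jm + 1) * (N + n) := Nat.le_mul_of_pos_left _ (by omega)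
  refine (Runs.cond (W := 150000 * ((Jm + 1) * (N + n))) (D := 280000 * B ^ 8) (fun hc => ?_)
    (fun hc => ?_)).conseq ?_ ?_ fun _ h _ => h
  · have hlt : S ^ 4 < n := by
      by_contra h
      exact hc (hcond.trans (if_neg h))
    have hS' : (E : ℝ) ≤ S * ε := hS.resolve_left (by omega)
    have hSn : S < n := (Nat.le_self_pow (by norm_num) S).trans_lt hlt
    refine ((runs_fillSrc (N := N) (n := n) (E := E) (S := S) hw hn (by omega) hES hE (by omega) h0
      h10 h11 h12 hoff hoff0 hoffn).seq fun σ₁ h₁ hf₁ =>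
      (runs_towers (n := n) (E := E) hw (by omega) hE (by omega) hE0
        (by rw [hf₁.w 0 rfl, h0])).seq fun σ₂ h₂ hf₂ =>
      Runs.seq (W := 6000 * ((Jm + 1) * (N + n))) (D := 18000 * B ^ 8) (Q := fun σ' =>
        (∀ v < n, σ'.w 21 v < S * S * 2) ∧
        S * monoCost N (σ₁.w 20) (σ.w 2) (σ.r 1) (σ'.w 21) ≤
          (σ₂.w 14 0) * ∑ p ∈ Finset.range N, σ.r 1 p) ?_ fun σ₃ h₃ hf₃ =>
      (runs_contract (n := n) (N := N) (S := S) (K := S * S * 2) hw (by omega) rfl ?_ (by omega)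
        ?_ ?_ ?_ ?_ ?_ ?_).conseq le_rfl le_rfl fun σ₄ h₄ hf₄ => ?_).conseq ?_ ?_ fun _ h _ => h
    · obtain ⟨g₁, g₂, g₃, g₄⟩ := h₂
      have hJ := hJm _ g₄
      have := runs_colorNodes (A := A) (σ := σ₂) (n := n) (N := N) (S := S) (J := σ₂.w 14 0) hw
        (by omega) (by omega) hlt (by omega) (by rw [hf₂.w 0 rfl, hf₁.w 0 rfl, h0])
        (by rw [hf₂.w 10 rfl, hf₁.w 10 rfl, h10]) (by rw [hf₂.w 12 rfl, hf₁.w 12 rfl, h12]) rfl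
        g₂ g₃ g₄ (by rw [hf₂.w 20 rfl]; exact fun p hp => (h₁ p hp).1)
        (by rw [hf₂.w 2 rfl, hf₁.w 2 rfl]; exact hnbr)
        (by rw [hf₂.w 20 rfl, hf₂.w 2 rfl, hf₁.w 2 rfl]; exact fun p hp => hne p hp _ (h₁ p hp))
        (by rw [hf₂.r 1 rfl, hf₁.r 1 rfl]; exact hcst)
      rw [hf₂.w 20 rfl, hf₂.w 2 rfl, hf₁.w 2 rfl, hf₂.r 1 rfl, hf₁.r 1 rfl] at this
      refine this.conseq ?_ ?_ fun _ h _ => h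
      · have : (σ₂.w 14 0 + 1) * (N + n + S) ≤ (Jm + 1) * (2 * (N + n)) :=
          Nat.mul_le_mul (by omega) (by omega)
        rw [Nat.mul_left_comm] at this
        omega
      · have : (σ₂.w 14 0 + 1) * (S + Nat.clog 2 (N + 1)) ≤ (2 * B) * (3 * B) :=
          Nat.mul_le_mul (by omega) (by omega)
        have h6 : (2 * B) * (3 * B) = 6 * (B * B) := by ring
        omega
    · calc S * S * 2 * (S * S * 2) = 4 * S ^ 4 := by ring
        _ ≤ 4 * n := by omega
    · rw [hf₃.w 0 rfl, hf₂.w 0 rfl, hf₁.w 0 rfl, h0]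
    · rw [hf₃.w 10 rfl, hf₂.w 10 rfl, hf₁.w 10 rfl, h10]
    · rw [hf₃.w 12 rfl, hf₂.w 12 rfl, hf₁.w 12 rfl, h12]
    · rw [hf₃.w 20 rfl, hf₂.w 20 rfl]
      exact fun p hp => (h₁ p hp).1
    · rw [hf₃.w 2 rfl, hf₂.w 2 rfl, hf₁.w 2 rfl]
      exact hnbr
    · exact h₃.1
    · rw [hf₃.w 20 rfl, hf₂.w 20 rfl, hf₃.w 2 rfl, hf₂.w 2 rfl, hf₁.w 2 rfl, hf₃.r 1 rfl,
        hf₂.r 1 rfl, hf₁.r 1 rfl, hf₃.r 0 rfl, hf₂.r 0 rfl, hf₁.r 0 rfl, ← hf₄.w 21 rfl] at h₄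
      have hKK : S * S * 2 * (S * S * 2) = 4 * S ^ 4 := by ring
      refine ⟨S * S * 2, _, σ₁.w 20, ?_, by omega, by omega, h₁, h₄, ?_⟩
      · omega
      · have hT : 0 ≤ ∑ p ∈ Finset.range N, σ.r 1 p :=
          Finset.sum_nonneg fun p hp => hcst p (Finset.mem_range.1 hp)
        have hS0 : (0 : ℝ) < S := by exact_mod_cast (by omega : 0 < S)
        rw [hf₄.w 21 rfl]
        -- After multiplication by `S`, what remains is `J ≤ E ≤ S * ε`.
        refine le_of_mul_le_mul_left (h₃.2.trans ?_) hS0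
        rw [← mul_assoc]
        refine mul_le_mul_of_nonneg_right (le_trans ?_ hS') hT
        exact_mod_cast h₂.1
    · omega
    · have hKK : S * S * 2 * (S * S * 2) = 4 * S ^ 4 := by ring
      rw [hKK]
      omega
  · have hle : n ≤ S ^ 4 := by
      by_contra h
      rw [hcond, if_pos (not_le.1 h)] at hc
      exact one_ne_zero hc
    have hex : ∀ p, ∃ v, p < N → Owns n (σ.w 1) v p := by
      intro p
      by_cases hp : p < N
      · obtain ⟨v, hv⟩ := exists_owns (n := n) hoff0 (hoffn.symm ▸ hp)
        exact ⟨v, fun _ => hv⟩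
      · exact ⟨0, fun h => absurd h hp⟩
    choose src hsrc using hex
    refine (runs_copyGraph hw (by omega) h0 h10 hoff hoffn hnbr src hsrc).conseq (by omega)
      (by omega) fun σ' h _ => ⟨n, N, src, by omega, by omega, ?_, hsrc, h.2, ?_⟩
    · have : n ^ 2 ≤ B ^ 8 :=
        (Nat.pow_le_pow_left (by omega : n ≤ B ^ 4) 2).trans_eq (by rw [← pow_mul])
      omega
    · have h0 : monoCost N src (σ.w 2) (σ.r 1) (σ'.w 21) = 0 := by
        refine Finset.sum_eq_zero fun p hp => ?_
        rw [Finset.mem_range] at hp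
        rw [h.1 _ (hsrc p hp).1, h.1 _ (hnbr p hp), if_neg (hne p hp _ (hsrc p hp))]
      rw [h0]
      exact mul_nonneg hε (Finset.sum_nonneg fun p hp => hcst p (Finset.mem_range.1 hp))
  · rw [show ((reg 12 * reg 12 * (reg 12 * reg 12)).lt (reg 0)).size = 14 from rfl]
    omega
  · rw [show ((reg 12 * reg 12 * (reg 12 * reg 12)).lt (reg 0)).size = 14 from rfl]
    omega

end

theorem exec_rounding {n : ℕ} (hn : 0 < n) {G : SimpleGraph (Fin n)} [DecidableRel G.Adj]
    {util : Fin n → ℝ} {cost : Sym2 (Fin n) → ℝ} (hcost : ∀ e ∈ G.edgeFinset, 0 ≤ cost e)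
    {ε : ℝ} (hε : 0 < ε) (A : Arbiter) {s : State} (h : IsInput G util cost ε s) {w B Jm : ℕ}
    (hw' : 100 * (n + 1) ^ 5 ≤ 2 ^ w)
    (hJm : ∀ J, J = 0 ∨ 2 ^ 2 ^ (J - 1) < n → J ≤ Jm)
    (hB : Nat.clog 2 n + 1 ≤ B) (hB' : (Nat.clog 2 n + 1 : ℝ) ≤ B * ε) :
    ∃ s' : State, Exec w A rounding s s' ∧
      s'.work ≤ 300000 * ((Jm + 1) * (2 * G.edgeFinset.card + n)) ∧ s'.depth ≤ 400000 * B ^ 8 ∧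
      (∑ v ∈ Finset.univ, (1 / 2 : ℝ) * util v - ∑ e ∈ G.edgeFinset, (1 / 4 : ℝ) * cost e)
          - ε * ∑ e ∈ G.edgeFinset, cost e ≤
        ∑ v ∈ s'.output n, util v
          - ∑ e ∈ G.edgeFinset with ∀ v ∈ e, v ∈ s'.output n, cost e := by
  have hN := h.off_last
  set N := s.wmem 1 n with hNdef
  -- Simplicity of the graph bounds the number of list positions, so positions fit into words and
  -- `log N` is at most about `2 * log n`.
  have hNn : N < n ^ 2 := by
    have h₁ : ∀ v : Fin n, G.degree v ≤ n - 1 := fun v => by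
      have := G.degree_lt_card_verts v
      rw [Fintype.card_fin] at this
      omega
    have h₂ : ∑ v, G.degree v ≤ n * (n - 1) := by
      simpa using Finset.sum_le_card_nsmul Finset.univ _ _ fun v _ => h₁ v
    rw [G.sum_degrees_eq_twice_card_edges] at h₂
    have : n * (n - 1) < n * n := Nat.mul_lt_mul_of_pos_left (by omega) hn
    rw [pow_two]
    omega
  have hQ : ∀ k ≤ 5, (n + 1) ^ k ≤ (n + 1) ^ 5 := fun k hk =>
    Nat.pow_le_pow_right (by omega) hk
  have hQ4 := hQ 4 (by norm_num)
  have hQ2 := hQ 2 (by norm_num)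
  have hQ1 : n ^ 2 + 2 * n + 1 = (n + 1) ^ 2 := by ring
  have hw : 1 < w := by
    by_contra hcon
    have : 2 ^ w ≤ 2 ^ 1 := Nat.pow_le_pow_right two_pos (by omega)
    omega
  have hclog : Nat.clog 2 (N + 1) ≤ 2 * B := by
    refine Nat.clog_le_of_le_pow ?_
    have h₁ : n ≤ 2 ^ B :=
      (Nat.le_pow_clog Nat.one_lt_two n).trans (Nat.pow_le_pow_right two_pos (by omega))
    calc N + 1 ≤ n ^ 2 := hNn
      _ ≤ (2 ^ B) ^ 2 := Nat.pow_le_pow_left h₁ 2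
      _ = 2 ^ (2 * B) := by rw [← pow_mul, Nat.mul_comm]
  have hpos : 1 ≤ B ^ 8 := Nat.one_le_pow _ _ (by omega)
  have hBP : B ≤ B ^ 8 := Nat.le_self_pow (by norm_num) B
  have hJ1 : N + n ≤ (Jm + 1) * (N + n) := Nat.le_mul_of_pos_left _ (by omega)
  set σ : Mem := ⟨s.wmem, s.rmem⟩ with hσ
  have hcst : ∀ p < N, 0 ≤ s.rmem 1 p := by
    intro p hp
    obtain ⟨v, u, -, hvu, -, hc⟩ := h.nbr_lt p hp
    rw [hc]
    exact hcost _ (by simpa using hvu)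
  have hnbr : ∀ p < N, s.wmem 2 p < n := by
    intro p hp
    obtain ⟨v, u, -, -, hu, -⟩ := h.nbr_lt p hp
    rw [hu]
    exact u.2
  have hne : ∀ p < N, ∀ v, Owns n (s.wmem 1) v p → v ≠ s.wmem 2 p := by
    rintro p hp v hv rfl
    obtain ⟨v', u, hv', hadj, hu, -⟩ := h.nbr_lt p hp
    have := hv.unique h.mono hv'
    rw [hu] at this
    exact hadj.ne (Fin.ext this.symm)
  have hrun : Runs w A rounding σ (300000 * ((Jm + 1) * (N + n))) (400000 * B ^ 8) fun σ' =>
      ∃ (K M : ℕ) (src col : ℕ → ℕ) (X : ℕ → ℝ) (τ : Mem),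
        (∀ p < N, Owns n (s.wmem 1) (src p) p) ∧
        Contracted n N K M src (s.wmem 2) (s.rmem 1) (s.rmem 0) col τ ∧
        IsGreedy K (τ.w 25) (τ.w 26) (τ.r 12) (τ.r 13) X ∧
        monoCost N src (s.wmem 2) (s.rmem 1) col ≤ ε * ∑ p ∈ Finset.range N, s.rmem 1 p ∧
        ∀ v < n, σ'.w 3 v ≠ 0 ↔ 1 ≤ X (col v) := by
    refine ((runs_setup (n := n) (N := N) (B := B) hw hn (by omega) (by omega) h.nodes rfl hB
      (by rw [show σ.r 2 0 = ε from h.eps]; exact hB')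
      (by rw [show σ.r 2 0 = ε from h.eps]; exact hε)).seq fun σ₁ h₁ hf₁ => ?_).conseq
      (by omega : 1000 * (n + 1) + 290000 * ((Jm + 1) * (N + n)) ≤ _)
      (by omega : 1000 * (B + 1) + 390000 * B ^ 8 ≤ _) fun _ h _ => h
    obtain ⟨h10, hE0, hE, hE', hES, hSB, hSn, hS⟩ := h₁
    have hprep := runs_prepare (A := A) (σ := σ₁) (ε := ε) hw hn hw' hNn
      (by rw [hf₁.w 0 rfl]; exact h.nodes) h10 rfl rfl hE0 hE hE' hES hSB hSn
      (by rwa [show σ.r 2 0 = ε from h.eps] at hS) hJm (by omega) hclog hε.le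
      (by rw [hf₁.w 1 rfl]; exact h.mono) (by rw [hf₁.w 1 rfl]; exact h.off_zero)
      (by rw [hf₁.w 1 rfl]) (by rw [hf₁.w 2 rfl]; exact hnbr)
      (by rw [hf₁.w 2 rfl, hf₁.w 1 rfl]; exact hne) (by rw [hf₁.r 1 rfl]; exact hcst)
    rw [hf₁.w 1 rfl, hf₁.w 2 rfl, hf₁.r 1 rfl, hf₁.r 0 rfl] at hprep
    refine (hprep.seq (W' := 80000 * ((Jm + 1) * (N + n))) (D' := 80000 * B ^ 8)
      fun σ₂ h₂ hf₂ => ?_).conseq (by omega) (by omega) fun _ h _ => h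
    obtain ⟨K, M, src, hM, hK, hMK, hsrc, hC, hmono⟩ := h₂
    refine ((runs_greedy (A := A) (σ := σ₂) (K := K) (N := M) hw (by omega) (by omega) hC.nodes
      hC.mono hC.last hC.nbr_lt).seq fun σ₃ h₃ hf₃ => ?_).conseq
      (by omega : 1000 * (M + K + 1) + 40 * (n + 1) ≤ _) (by omega : 1000 * (M + K + 1) + 40 ≤ _)
      fun _ h _ => h
    classical
    refine Runs.wpar n (fun v => if 1 ≤ σ₃.r 14 (σ₂.w 21 v) then 1 else 0) (by omega) ?_ ?_ ?_ _
      (Nat.le_of_ble_eq_true rfl)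
    · rw [evw_reg, hf₃.w 0 rfl, hf₂.w 0 rfl, hf₁.w 0 rfl, show σ.w 0 0 = n from h.nodes,
        Nat.mod_eq_of_lt (by omega)]
    · intro v hv
      have := hC.col_lt v hv
      rw [evw_rle, evr_ofWord, evr_load, evw_load, evw_pid, evw_one _ _ _ (by omega), hf₃.w 21 rfl,
        Nat.mod_eq_of_lt (by omega), Nat.cast_one]
    · intro f hf
      refine ⟨K, M, src, σ₂.w 21, σ₃.r 14, σ₂, hsrc, hC, h₃, hmono, fun v hv => ?_⟩
      rw [Mem.setW_w, if_pos rfl, hf v hv]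
      simp
  obtain ⟨σ', W, D, he, hW, hD, K, M, src, col, X, τ, hsrc, hC, hX, hmono, hout⟩ := hrun 0 0
  have hs : s = σ.st 0 0 := by
    obtain ⟨_, _, _, _⟩ := s
    simp only [Mem.st, hσ]
    congr 1
    · exact h.work_zero
    · exact h.depth_zero
  refine ⟨σ'.st W D, hs ▸ he, ?_, ?_, ?_⟩
  · change W ≤ _
    rw [← hN]
    omega
  · change D ≤ _
    omega
  · refine h.rounding hcost hsrc hC hX hmono _ fun v => ?_
    rw [← hout v v.2]
    exact Finset.mem_filter.trans (and_iff_right (Finset.mem_univ v))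

/-! ### Estimates -/

theorem levels_le {n : ℕ} {J : ℕ} (h : J = 0 ∨ 2 ^ 2 ^ (J - 1) < n) :
    J ≤ Nat.clog 2 (Nat.clog 2 n) := by
  rcases h with rfl | h
  · exact Nat.zero_le _
  · rcases Nat.eq_zero_or_pos J with rfl | hJ
    · exact Nat.zero_le _
    · by_contra hcon
      have h₁ : Nat.clog 2 n ≤ 2 ^ (J - 1) := (Nat.le_pow_clog Nat.one_lt_two _).trans
        (Nat.pow_le_pow_right two_pos (by omega))
      have h₂ : n ≤ 2 ^ 2 ^ (J - 1) := (Nat.le_pow_clog Nat.one_lt_two _).trans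
        (Nat.pow_le_pow_right two_pos h₁)
      omega

theorem pow_lt_of_lt_clog {k m : ℕ} (h : k < Nat.clog 2 m) : 2 ^ k < m := by
  by_contra hcon
  have := Nat.clog_le_of_le_pow (not_lt.1 hcon)
  omega

/-- The constant absorbs both the rounding up and the change from base 2 to natural logarithms. -/
theorem clog_clog_le (n : ℕ) :
    (Nat.clog 2 (Nat.clog 2 n) : ℝ) ≤ 4 * max 1 (Real.log (Real.log n)) := by
  have hm₁ := le_max_left 1 (Real.log (Real.log n))
  have hm₂ := le_max_right 1 (Real.log (Real.log n))
  set k := Nat.clog 2 (Nat.clog 2 n) with hk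
  rcases Nat.lt_or_ge k 2 with h | h
  · have : (k : ℝ) ≤ 1 := by exact_mod_cast (by omega : k ≤ 1)
    linarith
  have h₁ : 2 ^ 2 ^ (k - 1) < n := pow_lt_of_lt_clog (pow_lt_of_lt_clog (by omega))
  have hl2 : 0.69 < Real.log 2 := by linarith [Real.log_two_gt_d9]
  have h₂ : (2 : ℝ) ^ (k - 1) * Real.log 2 < Real.log n := by
    have h₃ : ((2 : ℝ) ^ 2 ^ (k - 1)) < n := by exact_mod_cast h₁
    have h₄ := Real.log_lt_log (by positivity) h₃
    rw [Real.log_pow] at h₄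
    exact_mod_cast h₄
  have h₃ := Real.log_lt_log (by positivity) h₂
  rw [Real.log_mul (by positivity) (by positivity), Real.log_pow] at h₃
  -- `log (log 2)` is negative; this bounds it below by `1 - 1 / log 2 ≥ -1/2`.
  have h₄ := Real.one_sub_inv_le_log_of_pos (show 0 < Real.log 2 by linarith)
  have h₅ : (Real.log 2)⁻¹ ≤ 1.5 := by
    rw [inv_le_comm₀ (by linarith) (by norm_num)]
    linarith
  have h₆ : (1 : ℝ) ≤ ((k - 1 : ℕ) : ℝ) := by exact_mod_cast (by omega : 1 ≤ k - 1)
  have h₇ : (k : ℝ) = ((k - 1 : ℕ) : ℝ) + 1 := by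
    rw [← Nat.cast_add_one]
    congr 1
    omega
  rw [h₇]
  nlinarith

theorem clog_add_one_le (n : ℕ) :
    (Nat.clog 2 n : ℝ) + 1 ≤ 4 * max 1 (Real.log n) := by
  have hm₁ := le_max_left 1 (Real.log n)
  have hm₂ := le_max_right 1 (Real.log n)
  rcases Nat.eq_zero_or_pos (Nat.clog 2 n) with h | h
  · rw [h, Nat.cast_zero]
    linarith
  have h₁ : 2 ^ (Nat.clog 2 n - 1) < n := pow_lt_of_lt_clog (by omega)
  have hl2 : 0.69 < Real.log 2 := by linarith [Real.log_two_gt_d9]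
  have h₃ : ((2 : ℝ) ^ (Nat.clog 2 n - 1)) < n := by exact_mod_cast h₁
  have h₄ := Real.log_lt_log (by positivity) h₃
  rw [Real.log_pow] at h₄
  have h₇ : (Nat.clog 2 n : ℝ) = ((Nat.clog 2 n - 1 : ℕ) : ℝ) + 1 := by
    rw [← Nat.cast_add_one]
    congr 1
    omega
  have h₈ : (0 : ℝ) ≤ ((Nat.clog 2 n - 1 : ℕ) : ℝ) := Nat.cast_nonneg _
  rw [h₇]
  nlinarith

theorem work_le {W e n k m C : ℝ} (hm : 1 ≤ m) (hk : k ≤ 4 * m) (he : 0 ≤ e)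
    (hn : 0 ≤ n) (hW : W ≤ 300000 * ((k + 1) * (2 * e + n))) (hC : 3000000 ≤ C) :
    W ≤ C * (e + n) * m := by
  have h₁ : (k + 1) * (2 * e + n) ≤ (5 * m) * (2 * (e + n)) :=
    mul_le_mul (by linarith) (by linarith) (by positivity) (by positivity)
  have h₂ : 0 ≤ (e + n) * m := by positivity
  have h₃ := mul_le_mul_of_nonneg_right hC h₂
  linarith

/-- Of the 16 factors `n + 1`, five are the required power and eleven absorb the constant, as `2 ^
11 ≥ 100`. -/
theorem word_size {n : ℕ} (hn : 0 < n) : 100 * (n + 1) ^ 5 ≤ 2 ^ (16 * (Nat.log 2 n + 1)) := by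
  have h₁ : n + 1 ≤ 2 ^ (Nat.log 2 n + 1) := Nat.lt_pow_succ_log_self Nat.one_lt_two n
  have h₂ : 100 ≤ (n + 1) ^ 11 := by
    have : 2 ^ 11 ≤ (n + 1) ^ 11 := Nat.pow_le_pow_left (by omega) 11
    omega
  calc 100 * (n + 1) ^ 5 ≤ (n + 1) ^ 11 * (n + 1) ^ 5 := Nat.mul_le_mul_right _ h₂
    _ = (n + 1) ^ 16 := by rw [← pow_add]
    _ ≤ (2 ^ (Nat.log 2 n + 1)) ^ 16 := Nat.pow_le_pow_left h₁ 16
    _ = 2 ^ (16 * (Nat.log 2 n + 1)) := by rw [← pow_mul, Nat.mul_comm]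

/-- The witness is `l / min 1 ε` rounded up; as this quotient is at least 1, rounding at most
doubles it, turning the factor 4 into 8. -/
theorem exists_depth_param {l x ε : ℝ} (hl : 1 ≤ l) (hx : l ≤ 4 * x) (hε : 0 < ε) :
    ∃ B : ℕ, l ≤ B ∧ l ≤ B * ε ∧ (B : ℝ) ≤ 8 * (x / min 1 ε) := by
  have hmin : 0 < min 1 ε := lt_min one_pos hε
  have hB := Nat.le_ceil (l / min 1 ε)
  have hLB := (div_le_iff₀ hmin).1 hB
  refine ⟨⌈l / min 1 ε⌉₊, hLB.trans (mul_le_of_le_one_right (Nat.cast_nonneg _) (min_le_left _ _)),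
    hLB.trans (mul_le_mul_of_nonneg_left (min_le_right _ _) (Nat.cast_nonneg _)), ?_⟩
  have h₁ := Nat.ceil_lt_add_one (show 0 ≤ l / min 1 ε by positivity)
  have h₂ : l / min 1 ε ≤ 4 * (x / min 1 ε) := by
    rw [← mul_div_assoc]
    exact div_le_div_of_nonneg_right hx hmin.le
  have h₃ : 1 ≤ l / min 1 ε := by
    rw [le_div_iff₀ hmin, one_mul]
    exact (min_le_left _ _).trans hl
  linarith

theorem depth_le {D B x c : ℝ} {C : ℕ} (hD : D ≤ 400000 * B ^ 8) (hB0 : 0 ≤ B) (hB : B ≤ 8 * x)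
    (hx : 1 ≤ x) (hc : 400000 * 8 ^ 8 ≤ c) (hC : 8 ≤ C) : D ≤ c * x ^ C := by
  have h₂ : B ^ 8 ≤ (8 * x) ^ 8 := pow_le_pow_left₀ hB0 hB 8
  have h₃ : x ^ 8 ≤ x ^ C := pow_le_pow_right₀ hx hC
  rw [mul_pow] at h₂
  calc D ≤ 400000 * (8 ^ 8 * x ^ 8) := by linarith
    _ = 400000 * 8 ^ 8 * x ^ 8 := by ring
    _ ≤ c * x ^ C := mul_le_mul hc h₃ (by positivity) (le_trans (by norm_num) hc)

end WorkDepth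

/-! ### The main theorem and its constants -/

theorem mainTheorem6 :
    ∃ (algorithm : WorkDepth.Cmd) (c C : ℕ),
      ∀ (n : ℕ) (_ : 1 ≤ n) (G : SimpleGraph (Fin n)) (_ : DecidableRel G.Adj)
        (util : Fin n → ℝ) (cost : Sym2 (Fin n) → ℝ) (_ : ∀ e ∈ G.edgeFinset, 0 ≤ cost e)
        (ε : ℝ) (_ : 0 < ε)
        (A : WorkDepth.Arbiter) (s : WorkDepth.State) (_ : WorkDepth.IsInput G util cost ε s),
        ∃ s' : WorkDepth.State,
          WorkDepth.Exec (c * (Nat.log 2 n + 1)) A algorithm s s' ∧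
          (s'.work : ℝ) ≤
            C * ((G.edgeFinset.card + n : ℕ) : ℝ) * max 1 (Real.log (Real.log n)) ∧
          (s'.depth : ℝ) ≤ C * (max 1 (Real.log n) / min 1 ε) ^ C ∧
          (∑ v ∈ Finset.univ, (1 / 2 : ℝ) * util v - ∑ e ∈ G.edgeFinset, (1 / 4 : ℝ) * cost e)
              - ε * ∑ e ∈ G.edgeFinset, cost e ≤
            ∑ v ∈ s'.output n, util v
              - ∑ e ∈ G.edgeFinset with ∀ v ∈ e, v ∈ s'.output n, cost e := by
  -- The depth is at most `400000 * B ^ 8` with `B ≤ 8 * x`, which dictates the constant. It also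
  -- serves as exponent, so the existential keeps the large numeral hidden.
  obtain ⟨C, hC, hC8⟩ : ∃ C : ℕ, 400000 * 8 ^ 8 ≤ (C : ℝ) ∧ 8 ≤ C :=
    ⟨400000 * 8 ^ 8, by norm_num, by norm_num⟩
  refine ⟨WorkDepth.rounding, 16, C, ?_⟩
  intro n hn G _ util cost hcost ε hε A s hs
  obtain ⟨B, hB₁, hB₂, hB₃⟩ := WorkDepth.exists_depth_param
    (show (1 : ℝ) ≤ (Nat.clog 2 n : ℝ) + 1 from le_add_of_nonneg_left (Nat.cast_nonneg _))
    (WorkDepth.clog_add_one_le n) hε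
  obtain ⟨s', he, hW, hD, hout⟩ := WorkDepth.exec_rounding hn hcost hε A hs
    (WorkDepth.word_size hn) (fun J hJ => WorkDepth.levels_le hJ) (by exact_mod_cast hB₁) hB₂
  refine ⟨s', he, ?_, ?_, hout⟩
  · rw [Nat.cast_add]
    refine WorkDepth.work_le (le_max_left _ _) (WorkDepth.clog_clog_le n) (Nat.cast_nonneg _)
      (Nat.cast_nonneg _) ?_ (le_trans (by norm_num) hC)
    exact_mod_cast hW
  · refine WorkDepth.depth_le (B := B) (by exact_mod_cast hD) (Nat.cast_nonneg _) hB₃ ?_ hC hC8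
    rw [le_div_iff₀ (lt_min one_pos hε), one_mul]
    exact (min_le_left _ _).trans (le_max_left _ _)
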